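/- **Setting.** Write $\Delta=\tfrac14(\partial_{xx}+\partial_{yy})$ and $dA=\tfrac1\pi\,dx\,dy$. Let $Q(z)=q(|z|)$, $q:[0,\infty)\to\mathbb R$, be a lower semicontinuous radially symmetric potential on $\mathbb C$ with $Q(z)-2\log|z|\to+\infty$ as $|z|\to\infty$. Let $\sigma$ be its equilibrium measure, i.e. the minimizer of $$I_Q[\mu]=\iint\log\frac1{|z-w|}\,d\mu(z)\,d\mu(w)+\int Q\,d\mu$$ over all compactly supported Borel probability measures $\mu$ on $\mathbb C$. Let $S=\operatorname{supp}\sigma$ be the droplet, $U^\sigma(z)=\int\log\frac1{|z-w|}\,d\sigma(w)$, let $\gamma$ be the constant value of $Q+2U^\sigma$ on $S$, and put $\check Q=\gamma-2U^\sigma$. Assume that $Q$ is $C^2$-smooth in a neighbourhood of $S$, that $\Delta Q>0$ on $\partial S$, that $Q>\check Q$ on $\mathbb C\setminus S$, and that $$S=\bigcup_{k=0}^N\{a_k\le|z|\le b_k\},\qquad 0\le a_0<b_0<a_1<b_1<\cdots<a_N<b_N,\qquad N\ge1.$$ Fix $k\in\{0,\dots,N-1\}$, put $r_1=b_k$, $r_2=a_{k+1}$,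 and consider the gap $G=\{r_1<|z|<r_2\}$. Assume that $Q$ is $C^6$-smooth in some neighbourhood of $\partial G$. Let $$B=\frac{q(r_2)-q(r_1)}{\log(r_2/r_1)},\qquad m=m(n)=\lfloor Bn/2\rfloor,\qquad x=x(n)=\{Bn/2\}=Bn/2-m,$$ and define the correlation kernel and the $n$-weighted Szegő kernel by $$K_n(z,w)=\sum_{j=0}^{n-1}\frac{p_j(z)\overline{p_j(w)}}{\|p_j\|^2_{L^2(\mathbb C,dA)}},\qquad p_j(z)=z^je^{-\frac n2Q(z)},$$ $$\mathcal S^G(z,w;n)=\frac1{2\pi}\sum_{\ell=-\infty}^{+\infty}\frac{(z\bar w)^\ell}{\frac{r_1^{2\ell+1-2x}}{\sqrt{\Delta Q(r_1)}}+\frac{r_2^{2\ell+1-2x}}{\sqrt{\Delta Q(r_2)}}}$$ (a term of $K_n$ with $\|p_j\|=\infty$ is read as $0$). **Corollary 1.15 ("$r_1$-$r_2$ case").** Let $0\le\theta_1,\theta_2<2\pi$ be fixed, let $s,t\in\mathbb R$, and put $$z=\Big(r_1+\frac t{\sqrt{2n\Delta Q(r_1)}}\Big)e^{i\theta_1},\qquad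 w=\Big(r_2+\frac s{\sqrt{2n\Delta Q(r_2)}}\Big)e^{i\theta_2}.$$ Then, as $n\to\infty$, $$K_n(z,w)=\sqrt{2\pi n}\;\mathcal S^G(z,w;n)\,e^{im(\theta_1-\theta_2)}(r_1r_2)^{-x}e^{-\frac12(t^2+s^2)}+O(\log^3n),$$ uniformly for $s,t$ in any given compact subset of $\mathbb R$. (For all large $n$, uniformly in such $s,t$, the series defining $\mathcal S^G(z,w;n)$ converges absolutely.) -/

import Mathlib

open Real Filter Topology MeasureTheory ComplexConjugate

noncomputable section

namespace CoulombGas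

/-- The radially symmetric potential `Q(z) = q(|z|)`. Only the values of `q` on `[0, ∞)` matter. -/
def radialPotential (q : ℝ → ℝ) : ℂ → ℝ := fun z => q ‖z‖

/-- The Laplacian normalized as `Δ = ∂ ∂̄ = (1/4) (∂_xx + ∂_yy)`. -/
def quarterLaplacian (Q : ℂ → ℝ) (z : ℂ) : ℝ := (1 / 4) * Laplacian.laplacian Q z

/-- The normalized area measure `dA = (1/π) dx dy`. -/
def areaMeasure : Measure ℂ := ENNReal.ofReal π⁻¹ • volume

/-! ### Weighted potential theory -/

/-- A compactly supported Borel probability measure on `ℂ`. -/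
def IsCompactProbability (μ : Measure ℂ) : Prop :=
  IsProbabilityMeasure μ ∧ ∃ K : Set ℂ, IsCompact K ∧ μ Kᶜ = 0

/-- Finiteness of the weighted logarithmic energy. The kernel `log (1 / |z - w|)` is `+∞` on the
diagonal (while `Real.log` takes the value `0` there), so the diagonal has to be a null set. For
compactly supported `μ` and lower semicontinuous `Q`, the kernel and `Q` are bounded below on the
support of `μ`, hence the energy is finite if and only if both are integrable. -/
def HasFiniteEnergy (Q : ℂ → ℝ) (μ : Measure ℂ) : Prop :=
  (μ.prod μ) {p : ℂ × ℂ | p.1 = p.2} = 0 ∧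
    Integrable (fun p : ℂ × ℂ => Real.log (1 / ‖p.1 - p.2‖)) (μ.prod μ) ∧
    Integrable Q μ

open Classical in
/-- The weighted logarithmic energy
`I_Q[μ] = ∫∫ log (1 / |z - w|) dμ(z) dμ(w) + ∫ Q dμ ∈ (-∞, +∞]`
of a compactly supported probability measure `μ`. -/
def weightedEnergy (Q : ℂ → ℝ) (μ : Measure ℂ) : EReal :=
  if HasFiniteEnergy Q μ then
    (((∫ p : ℂ × ℂ, Real.log (1 / ‖p.1 - p.2‖) ∂(μ.prod μ)) + ∫ z, Q z ∂μ : ℝ) : EReal)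
  else ⊤

/-- `σ` is the equilibrium measure of `Q`: it minimizes the weighted logarithmic energy over all
compactly supported Borel probability measures. -/
def IsEquilibriumMeasure (Q : ℂ → ℝ) (σ : Measure ℂ) : Prop :=
  IsCompactProbability σ ∧
    ∀ μ : Measure ℂ, IsCompactProbability μ → weightedEnergy Q σ ≤ weightedEnergy Q μ

/-- The logarithmic potential `U^μ(z) = ∫ log (1 / |z - w|) dμ(w)`. -/
def logPotential (μ : Measure ℂ) (z : ℂ) : ℝ := ∫ w, Real.log (1 / ‖z - w‖) ∂μ

/-- Robin's constant `γ`, i.e. the constant value of `Q + 2 U^σ` on the support of the equilibrium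
measure `σ`, written as the `σ`-average of that function. -/
def robinConstant (Q : ℂ → ℝ) (σ : Measure ℂ) : ℝ := ∫ z, (Q z + 2 * logPotential σ z) ∂σ

/-- The obstacle function `γ - 2 U^σ`. -/
def obstacle (Q : ℂ → ℝ) (σ : Measure ℂ) (z : ℂ) : ℝ :=
  robinConstant Q σ - 2 * logPotential σ z

/-- `Q` is `C^k`-smooth in some neighbourhood of the set `E`. -/
def SmoothNear (k : ℕ) (Q : ℂ → ℝ) (E : Set ℂ) : Prop :=
  ∃ U : Set ℂ, IsOpen U ∧ E ⊆ U ∧ ContDiffOn ℝ k Q U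

/-- The open annulus `{r₁ < |z| < r₂}`. -/
def gap (r₁ r₂ : ℝ) : Set ℂ := {z | r₁ < ‖z‖ ∧ ‖z‖ < r₂}

/-- The standing assumptions on the potential `Q(z) = q(|z|)`, with equilibrium measure `σ`, whose
droplet (the support of `σ`) is the union of the annuli `{a k ≤ |z| ≤ b k}` for `k = 0, …, N`. -/
structure IsAnnularPotential (q : ℝ → ℝ) (σ : Measure ℂ) (N : ℕ) (a b : ℕ → ℝ) : Prop where
  lowerSemicontinuous : LowerSemicontinuous (radialPotential q)
  growth : Tendsto (fun z : ℂ => radialPotential q z - 2 * Real.log ‖z‖) (cocompact ℂ) atTop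
  equilibrium : IsEquilibriumMeasure (radialPotential q) σ
  smooth_droplet : SmoothNear 2 (radialPotential q) σ.support
  laplacian_pos : ∀ z ∈ frontier σ.support, 0 < quarterLaplacian (radialPotential q) z
  obstacle_lt : ∀ z, z ∉ σ.support →
    obstacle (radialPotential q) σ z < radialPotential q z
  nonneg : 0 ≤ a 0
  lt_annulus : ∀ k ≤ N, a k < b k
  lt_gap : ∀ k < N, b k < a (k + 1)
  droplet_eq : σ.support = ⋃ k ≤ N, {z : ℂ | a k ≤ ‖z‖ ∧ ‖z‖ ≤ b k}

/-! ### The correlation kernel -/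

/-- The weighted monomial `p_j(z) = z^j e^{-n Q(z) / 2}`. -/
def weightedMonomial (Q : ℂ → ℝ) (n j : ℕ) (z : ℂ) : ℂ :=
  z ^ j * (Real.exp (-((n : ℝ) / 2) * Q z) : ℂ)

/-- The canonical correlation kernel `K_n(z, w) = ∑_{j < n} p_j(z) conj(p_j(w)) / ‖p_j‖²`, with
the norm of `L²(ℂ, dA)`. -/
def correlationKernel (Q : ℂ → ℝ) (n : ℕ) (z w : ℂ) : ℂ :=
  ∑ j ∈ Finset.range n,
    weightedMonomial Q n j z * conj (weightedMonomial Q n j w) /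
      ((∫ u, ‖weightedMonomial Q n j u‖ ^ 2 ∂areaMeasure : ℝ) : ℂ)

/-! ### The weighted Szegő kernel of a gap -/

/-- The parameter `B = (q(r₂) - q(r₁)) / log (r₂ / r₁)` of the gap `{r₁ < |z| < r₂}`. -/
def gapParameter (q : ℝ → ℝ) (r₁ r₂ : ℝ) : ℝ := (q r₂ - q r₁) / Real.log (r₂ / r₁)

/-- The integer part `m = ⌊B n / 2⌋`. -/
def gapFloor (q : ℝ → ℝ) (r₁ r₂ : ℝ) (n : ℕ) : ℤ := ⌊gapParameter q r₁ r₂ * n / 2⌋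

/-- The fractional part `x = {B n / 2}`. -/
def gapFract (q : ℝ → ℝ) (r₁ r₂ : ℝ) (n : ℕ) : ℝ := Int.fract (gapParameter q r₁ r₂ * n / 2)

/-- The `ℓ`-th term of the series of the `n`-weighted Szegő kernel, without the factor `1/(2π)`. -/
def szegoTerm (q : ℝ → ℝ) (r₁ r₂ : ℝ) (n : ℕ) (z w : ℂ) (ℓ : ℤ) : ℂ :=
  (z * conj w) ^ ℓ /
    ((r₁ ^ (2 * (ℓ : ℝ) + 1 - 2 * gapFract q r₁ r₂ n) /
          √(quarterLaplacian (radialPotential q) (r₁ : ℂ)) +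
        r₂ ^ (2 * (ℓ : ℝ) + 1 - 2 * gapFract q r₁ r₂ n) /
          √(quarterLaplacian (radialPotential q) (r₂ : ℂ)) : ℝ) : ℂ)

/-- The `n`-weighted Szegő kernel of the gap `{r₁ < |z| < r₂}`. -/
def szegoKernel (q : ℝ → ℝ) (r₁ r₂ : ℝ) (n : ℕ) (z w : ℂ) : ℂ :=
  1 / (2 * (π : ℂ)) * ∑' ℓ : ℤ, szegoTerm q r₁ r₂ n z w ℓ

/-- The point `(ρ + t / √(2 n ΔQ(ρ))) e^{iθ}` at microscopic distance from the circle `|z| = ρ`. -/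
def edgePoint (q : ℝ → ℝ) (ρ : ℝ) (n : ℕ) (θ t : ℝ) : ℂ :=
  ((ρ + t / √(2 * n * quarterLaplacian (radialPotential q) (ρ : ℂ)) : ℝ) : ℂ) *
    Complex.exp (Complex.I * θ)

end CoulombGas

end

open CoulombGas

/-! Let L(r) = ∫ log max(r,|w|) dσ(w), the circular mean of -U^σ. Because Q is radial, testing the
minimality of σ against uniform measures on circles gives q ≥ γ + 2L at every positive radius.
Equality holds at positive radii of the droplet, and the inequality is strict in the gap. If M is
the σ-mass of {|w| ≤ r₁}, then L - M log r is constant on [r₁,r₂] and strictly larger outside it.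
Hence f(r) = q(r) - 2M log r - c is positive on (0,∞) except at r₁ and r₂, where it vanishes
(`IsAnnularPotential.radial_obstacle`). Comparing the two zeros gives B = 2M. Since log r is
harmonic in the plane, the quadratic coefficient of f at r_i is 2ΔQ(r_i), so both zeros are
nondegenerate wells.

Polar coordinates turn ‖p_j‖² into e^{-nc} · 2∫ r^p e^{-n f(r)} dr, with p = 2j+1-2nM. As nM = m +
x, this is p = 2ℓ+1-2x with ℓ = j-m. Laplace's method at the two wells gives √(2π/n) (r₁^p/√ΔQ(r₁) +
r₂^p/√ΔQ(r₂)), which is the Szegő denominator.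

The delicate point is uniformity in j. The relative error is allowed to be O(n^{-1/2}) e^{β|p|} with
β small (`IsDoubleWell.exists_inv_laplaceCoeff`). For |p| of order n this bound exceeds a constant,
so those terms need only a crude two-sided comparison. Near the two edges |z w̄| is close to r₁r₂,
the geometric mean of r₁² and r₂². The Szegő terms therefore decay almost like (r₁/r₂)^{|ℓ|}, which
beats e^{β|p|} for β = log(r₂/r₁)/4. Summing over ℓ gives an O(n^{-1/2}) error, including the
indices missing from 0 ≤ j < n (`IsDoubleWell.exists_sum_sub_tsum_le`).

What remains of z and w are the edge factors r^{-x} e^{-n f(r)/2}, which tend to r_i^{-x} times a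
Gaussian with error O(n^{-1/2}) (`IsWell.exists_edgeFactor`). Against the prefactor of order √n the
total error is O(1), which is stronger than O(log³ n). -/

noncomputable section

namespace CoulombGas

/-! ### The uniform measure on a circle -/

/-- The logarithmic kernel `log (1 / |z - w|)`. -/
def logKernel (p : ℂ × ℂ) : ℝ := Real.log (1 / ‖p.1 - p.2‖)

/-- The diagonal of `ℂ × ℂ`. -/
def diagonalSet : Set (ℂ × ℂ) := {p | p.1 = p.2}

/-- The uniform probability measure on the circle `|z| = r`. -/
def circleMeasure (r : ℝ) : Measure ℂ :=
  (ENNReal.ofReal (2 * π)⁻¹ • volume.restrict (Set.Ioc 0 (2 * π))).map (circleMap 0 r)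

lemma logKernel_eq (z w : ℂ) : logKernel (z, w) = -Real.log ‖z - w‖ := by
  simp [logKernel]

lemma logKernel_swap : logKernel ∘ Prod.swap = logKernel := by
  ext p; simp [logKernel, norm_sub_rev]

@[fun_prop]
lemma measurable_logKernel : Measurable logKernel := by
  unfold logKernel; fun_prop

lemma measurableSet_diagonalSet : MeasurableSet diagonalSet :=
  (isClosed_eq continuous_fst continuous_snd).measurableSet

lemma logPotential_eq (μ : Measure ℂ) (z : ℂ) :
    logPotential μ z = ∫ w, logKernel (z, w) ∂μ := rfl

instance isProbabilityMeasure_circleMeasure (r : ℝ) : IsProbabilityMeasure (circleMeasure r) := by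
  have : IsProbabilityMeasure
      (ENNReal.ofReal (2 * π)⁻¹ • volume.restrict (Set.Ioc 0 (2 * π))) := by
    constructor
    rw [Measure.smul_apply, Measure.restrict_apply_univ, Real.volume_Ioc, smul_eq_mul, sub_zero,
      ← ENNReal.ofReal_mul (by positivity), inv_mul_cancel₀ (by positivity), ENNReal.ofReal_one]
  exact Measure.isProbabilityMeasure_map (measurable_circleMap 0 r).aemeasurable

lemma ae_circleMeasure {r : ℝ} (hr : 0 < r) : ∀ᵐ z ∂circleMeasure r, ‖z‖ = r := by
  rw [circleMeasure, ae_map_iff (measurable_circleMap 0 r).aemeasurable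
    (measurableSet_eq_fun measurable_norm measurable_const)]
  exact ae_of_all _ fun θ => by simp [abs_of_pos hr]

lemma circleMeasure_singleton {r : ℝ} (hr : 0 < r) (w : ℂ) : circleMeasure r {w} = 0 := by
  rw [circleMeasure, Measure.map_apply (measurable_circleMap 0 r) (measurableSet_singleton w)]
  have h : (circleMap 0 r ⁻¹' {w}).Countable :=
    (Set.countable_singleton w).preimage_circleMap 0 hr.ne'
  simp [h.measure_zero]

lemma integrable_circleMeasure {r : ℝ} {f : ℂ → ℝ} (hm : Measurable f)
    (hf : CircleIntegrable f 0 r) : Integrable f (circleMeasure r) := by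
  rw [circleMeasure, integrable_map_measure hm.aestronglyMeasurable
    (measurable_circleMap 0 r).aemeasurable]
  refine Integrable.smul_measure ?_ ENNReal.ofReal_ne_top
  have h := hf
  rw [circleIntegrable_def, intervalIntegrable_iff_integrableOn_Ioc_of_le (by positivity)] at h
  exact h

lemma integral_circleMeasure {r : ℝ} {f : ℂ → ℝ} (hm : Measurable f) :
    ∫ z, f z ∂circleMeasure r = circleAverage f 0 r := by
  rw [circleMeasure, integral_map (measurable_circleMap 0 r).aemeasurable hm.aestronglyMeasurable,
    integral_smul_measure, circleAverage_def,
    intervalIntegral.integral_of_le (by positivity), ENNReal.toReal_ofReal (by positivity)]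

lemma isCompactProbability_circleMeasure {r : ℝ} (hr : 0 < r) :
    IsCompactProbability (circleMeasure r) := by
  refine ⟨inferInstance, Metric.closedBall 0 r, isCompact_closedBall _ _, ?_⟩
  have := ae_circleMeasure hr
  rw [ae_iff] at this
  refine measure_mono_null (fun z hz => ?_) this
  simp only [Set.mem_compl_iff, Metric.mem_closedBall, dist_zero_right, not_le] at hz
  exact fun h => absurd h hz.ne'

lemma measurable_log_norm_sub (w : ℂ) : Measurable fun z : ℂ => Real.log ‖z - w‖ := by
  fun_prop

lemma integrable_log_norm_sub_circleMeasure (r : ℝ) (w : ℂ) :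
    Integrable (fun z => Real.log ‖z - w‖) (circleMeasure r) :=
  integrable_circleMeasure (measurable_log_norm_sub w) (circleIntegrable_log_norm_sub_const r)

/-- Jensen's formula for a linear function: the potential of a uniform circle is constant inside it,
and outside it is that of a point mass at the origin. -/
lemma integral_log_norm_sub_circleMeasure {r : ℝ} (hr : 0 < r) (w : ℂ) :
    ∫ z, Real.log ‖z - w‖ ∂circleMeasure r = Real.log (max r ‖w‖) := by
  rw [integral_circleMeasure (measurable_log_norm_sub w),
    circleAverage_log_norm_sub_const_eq_log_radius_add_posLog hr.ne', zero_sub, norm_neg]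
  rcases le_total ‖w‖ r with h | h
  · rw [max_eq_left h, (posLog_eq_zero_iff _).2, add_zero]
    rw [abs_of_nonneg (by positivity), inv_mul_le_iff₀ hr]
    linarith
  · have hw : 0 < ‖w‖ := hr.trans_le h
    rw [max_eq_right h, posLog_eq_log, Real.log_mul (by positivity) hw.ne', Real.log_inv]
    · ring
    · rw [abs_of_nonneg (by positivity), le_inv_mul_iff₀ hr]
      linarith

/-- Since |log x| = 2 log⁺ x - log x, the mean of |log| over the circle is controlled by the exact
mean of log, uniformly in w. No energy assumption on μ is needed, so circles can be tested against
any compactly supported finite measure. -/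
lemma integrable_logKernel_circleMeasure_prod {r R : ℝ} (hr : 0 < r) (μ : Measure ℂ)
    [IsFiniteMeasure μ] (hμ : ∀ᵐ w ∂μ, ‖w‖ ≤ R) :
    Integrable logKernel ((circleMeasure r).prod μ) := by
  rw [integrable_prod_iff' measurable_logKernel.aestronglyMeasurable]
  have hint : ∀ w : ℂ, Integrable (fun z => logKernel (z, w)) (circleMeasure r) := fun w => by
    simp only [logKernel_eq]
    exact (integrable_log_norm_sub_circleMeasure r w).neg
  refine ⟨ae_of_all _ hint, ?_⟩
  refine Integrable.of_bound (C := 2 * log⁺ (r + R) - Real.log r) ?_ ?_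
  · exact measurable_logKernel.norm.stronglyMeasurable.integral_prod_left'.aestronglyMeasurable
  · filter_upwards [hμ] with w hw
    rw [Real.norm_of_nonneg (integral_nonneg fun _ => norm_nonneg _)]
    have hlog := integrable_log_norm_sub_circleMeasure r w
    calc ∫ z, ‖logKernel (z, w)‖ ∂circleMeasure r
        ≤ ∫ z, (2 * log⁺ (r + R) - Real.log ‖z - w‖) ∂circleMeasure r := by
          refine integral_mono_ae (hint w).norm ((integrable_const _).sub hlog) ?_
          filter_upwards [ae_circleMeasure hr] with z hz
          have h1 : ‖z - w‖ ≤ r + R := (norm_sub_le z w).trans (by linarith)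
          have h2 := posLog_le_posLog (norm_nonneg _) h1
          have h3 := half_mul_log_add_log_abs (x := ‖z - w‖)
          simp only [logKernel_eq, norm_neg, Real.norm_eq_abs]
          linarith
      _ = 2 * log⁺ (r + R) - Real.log (max r ‖w‖) := by
          rw [integral_sub (integrable_const _) hlog, integral_log_norm_sub_circleMeasure hr]
          simp
      _ ≤ _ := by
          have := Real.log_le_log hr (le_max_left r ‖w‖)
          linarith

lemma circleMeasure_prod_diagonalSet {r : ℝ} (hr : 0 < r) (μ : Measure ℂ) [IsFiniteMeasure μ] :
    (μ.prod (circleMeasure r)) diagonalSet = 0 := by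
  rw [Measure.measure_prod_null measurableSet_diagonalSet]
  refine ae_of_all _ fun z => ?_
  change circleMeasure r (Prod.mk z ⁻¹' diagonalSet) = 0
  convert circleMeasure_singleton hr z using 2
  ext w; simp [diagonalSet, eq_comm]

/-! ### Finiteness of the equilibrium energy -/

lemma IsCompactProbability.exists_norm_le {μ : Measure ℂ} (h : IsCompactProbability μ) :
    ∃ R : ℝ, ∀ᵐ w ∂μ, ‖w‖ ≤ R := by
  obtain ⟨-, K, hK, hμ⟩ := h
  obtain ⟨R, hR⟩ := hK.isBounded.exists_norm_le
  refine ⟨R, ?_⟩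
  rw [ae_iff]
  exact measure_mono_null (fun z hz hzK => hz (hR z hzK)) hμ

lemma hasFiniteEnergy_circleMeasure (q : ℝ → ℝ) {r : ℝ} (hr : 0 < r) :
    HasFiniteEnergy (radialPotential q) (circleMeasure r) := by
  refine ⟨circleMeasure_prod_diagonalSet hr _, ?_, ?_⟩
  · exact integrable_logKernel_circleMeasure_prod hr _
      ((ae_circleMeasure hr).mono fun z hz => hz.le)
  · refine (integrable_const (q r)).congr ?_
    filter_upwards [ae_circleMeasure hr] with z hz
    simp [radialPotential, hz]

/-- The unit circle is a competitor of finite energy, so the minimum cannot be `⊤`. -/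
lemma IsEquilibriumMeasure.hasFiniteEnergy {q : ℝ → ℝ} {σ : Measure ℂ}
    (h : IsEquilibriumMeasure (radialPotential q) σ) : HasFiniteEnergy (radialPotential q) σ := by
  by_contra hn
  have h1 := h.2 _ (isCompactProbability_circleMeasure one_pos)
  rw [weightedEnergy, if_neg hn, weightedEnergy, if_pos (hasFiniteEnergy_circleMeasure q one_pos),
    top_le_iff] at h1
  exact EReal.coe_ne_top _ h1

/-! ### The variational inequality -/

lemma nonneg_of_forall_nonneg_add_mul {X Y : ℝ}
    (h : ∀ ε : ℝ, 0 < ε → ε < 1 → 0 ≤ X + ε * Y) : 0 ≤ X := by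
  have hc : Tendsto (fun ε : ℝ => X + ε * Y) (𝓝[>] 0) (𝓝 (X + 0 * Y)) :=
    ((continuous_const.add (continuous_id.mul continuous_const)).tendsto 0).mono_left
      nhdsWithin_le_nhds
  rw [zero_mul, add_zero] at hc
  refine ge_of_tendsto hc ?_
  filter_upwards [Ioo_mem_nhdsGT (zero_lt_one' ℝ)] with ε hε using h ε hε.1 hε.2

lemma integral_mixture {α : Type*} [MeasurableSpace α] {μ ν : Measure α} {f : α → ℝ}
    (hμ : Integrable f μ) (hν : Integrable f ν) {a b : ℝ} (ha : 0 ≤ a) (hb : 0 ≤ b) :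
    ∫ x, f x ∂(ENNReal.ofReal a • μ + ENNReal.ofReal b • ν) =
      a * ∫ x, f x ∂μ + b * ∫ x, f x ∂ν := by
  rw [integral_add_measure (hμ.smul_measure ENNReal.ofReal_ne_top)
    (hν.smul_measure ENNReal.ofReal_ne_top), integral_smul_measure, integral_smul_measure,
    ENNReal.toReal_ofReal ha, ENNReal.toReal_ofReal hb, smul_eq_mul, smul_eq_mul]

lemma integrable_mixture {α : Type*} [MeasurableSpace α] {μ ν : Measure α} {f : α → ℝ}
    (hμ : Integrable f μ) (hν : Integrable f ν) (a b : ℝ) :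
    Integrable f (ENNReal.ofReal a • μ + ENNReal.ofReal b • ν) :=
  (hμ.smul_measure ENNReal.ofReal_ne_top).add_measure (hν.smul_measure ENNReal.ofReal_ne_top)

lemma integrable_logPotential {σ μ : Measure ℂ} [SFinite σ]
    (h : Integrable logKernel (μ.prod σ)) : Integrable (logPotential σ) μ :=
  h.integral_prod_left

lemma integral_logPotential {σ μ : Measure ℂ} [SFinite σ] [SFinite μ]
    (h : Integrable logKernel (μ.prod σ)) :
    ∫ z, logPotential σ z ∂μ = ∫ p, logKernel p ∂(μ.prod σ) :=
  (integral_prod _ h).symm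

lemma robinConstant_eq {Q : ℂ → ℝ} {σ : Measure ℂ} [IsProbabilityMeasure σ]
    (hσ : HasFiniteEnergy Q σ) :
    robinConstant Q σ = ∫ z, Q z ∂σ + 2 * ∫ p, logKernel p ∂(σ.prod σ) := by
  have h : Integrable logKernel (σ.prod σ) := hσ.2.1
  rw [robinConstant, integral_add hσ.2.2 ((integrable_logPotential h).const_mul 2),
    integral_const_mul, integral_logPotential h]

/-- The first-order optimality condition at the equilibrium measure, tested against `μ`. -/
lemma IsEquilibriumMeasure.variational {Q : ℂ → ℝ} {σ μ : Measure ℂ}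
    (h : IsEquilibriumMeasure Q σ) (hσ : HasFiniteEnergy Q σ)
    (hμ : IsCompactProbability μ) (hμe : HasFiniteEnergy Q μ)
    (hdiag : (μ.prod σ) diagonalSet = 0) (hint : Integrable logKernel (μ.prod σ)) :
    robinConstant Q σ ≤ ∫ z, (Q z + 2 * logPotential σ z) ∂μ := by
  have := h.1.1
  have := hμ.1
  have hint' : Integrable logKernel (σ.prod μ) := by
    have := hint.swap
    rwa [logKernel_swap] at this
  have hcross : ∫ p, logKernel p ∂(σ.prod μ) = ∫ p, logKernel p ∂(μ.prod σ) := by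
    rw [← integral_prod_swap]
    exact integral_congr_ae (ae_of_all _ fun p => congrFun logKernel_swap p)
  have hdiag' : (σ.prod μ) diagonalSet = 0 := by
    rw [← Measure.prod_swap, Measure.map_apply measurable_swap measurableSet_diagonalSet]
    convert hdiag using 2
    ext p; simp [diagonalSet, eq_comm]
  have hσi : Integrable logKernel (σ.prod σ) := hσ.2.1
  have hμi : Integrable logKernel (μ.prod μ) := hμe.2.1
  rw [robinConstant_eq hσ, integral_add hμe.2.2 ((integrable_logPotential hint).const_mul 2),
    integral_const_mul, integral_logPotential hint, ← sub_nonneg]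
  set A := ∫ p, logKernel p ∂(σ.prod σ)
  set C := ∫ p, logKernel p ∂(μ.prod σ)
  set D := ∫ p, logKernel p ∂(μ.prod μ)
  set a := ∫ z, Q z ∂σ
  set d := ∫ z, Q z ∂μ
  -- The energy of (1-ε)σ + εμ exceeds that of σ by ε(X + εY). Here X is the first variation and Y
  -- the logarithmic energy of μ - σ. Letting ε → 0 makes the sign of Y irrelevant.
  refine nonneg_of_forall_nonneg_add_mul (Y := A - 2 * C + D) fun ε hε hε1 => ?_
  have h1ε : 0 ≤ 1 - ε := by linarith
  set ν := ENNReal.ofReal (1 - ε) • σ + ENNReal.ofReal ε • μ with hν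
  have hνprod : ν.prod ν =
      ENNReal.ofReal (1 - ε) • (ENNReal.ofReal (1 - ε) • σ.prod σ + ENNReal.ofReal ε • μ.prod σ) +
      ENNReal.ofReal ε • (ENNReal.ofReal (1 - ε) • σ.prod μ + ENNReal.ofReal ε • μ.prod μ) := by
    have : SFinite (ENNReal.ofReal (1 - ε) • σ) := inferInstance
    rw [hν, Measure.prod_add, Measure.prod_smul_right, Measure.prod_smul_right, Measure.add_prod,
      Measure.add_prod, Measure.prod_smul_left, Measure.prod_smul_left, Measure.prod_smul_left,
      Measure.prod_smul_left]
  have hνc : IsCompactProbability ν := by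
    refine ⟨⟨?_⟩, ?_⟩
    · rw [hν]
      simp only [Measure.coe_add, Measure.coe_smul, Pi.add_apply, Pi.smul_apply, measure_univ,
        smul_eq_mul, mul_one]
      rw [← ENNReal.ofReal_add h1ε hε.le]
      simp
    · obtain ⟨K, hK, hK0⟩ := h.1.2
      obtain ⟨K', hK', hK0'⟩ := hμ.2
      refine ⟨K ∪ K', hK.union hK', ?_⟩
      have e1 : σ (K ∪ K')ᶜ = 0 :=
        measure_mono_null (Set.compl_subset_compl.2 Set.subset_union_left) hK0
      have e2 : μ (K ∪ K')ᶜ = 0 :=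
        measure_mono_null (Set.compl_subset_compl.2 Set.subset_union_right) hK0'
      rw [hν, Measure.add_apply, Measure.smul_apply, Measure.smul_apply, e1, e2]
      simp
  have hi1 := integrable_mixture hσi hint (1 - ε) ε
  have hi2 := integrable_mixture hint' hμi (1 - ε) ε
  have hνe : HasFiniteEnergy Q ν := by
    refine ⟨?_, ?_, integrable_mixture hσ.2.2 hμe.2.2 _ _⟩
    · have e1 : (σ.prod σ) diagonalSet = 0 := hσ.1
      have e2 : (μ.prod μ) diagonalSet = 0 := hμe.1
      change (ν.prod ν) diagonalSet = 0
      rw [hνprod]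
      simp [e1, e2, hdiag, hdiag']
    · change Integrable logKernel (ν.prod ν)
      rw [hνprod]
      exact integrable_mixture hi1 hi2 _ _
  have hmin := h.2 ν hνc
  rw [weightedEnergy, if_pos hσ, weightedEnergy, if_pos hνe, EReal.coe_le_coe_iff] at hmin
  change A + a ≤ ∫ p, logKernel p ∂(ν.prod ν) + _ at hmin
  rw [hνprod, integral_mixture hi1 hi2 h1ε hε.le, integral_mixture hσi hint h1ε hε.le,
    integral_mixture hint' hμi h1ε hε.le, integral_mixture hσ.2.2 hμe.2.2 h1ε hε.le, hcross] at hmin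
  change A + a ≤ (1 - ε) * ((1 - ε) * A + ε * C) + ε * ((1 - ε) * C + ε * D)
    + ((1 - ε) * a + ε * d) at hmin
  have key : 0 ≤ ε * (d + 2 * C - (a + 2 * A) + ε * (A - 2 * C + D)) := by
    linarith [hmin, show ε * (d + 2 * C - (a + 2 * A) + ε * (A - 2 * C + D)) =
      (1 - ε) * ((1 - ε) * A + ε * C) + ε * ((1 - ε) * C + ε * D)
        + ((1 - ε) * a + ε * d) - (A + a) by ring]
  exact nonneg_of_mul_nonneg_right key hε

/-! ### The equilibrium conditions averaged over circles -/

/-- The function `r ↦ ∫ log (max r |w|) dσ(w)`, the circular mean of `-U^σ`. -/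
def radialMeanLog (σ : Measure ℂ) (r : ℝ) : ℝ := ∫ w, Real.log (max r ‖w‖) ∂σ

section

variable {q : ℝ → ℝ} {σ : Measure ℂ}

lemma integral_logPotential_circleMeasure (hσ : IsCompactProbability σ) {r : ℝ} (hr : 0 < r) :
    ∫ z, logPotential σ z ∂circleMeasure r = -radialMeanLog σ r := by
  have := hσ.1
  obtain ⟨R, hR⟩ := hσ.exists_norm_le
  have hint := integrable_logKernel_circleMeasure_prod hr σ hR
  rw [integral_logPotential hint, integral_prod_symm _ hint, radialMeanLog, ← integral_neg]
  refine integral_congr_ae (ae_of_all _ fun w => ?_)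
  simp only [logKernel_eq]
  rw [integral_neg, integral_log_norm_sub_circleMeasure hr]

lemma integrable_logPotential_circleMeasure (hσ : IsCompactProbability σ) {r : ℝ} (hr : 0 < r) :
    Integrable (logPotential σ) (circleMeasure r) := by
  have := hσ.1
  obtain ⟨R, hR⟩ := hσ.exists_norm_le
  exact integrable_logPotential (integrable_logKernel_circleMeasure_prod hr σ hR)

lemma integrable_log_max (hσ : IsCompactProbability σ) {r : ℝ} (hr : 0 < r) :
    Integrable (fun w : ℂ => Real.log (max r ‖w‖)) σ := by
  have := hσ.1
  obtain ⟨R, hR⟩ := hσ.exists_norm_le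
  refine Integrable.of_bound (C := max |Real.log r| |Real.log (max r R)|)
    (by fun_prop : Measurable _).aestronglyMeasurable ?_
  filter_upwards [hR] with w hw
  have h1 : Real.log r ≤ Real.log (max r ‖w‖) := Real.log_le_log hr (le_max_left _ _)
  have h2 : Real.log (max r ‖w‖) ≤ Real.log (max r R) :=
    Real.log_le_log (hr.trans_le (le_max_left _ _)) (max_le_max_left _ hw)
  exact abs_le_max_abs_abs h1 h2

lemma prod_diagonalSet_comm (μ ν : Measure ℂ) [SFinite μ] [SFinite ν] :
    (μ.prod ν) diagonalSet = (ν.prod μ) diagonalSet := by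
  rw [← Measure.prod_swap, Measure.map_apply measurable_swap measurableSet_diagonalSet]
  congr 1
  ext p; simp [diagonalSet, eq_comm]

lemma integral_radialPotential_circleMeasure (q : ℝ → ℝ) {r : ℝ} (hr : 0 < r) :
    ∫ z, radialPotential q z ∂circleMeasure r = q r := by
  have : ∫ z, radialPotential q z ∂circleMeasure r = ∫ _, q r ∂circleMeasure r := by
    refine integral_congr_ae ?_
    filter_upwards [ae_circleMeasure hr] with z hz
    simp [radialPotential, hz]
  simpa using this

lemma integral_pos_of_ae_pos {μ : Measure ℂ} [IsProbabilityMeasure μ] {f : ℂ → ℝ}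
    (hi : Integrable f μ) (hf : ∀ᵐ z ∂μ, 0 < f z) : 0 < ∫ z, f z ∂μ := by
  rw [integral_pos_iff_support_of_nonneg_ae (hf.mono fun z hz => hz.le) hi, pos_iff_ne_zero]
  intro h0
  have h2 : ∀ᵐ z ∂μ, False := by
    filter_upwards [hf, measure_eq_zero_iff_ae_notMem.1 h0] with z hz hz'
    exact hz' hz.ne'
  exact h2.exists.elim fun _ h => h

/-- Q is constant on a circle, so the variational inequality tested there is already a pointwise
statement about q, with no exceptional radii. -/
lemma robinConstant_add_le (h : IsEquilibriumMeasure (radialPotential q) σ) {r : ℝ} (hr : 0 < r) :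
    robinConstant (radialPotential q) σ + 2 * radialMeanLog σ r ≤ q r := by
  have := h.1.1
  obtain ⟨R, hR⟩ := h.1.exists_norm_le
  have hv := h.variational h.hasFiniteEnergy (isCompactProbability_circleMeasure hr)
    (hasFiniteEnergy_circleMeasure q hr)
    (by rw [prod_diagonalSet_comm]; exact circleMeasure_prod_diagonalSet hr σ)
    (integrable_logKernel_circleMeasure_prod hr σ hR)
  rw [integral_add (hasFiniteEnergy_circleMeasure q hr).2.2
    ((integrable_logPotential_circleMeasure h.1 hr).const_mul 2), integral_const_mul,
    integral_logPotential_circleMeasure h.1 hr, integral_radialPotential_circleMeasure q hr] at hv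
  linarith

/-- Strictness comes from averaging the pointwise obstacle inequality over the circle; the
variational inequality would give only ≤. -/
lemma robinConstant_add_lt (h : IsEquilibriumMeasure (radialPotential q) σ) {r : ℝ} (hr : 0 < r)
    (hlt : ∀ z : ℂ, ‖z‖ = r → obstacle (radialPotential q) σ z < radialPotential q z) :
    robinConstant (radialPotential q) σ + 2 * radialMeanLog σ r < q r := by
  have hi1 := (hasFiniteEnergy_circleMeasure q hr).2.2
  have hi2 := (integrable_logPotential_circleMeasure h.1 hr).const_mul 2
  have hi3 : Integrable (fun z => radialPotential q z + 2 * logPotential σ z) (circleMeasure r) :=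
    hi1.add hi2
  have hpos : ∀ᵐ z ∂circleMeasure r,
      0 < radialPotential q z + 2 * logPotential σ z - robinConstant (radialPotential q) σ := by
    filter_upwards [ae_circleMeasure hr] with z hz
    have := hlt z hz
    rw [obstacle] at this
    linarith
  have h1 : 0 < ∫ z, (radialPotential q z + 2 * logPotential σ z
      - robinConstant (radialPotential q) σ) ∂circleMeasure r :=
    integral_pos_of_ae_pos (hi3.sub (integrable_const _)) hpos
  rw [integral_sub hi3 (integrable_const _), integral_add hi1 hi2, integral_const_mul,
    integral_logPotential_circleMeasure h.1 hr, integral_radialPotential_circleMeasure q hr] at h1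
  simp only [integral_const, probReal_univ, smul_eq_mul, one_mul] at h1
  linarith

/-- Equality in the equilibrium condition almost everywhere. -/
lemma ae_add_logPotential_eq (h : IsEquilibriumMeasure (radialPotential q) σ) :
    ∀ᵐ z ∂σ, radialPotential q z + 2 * logPotential σ z = robinConstant (radialPotential q) σ := by
  have := h.1.1
  have hσ := h.hasFiniteEnergy
  have hL : Integrable logKernel (σ.prod σ) := hσ.2.1
  set Q := radialPotential q
  set γ := robinConstant Q σ with hγ
  have hint : Integrable (fun z => Q z + 2 * logPotential σ z) σ :=
    hσ.2.2.add ((integrable_logPotential hL).const_mul 2)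
  obtain ⟨f, hf, hfe⟩ := hint.aestronglyMeasurable
  -- If the inequality failed on a set of positive σ-measure, the normalized restriction of σ to
  -- that set would violate the variational inequality. It has finite energy because it is dominated
  -- by a multiple of σ. The measurable representative `f` makes the set measurable.
  have hge : ∀ᵐ z ∂σ, γ ≤ Q z + 2 * logPotential σ z := by
    by_contra hcon
    set A : Set ℂ := {z | f z < γ}
    have hAm : MeasurableSet A := measurableSet_lt hf.measurable measurable_const
    have hA0 : σ A ≠ 0 := by
      intro h0
      refine hcon ?_
      filter_upwards [hfe, measure_eq_zero_iff_ae_notMem.1 h0] with z hz hz'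
      rw [hz]
      exact not_lt.1 hz'
    set c : ENNReal := (σ A)⁻¹ with hc
    have hctop : c ≠ ⊤ := ENNReal.inv_ne_top.2 hA0
    set μ : Measure ℂ := c • σ.restrict A with hμ
    have hprob : IsProbabilityMeasure μ := by
      constructor
      rw [hμ, Measure.smul_apply, Measure.restrict_apply_univ, smul_eq_mul, hc,
        ENNReal.inv_mul_cancel hA0 (measure_ne_top σ A)]
    have hcross : μ.prod σ = c • (σ.prod σ).restrict (A ×ˢ Set.univ) := by
      rw [hμ, Measure.prod_smul_left, ← Measure.prod_restrict, Measure.restrict_univ]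
    have hself : μ.prod μ = c • c • (σ.prod σ).restrict (A ×ˢ A) := by
      rw [hμ, Measure.prod_smul_left, Measure.prod_smul_right, ← Measure.prod_restrict]
    have hnull : ∀ s, (σ.prod σ).restrict s diagonalSet = 0 := fun s =>
      le_antisymm ((Measure.restrict_apply_le s diagonalSet).trans (le_of_eq hσ.1)) zero_le
    have hμc : IsCompactProbability μ := by
      refine ⟨hprob, ?_⟩
      obtain ⟨K, hK, hK0⟩ := h.1.2
      refine ⟨K, hK, ?_⟩
      have : σ.restrict A Kᶜ = 0 :=
        le_antisymm ((Measure.restrict_apply_le A Kᶜ).trans hK0.le) zero_le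
      rw [hμ, Measure.smul_apply, this, smul_zero]
    have hμe : HasFiniteEnergy Q μ := by
      refine ⟨?_, ?_, hσ.2.2.restrict.smul_measure hctop⟩
      · change (μ.prod μ) diagonalSet = 0
        rw [hself, Measure.smul_apply, Measure.smul_apply, hnull, smul_zero, smul_zero]
      · change Integrable logKernel (μ.prod μ)
        rw [hself]
        exact (hL.restrict.smul_measure hctop).smul_measure hctop
    have hv := h.variational hσ hμc hμe
      (by rw [hcross, Measure.smul_apply, hnull, smul_zero])
      (by rw [hcross]; exact hL.restrict.smul_measure hctop)
    have hμA : ∀ᵐ z ∂μ, 0 < γ - (Q z + 2 * logPotential σ z) := by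
      refine Measure.ae_smul_measure ?_ c
      filter_upwards [ae_restrict_mem hAm, ae_restrict_of_ae hfe] with z hz hz'
      rw [hz', sub_pos]
      exact hz
    have hμi : Integrable (fun z => Q z + 2 * logPotential σ z) μ :=
      hint.restrict.smul_measure hctop
    have hpos : 0 < ∫ z, (γ - (Q z + 2 * logPotential σ z)) ∂μ :=
      integral_pos_of_ae_pos ((integrable_const _).sub hμi) hμA
    rw [integral_sub (integrable_const _) hμi] at hpos
    simp only [integral_const, probReal_univ, smul_eq_mul, one_mul] at hpos
    linarith
  -- γ is defined as the σ-average, so a function that is ≥ γ almost everywhere must equal γ almost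
  -- everywhere.
  have hzero : ∫ z, (Q z + 2 * logPotential σ z - γ) ∂σ = 0 := by
    rw [integral_sub hint (integrable_const _)]
    simp [hγ, robinConstant]
  rw [integral_eq_zero_iff_of_nonneg_ae (hge.mono fun z hz => sub_nonneg.2 hz)
    (hint.sub (integrable_const _))] at hzero
  filter_upwards [hzero] with z hz
  exact sub_eq_zero.1 hz

/-- An atom at z would give the diagonal point (z,z) positive product mass. -/
lemma measure_singleton_eq_zero_of_diagonalSet {μ : Measure ℂ} [IsFiniteMeasure μ]
    (h : (μ.prod μ) diagonalSet = 0) (z : ℂ) : μ {z} = 0 := by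
  rw [Measure.measure_prod_null measurableSet_diagonalSet] at h
  by_contra h0
  have hsub : ({z} : Set ℂ) ⊆ {x | ¬ μ (Prod.mk x ⁻¹' diagonalSet) = (0 : ℂ → ENNReal) x} := by
    rintro x rfl
    have : Prod.mk x ⁻¹' diagonalSet = {x} := by ext w; simp [diagonalSet, eq_comm]
    simpa [this] using h0
  exact h0 (measure_mono_null hsub h)

/-- The lower semicontinuous upper bound for the potential at a point of the support. -/
lemma lintegral_logKernel_le (h : IsEquilibriumMeasure (radialPotential q) σ) {R : ℝ} (hR0 : 0 ≤ R)
    (hR : ∀ᵐ w ∂σ, ‖w‖ ≤ R) {z : ℂ} (hz : z ∈ σ.support)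
    (hcont : ContinuousAt (radialPotential q) z) :
    ∫⁻ w, ENNReal.ofReal (Real.log (‖z‖ + 1 + R) + logKernel (z, w)) ∂σ ≤
      ENNReal.ofReal (Real.log (‖z‖ + 1 + R) +
        (robinConstant (radialPotential q) σ - radialPotential q z) / 2) := by
  have := h.1.1
  have hσ := h.hasFiniteEnergy
  have hL : Integrable logKernel (σ.prod σ) := hσ.2.1
  set Q := radialPotential q
  set γ := robinConstant Q σ
  set K := Real.log (‖z‖ + 1 + R)
  have hgood : ∀ᵐ u ∂σ, Q u + 2 * logPotential σ u = γ ∧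
      Integrable (fun w => logKernel (u, w)) σ :=
    (ae_add_logPotential_eq h).and hL.prod_right_ae
  -- Every neighbourhood of a support point has positive measure, so it meets the full-measure set
  -- where the equilibrium equality holds.
  have hclos : z ∈ closure {u | Q u + 2 * logPotential σ u = γ ∧
      Integrable (fun w => logKernel (u, w)) σ} := by
    rw [mem_closure_iff_nhds]
    intro V hV
    have hpos := (Measure.mem_support_iff_forall z).1 hz V hV
    by_contra hempty
    have hVnull : σ V = 0 := by
      have hsub : V ⊆ {u | ¬ (Q u + 2 * logPotential σ u = γ ∧
          Integrable (fun w => logKernel (u, w)) σ)} := fun u hu hu' => hempty ⟨u, hu, hu'⟩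
      exact measure_mono_null hsub (ae_iff.1 hgood)
    exact hpos.ne' hVnull
  obtain ⟨s, hs, hlim⟩ := mem_closure_iff_seq_limit.1 hclos
  -- Fatou's lemma along s n → z. Adding K makes the integrands nonnegative once ‖s n - z‖ < 1.
  -- Working with `lintegral` avoids knowing beforehand that the kernel is integrable at z itself.
  -- The value `Real.log 0 = 0` at w = z is harmless because σ has no atoms.
  have hptw : ∀ᵐ w ∂σ, ENNReal.ofReal (K + logKernel (z, w)) =
      liminf (fun n => ENNReal.ofReal (K + logKernel (s n, w))) atTop := by
    have hsing := measure_singleton_eq_zero_of_diagonalSet (μ := σ) hσ.1 z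
    filter_upwards [measure_eq_zero_iff_ae_notMem.1 hsing] with w hw
    have hne : ‖z - w‖ ≠ 0 := by
      rw [norm_ne_zero_iff, sub_ne_zero]
      exact fun e => hw e.symm
    refine (Tendsto.liminf_eq ?_).symm
    refine (ENNReal.continuous_ofReal.tendsto _).comp (tendsto_const_nhds.add ?_)
    simp only [logKernel_eq]
    exact ((hlim.sub_const w).norm.log hne).neg
  have hev : ∀ᶠ n in atTop, ∫⁻ w, ENNReal.ofReal (K + logKernel (s n, w)) ∂σ =
      ENNReal.ofReal (K + (γ - Q (s n)) / 2) := by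
    have h1 : ∀ᶠ n in atTop, ‖s n - z‖ < 1 := by
      have := (tendsto_iff_norm_sub_tendsto_zero.1 hlim).eventually_lt_const one_pos
      exact this
    filter_upwards [h1] with n hn
    have hsum : Integrable (fun w => K + logKernel (s n, w)) σ := (integrable_const _).add (hs n).2
    rw [← ofReal_integral_eq_lintegral_ofReal hsum,
      integral_add (integrable_const _) (hs n).2, ← logPotential_eq]
    · simp only [integral_const, probReal_univ, smul_eq_mul, one_mul]
      congr 2
      linarith [(hs n).1]
    · filter_upwards [hR] with w hw
      have hle : ‖s n - w‖ ≤ ‖z‖ + 1 + R := by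
        calc ‖s n - w‖ = ‖(s n - z) + (z - w)‖ := by ring_nf
          _ ≤ ‖s n - z‖ + (‖z‖ + ‖w‖) := (norm_add_le _ _).trans (by gcongr; exact norm_sub_le _ _)
          _ ≤ _ := by linarith
      simp only [Pi.zero_apply, logKernel_eq]
      rcases (norm_nonneg (s n - w)).eq_or_lt with h0 | h0
      · rw [← h0, Real.log_zero, neg_zero, add_zero]
        exact Real.log_nonneg (by linarith [norm_nonneg z])
      · linarith [Real.log_le_log h0 hle]
  have hQlim : Tendsto (fun n => ENNReal.ofReal (K + (γ - Q (s n)) / 2)) atTop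
      (𝓝 (ENNReal.ofReal (K + (γ - Q z) / 2))) := by
    refine (ENNReal.continuous_ofReal.tendsto _).comp (tendsto_const_nhds.add ?_)
    exact (tendsto_const_nhds.sub (hcont.tendsto.comp hlim)).div_const 2
  calc ∫⁻ w, ENNReal.ofReal (K + logKernel (z, w)) ∂σ
      = ∫⁻ w, liminf (fun n => ENNReal.ofReal (K + logKernel (s n, w))) atTop ∂σ :=
        lintegral_congr_ae hptw
    _ ≤ liminf (fun n => ∫⁻ w, ENNReal.ofReal (K + logKernel (s n, w)) ∂σ) atTop :=
        lintegral_liminf_le fun n => by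
          have : Measurable fun w => logKernel (s n, w) :=
            measurable_logKernel.comp measurable_prodMk_left
          fun_prop
    _ = ENNReal.ofReal (K + (γ - Q z) / 2) := by
        rw [liminf_congr hev]
        exact hQlim.liminf_eq

/-- Integrating the pointwise upper bound for U^σ over a circle contained in the support, where Q is
continuous, reverses `robinConstant_add_le`. -/
lemma le_robinConstant_add (h : IsEquilibriumMeasure (radialPotential q) σ) {r : ℝ} (hr : 0 < r)
    (hsupp : ∀ z : ℂ, ‖z‖ = r → z ∈ σ.support)
    (hcont : ∀ z : ℂ, ‖z‖ = r → ContinuousAt (radialPotential q) z) :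
    q r ≤ robinConstant (radialPotential q) σ + 2 * radialMeanLog σ r := by
  have := h.1.1
  obtain ⟨R', hR'⟩ := h.1.exists_norm_le
  obtain ⟨R, hR0, hR⟩ : ∃ R : ℝ, 0 ≤ R ∧ ∀ᵐ w ∂σ, ‖w‖ ≤ R :=
    ⟨max R' 0, le_max_right _ _, hR'.mono fun w hw => hw.trans (le_max_left _ _)⟩
  have hint := integrable_logKernel_circleMeasure_prod hr σ hR
  set γ := robinConstant (radialPotential q) σ
  set K := Real.log (r + 1 + R)
  have hnonneg : ∀ᵐ z ∂circleMeasure r, ∀ᵐ w ∂σ, 0 ≤ K + logKernel (z, w) := by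
    filter_upwards [ae_circleMeasure hr] with z hz
    filter_upwards [hR] with w hw
    have hle : ‖z - w‖ ≤ r + 1 + R := (norm_sub_le z w).trans (by linarith)
    rw [logKernel_eq]
    rcases (norm_nonneg (z - w)).eq_or_lt with h0 | h0
    · rw [← h0, Real.log_zero, neg_zero, add_zero]
      exact Real.log_nonneg (by linarith)
    · linarith [Real.log_le_log h0 hle]
  have hmeas : Measurable fun p : ℂ × ℂ => ENNReal.ofReal (K + logKernel p) := by fun_prop
  have hprod : ENNReal.ofReal (∫ p, (K + logKernel p) ∂((circleMeasure r).prod σ)) ≤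
      ENNReal.ofReal (K + (γ - q r) / 2) := by
    have hsum : Integrable (fun p => K + logKernel p) ((circleMeasure r).prod σ) :=
      (integrable_const _).add hint
    rw [ofReal_integral_eq_lintegral_ofReal hsum,
      lintegral_prod _ hmeas.aemeasurable]
    · calc ∫⁻ z, ∫⁻ w, ENNReal.ofReal (K + logKernel (z, w)) ∂σ ∂circleMeasure r
          ≤ ∫⁻ _, ENNReal.ofReal (K + (γ - q r) / 2) ∂circleMeasure r := by
            refine lintegral_mono_ae ?_
            filter_upwards [ae_circleMeasure hr] with z hz
            have := lintegral_logKernel_le h hR0 hR (hsupp z hz) (hcont z hz)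
            simpa only [hz, radialPotential] using this
        _ = _ := by simp
    · refine (Measure.ae_prod_iff_ae_ae ?_).2 hnonneg
      exact measurableSet_le measurable_const (by fun_prop)
  rw [integral_add (integrable_const _) hint, ← integral_logPotential hint,
    integral_logPotential_circleMeasure h.1 hr] at hprod
  simp only [integral_const, probReal_univ, smul_eq_mul, one_mul] at hprod
  -- `ENNReal.ofReal` truncates at zero, so the inequality can be read back in ℝ only if the left
  -- side is positive. The extra 1 inside K ensures this.
  have hlt : radialMeanLog σ r < K := by
    calc radialMeanLog σ r ≤ ∫ _, Real.log (r + R) ∂σ := by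
          refine integral_mono_ae (integrable_log_max h.1 hr) (integrable_const _) ?_
          filter_upwards [hR] with w hw
          exact Real.log_le_log (hr.trans_le (le_max_left _ _)) (max_le (by linarith) (by linarith))
      _ = Real.log (r + R) := by simp
      _ < K := Real.log_lt_log (by linarith) (by linarith)
  rcases ENNReal.ofReal_le_ofReal_iff'.1 hprod with h1 | h1
  · linarith
  · linarith

/-! ### Mass comparison between radii -/

/-- The comparison of circular means at two radii with the potential of a centred point mass. -/
lemma radialMeanLog_sub_eq (hσ : IsCompactProbability σ) {r r₀ : ℝ} (hr : 0 < r) (hr₀ : 0 < r₀)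
    (ρ : ℝ) :
    Integrable (fun w : ℂ => Real.log (max r ‖w‖) - Real.log (max r₀ ‖w‖) -
        {w : ℂ | ‖w‖ ≤ ρ}.indicator (fun _ => Real.log (r / r₀)) w) σ ∧
      ∫ w, (Real.log (max r ‖w‖) - Real.log (max r₀ ‖w‖) -
        {w : ℂ | ‖w‖ ≤ ρ}.indicator (fun _ => Real.log (r / r₀)) w) ∂σ =
      radialMeanLog σ r - radialMeanLog σ r₀ - σ.real {w : ℂ | ‖w‖ ≤ ρ} * Real.log (r / r₀) := by
  have := hσ.1
  have hm : MeasurableSet {w : ℂ | ‖w‖ ≤ ρ} := measurableSet_le measurable_norm measurable_const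
  have h1 : Integrable (fun w : ℂ => Real.log (max r ‖w‖) - Real.log (max r₀ ‖w‖)) σ :=
    (integrable_log_max hσ hr).sub (integrable_log_max hσ hr₀)
  have h2 : Integrable ({w : ℂ | ‖w‖ ≤ ρ}.indicator fun _ => Real.log (r / r₀)) σ :=
    (integrable_const _).indicator hm
  refine ⟨h1.sub h2, ?_⟩
  rw [integral_sub h1 h2, integral_sub (integrable_log_max hσ hr) (integrable_log_max hσ hr₀),
    integral_indicator_const _ hm, smul_eq_mul]
  rfl

lemma integral_pos_of_pos_on_open {σ : Measure ℂ} {f : ℂ → ℝ} (hf : 0 ≤ f) (hi : Integrable f σ)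
    {U : Set ℂ} (hU : IsOpen U) (hpos : ∀ w ∈ U, 0 < f w) {z : ℂ} (hz : z ∈ σ.support)
    (hzU : z ∈ U) : 0 < ∫ w, f w ∂σ := by
  rw [integral_pos_iff_support_of_nonneg hf hi]
  exact ((Measure.mem_support_iff_forall z).1 hz U (hU.mem_nhds hzU)).trans_le
    (measure_mono fun w hw => (hpos w hw).ne')

end

/-! ### The geometry of the droplet -/

section

variable {q : ℝ → ℝ} {σ : Measure ℂ} {N : ℕ} {a b : ℕ → ℝ}

namespace IsAnnularPotential

lemma outer_le (hQ : IsAnnularPotential q σ N a b) {i j : ℕ} (hij : i ≤ j) (hj : j ≤ N) :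
    b i ≤ b j := by
  induction j, hij using Nat.le_induction with
  | base => exact le_rfl
  | succ j hij ih =>
    exact (ih (by omega)).trans ((hQ.lt_gap j (by omega)).trans (hQ.lt_annulus (j + 1) hj)).le

lemma inner_le (hQ : IsAnnularPotential q σ N a b) {i j : ℕ} (hij : i ≤ j) (hj : j ≤ N) :
    a i ≤ a j := by
  induction j, hij using Nat.le_induction with
  | base => exact le_rfl
  | succ j hij ih =>
    exact (ih (by omega)).trans ((hQ.lt_annulus j (by omega)).trans (hQ.lt_gap j (by omega))).le

lemma inner_nonneg (hQ : IsAnnularPotential q σ N a b) {i : ℕ} (hi : i ≤ N) : 0 ≤ a i :=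
  hQ.nonneg.trans (hQ.inner_le (Nat.zero_le i) hi)

lemma mem_support (hQ : IsAnnularPotential q σ N a b) {i : ℕ} (hi : i ≤ N) {z : ℂ}
    (h1 : a i ≤ ‖z‖) (h2 : ‖z‖ ≤ b i) : z ∈ σ.support := by
  rw [hQ.droplet_eq]
  exact Set.mem_iUnion₂.2 ⟨i, hi, h1, h2⟩

lemma notMem_support (hQ : IsAnnularPotential q σ N a b) {k : ℕ} (hk : k < N) {z : ℂ}
    (h1 : b k < ‖z‖) (h2 : ‖z‖ < a (k + 1)) : z ∉ σ.support := by
  rw [hQ.droplet_eq]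
  intro hz
  obtain ⟨i, hi, hz1, hz2⟩ := Set.mem_iUnion₂.1 hz
  rcases Nat.lt_or_ge k i with h | h
  · linarith [hQ.inner_le (show k + 1 ≤ i from h) hi]
  · linarith [hQ.outer_le h hk.le]

lemma continuousAt (hQ : IsAnnularPotential q σ N a b) {z : ℂ} (hz : z ∈ σ.support) :
    ContinuousAt (radialPotential q) z := by
  obtain ⟨U, hU, hSU, hc⟩ := hQ.smooth_droplet
  exact hc.continuousOn.continuousAt (hU.mem_nhds (hSU hz))

lemma eq_robinConstant_add (hQ : IsAnnularPotential q σ N a b) {i : ℕ} (hi : i ≤ N) {r : ℝ}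
    (hr : 0 < r) (h1 : a i ≤ r) (h2 : r ≤ b i) :
    q r = robinConstant (radialPotential q) σ + 2 * radialMeanLog σ r :=
  have hs : ∀ z : ℂ, ‖z‖ = r → z ∈ σ.support := fun z hz =>
    hQ.mem_support hi (by rw [hz]; exact h1) (by rw [hz]; exact h2)
  le_antisymm (le_robinConstant_add hQ.equilibrium hr hs fun z hz => hQ.continuousAt (hs z hz))
    (robinConstant_add_le hQ.equilibrium hr)

lemma outer_pos (hQ : IsAnnularPotential q σ N a b) {k : ℕ} (hk : k ≤ N) : 0 < b k :=
  (hQ.inner_nonneg hk).trans_lt (hQ.lt_annulus k hk)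

lemma mass_pos (hQ : IsAnnularPotential q σ N a b) {k : ℕ} (hk : k < N) :
    0 < σ.real {w : ℂ | ‖w‖ ≤ b k} := by
  have := hQ.equilibrium.1.1
  have hab := hQ.lt_annulus k hk.le
  have ha := hQ.inner_nonneg hk.le
  have hmem : (((a k + b k) / 2 : ℝ) : ℂ) ∈ σ.support := by
    refine hQ.mem_support hk.le ?_ ?_ <;> rw [Complex.norm_of_nonneg (by linarith)] <;> linarith
  have hpos := (Measure.mem_support_iff_forall _).1 hmem {w : ℂ | ‖w‖ < b k}
    ((isOpen_lt continuous_norm continuous_const).mem_nhds (by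
      change ‖_‖ < b k
      rw [Complex.norm_of_nonneg (by linarith)]; linarith))
  refine ENNReal.toReal_pos (hpos.trans_le (measure_mono ?_)).ne' (measure_ne_top _ _)
  exact fun w (hw : ‖w‖ < b k) => hw.le

lemma mass_lt_one (hQ : IsAnnularPotential q σ N a b) {k : ℕ} (hk : k < N) :
    σ.real {w : ℂ | ‖w‖ ≤ b k} < 1 := by
  have := hQ.equilibrium.1.1
  have hab := hQ.lt_annulus (k + 1) hk
  have hg := hQ.lt_gap k hk
  have ha := hQ.inner_nonneg hk
  have hmem : ((a (k + 1) : ℝ) : ℂ) ∈ σ.support := by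
    refine hQ.mem_support hk ?_ ?_ <;> rw [Complex.norm_of_nonneg ha]
    exact hab.le
  have hpos := (Measure.mem_support_iff_forall _).1 hmem {w : ℂ | b k < ‖w‖}
    ((isOpen_lt continuous_const continuous_norm).mem_nhds (by
      change b k < ‖_‖
      rw [Complex.norm_of_nonneg ha]; linarith))
  have hm : MeasurableSet {w : ℂ | ‖w‖ ≤ b k} := measurableSet_le measurable_norm measurable_const
  have hc : {w : ℂ | ‖w‖ ≤ b k}ᶜ = {w : ℂ | b k < ‖w‖} := by ext w; simp
  have h1 := probReal_add_probReal_compl (μ := σ) hm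
  rw [hc] at h1
  have h2 : 0 < σ.real {w : ℂ | b k < ‖w‖} := ENNReal.toReal_pos hpos.ne' (measure_ne_top _ _)
  linarith

/-- The radial form of the obstacle condition on a gap: with `M` the mass inside the gap,
`q(r) - 2 M log r` is minimal exactly at the two boundary radii. -/
theorem radial_obstacle (hQ : IsAnnularPotential q σ N a b) {k : ℕ} (hk : k < N) :
    ∃ M c : ℝ, 0 < M ∧ M < 1 ∧ gapParameter q (b k) (a (k + 1)) = 2 * M ∧
      q (b k) - 2 * M * Real.log (b k) = c ∧
      q (a (k + 1)) - 2 * M * Real.log (a (k + 1)) = c ∧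
      ∀ r, 0 < r → r ≠ b k → r ≠ a (k + 1) → c < q r - 2 * M * Real.log r := by
  have hE := hQ.equilibrium
  set r₁ := b k
  set r₂ := a (k + 1)
  have h1 : 0 < r₁ := hQ.outer_pos hk.le
  have h12 : r₁ < r₂ := hQ.lt_gap k hk
  have h2 : 0 < r₂ := h1.trans h12
  set M := σ.real {w : ℂ | ‖w‖ ≤ r₁}
  set γ := robinConstant (radialPotential q) σ
  have e1 : q r₁ = γ + 2 * radialMeanLog σ r₁ :=
    hQ.eq_robinConstant_add hk.le h1 (hQ.lt_annulus k hk.le).le le_rfl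
  have e2 : q r₂ = γ + 2 * radialMeanLog σ r₂ :=
    hQ.eq_robinConstant_add hk h2 le_rfl (hQ.lt_annulus (k + 1) hk).le
  have hlog : Real.log (r₂ / r₁) = Real.log r₂ - Real.log r₁ := Real.log_div h2.ne' h1.ne'
  have hlogpos : 0 < Real.log (r₂ / r₁) := Real.log_pos ((one_lt_div h1).2 h12)
  -- The integrand is log(r₂/r₁) for |w| ≤ r₁ and 0 for |w| ≥ r₂, and σ has no mass in between. This
  -- identity is what forces B = 2M.
  have e12 : radialMeanLog σ r₂ - radialMeanLog σ r₁ = M * Real.log (r₂ / r₁) := by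
    have hz := (radialMeanLog_sub_eq hE.1 h2 h1 r₁).2
    rw [integral_eq_zero_of_ae] at hz
    · linarith
    · have hS : ∀ᵐ w ∂σ, w ∈ σ.support := measure_eq_zero_iff_ae_notMem.1
        (Measure.measure_compl_support (μ := σ)) |>.mono fun w hw => not_not.1 hw
      filter_upwards [hS] with w hw
      rcases le_or_gt ‖w‖ r₁ with hw1 | hw1
      · have : w ∈ {w : ℂ | ‖w‖ ≤ r₁} := hw1
        rw [Set.indicator_of_mem this, max_eq_left (hw1.trans h12.le), max_eq_left hw1, hlog]
        simp
      · have : w ∉ {w : ℂ | ‖w‖ ≤ r₁} := not_le.2 hw1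
        have hw2 : r₂ ≤ ‖w‖ := not_lt.1 fun h => hQ.notMem_support hk hw1 h hw
        rw [Set.indicator_of_notMem this, max_eq_right hw2, max_eq_right hw1.le]
        simp
  refine ⟨M, γ + 2 * radialMeanLog σ r₁ - 2 * M * Real.log r₁, hQ.mass_pos hk, hQ.mass_lt_one hk,
    ?_, by rw [e1], ?_, ?_⟩
  · rw [gapParameter, div_eq_iff hlogpos.ne']
    linarith
  · rw [hlog] at e12
    linarith
  · intro r hr hne1 hne2
    have hmono := robinConstant_add_le hE hr
    -- For r < r₁, the increase of L - M log is the integral of log(max(r,|w|)/r) over |w| ≤ r₁. It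
    -- is positive because the annulus ending at r₁ carries mass between r and r₁; ρ is a droplet
    -- radius in that range.
    rcases lt_or_gt_of_ne hne1 with hlt | hgt
    · obtain ⟨hi, he⟩ := radialMeanLog_sub_eq hE.1 hr h1 r₁
      have hlt' : Real.log r < Real.log r₁ := Real.log_lt_log hr hlt
      have hld : Real.log (r / r₁) = Real.log r - Real.log r₁ := Real.log_div hr.ne' h1.ne'
      set ρ := (max r (a k) + r₁) / 2
      have hmax : max r (a k) < r₁ := max_lt hlt (hQ.lt_annulus k hk.le)
      have hρ1 : r < ρ := by have := le_max_left r (a k); simp only [ρ]; linarith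
      have hρ2 : a k ≤ ρ := by have := le_max_right r (a k); simp only [ρ]; linarith
      have hρ3 : ρ < r₁ := by simp only [ρ]; linarith
      have hnorm : ‖(ρ : ℂ)‖ = ρ := Complex.norm_of_nonneg (by linarith)
      have hpos := integral_pos_of_pos_on_open (σ := σ) (U := {w : ℂ | r < ‖w‖ ∧ ‖w‖ < r₁})
        (z := (ρ : ℂ)) (fun w => ?_) hi
        ((isOpen_lt continuous_const continuous_norm).inter
          (isOpen_lt continuous_norm continuous_const))
        (fun w hw => ?_) (hQ.mem_support hk.le (by rw [hnorm]; exact hρ2)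
          (by rw [hnorm]; exact hρ3.le)) ⟨by rw [hnorm]; exact hρ1, by rw [hnorm]; exact hρ3⟩
      · rw [he, hld] at hpos
        linarith
      · rcases le_or_gt ‖w‖ r₁ with hw1 | hw1
        · have : w ∈ {w : ℂ | ‖w‖ ≤ r₁} := hw1
          simp only [Pi.zero_apply]
          rw [Set.indicator_of_mem this, max_eq_left hw1, hld]
          linarith [Real.log_le_log hr (le_max_left r ‖w‖)]
        · have : w ∉ {w : ℂ | ‖w‖ ≤ r₁} := not_le.2 hw1
          simp only [Pi.zero_apply]
          rw [Set.indicator_of_notMem this, max_eq_right hw1.le, max_eq_right (hlt.trans hw1).le]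
          simp
      · have : w ∈ {w : ℂ | ‖w‖ ≤ r₁} := hw.2.le
        rw [Set.indicator_of_mem this, max_eq_left hw.2.le, max_eq_right hw.1.le, hld]
        linarith [Real.log_lt_log hr hw.1]
    -- Inside the gap L - M log does not increase strictly, so strictness comes from Q > Q̌. Beyond
    -- r₂ it comes from the mass of the next annulus.
    rcases lt_or_gt_of_ne hne2 with hlt | hgt2
    · have hstrict := robinConstant_add_lt hE hr fun z hz => hQ.obstacle_lt z
        (hQ.notMem_support hk (by rw [hz]; exact hgt) (by rw [hz]; exact hlt))
      obtain ⟨hi, he⟩ := radialMeanLog_sub_eq hE.1 hr h1 r₁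
      have hld : Real.log (r / r₁) = Real.log r - Real.log r₁ := Real.log_div hr.ne' h1.ne'
      have hnn : 0 ≤ radialMeanLog σ r - radialMeanLog σ r₁ - M * Real.log (r / r₁) := by
        rw [← he]
        refine integral_nonneg fun w => ?_
        rcases le_or_gt ‖w‖ r₁ with hw1 | hw1
        · have : w ∈ {w : ℂ | ‖w‖ ≤ r₁} := hw1
          simp only [Pi.zero_apply]
          rw [Set.indicator_of_mem this, max_eq_left hw1, max_eq_left (hw1.trans hgt.le), hld]
          simp
        · have : w ∉ {w : ℂ | ‖w‖ ≤ r₁} := not_le.2 hw1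
          simp only [Pi.zero_apply]
          rw [Set.indicator_of_notMem this, max_eq_right hw1.le, sub_zero, sub_nonneg]
          exact Real.log_le_log (h1.trans hw1) (le_max_right _ _)
      rw [hld] at hnn
      linarith
    · obtain ⟨hi, he⟩ := radialMeanLog_sub_eq hE.1 hr h2 r₁
      have hld : Real.log (r / r₂) = Real.log r - Real.log r₂ := Real.log_div hr.ne' h2.ne'
      set ρ := (r₂ + min r (b (k + 1))) / 2
      have hmin : r₂ < min r (b (k + 1)) := lt_min hgt2 (hQ.lt_annulus (k + 1) hk)
      have hρ1 : ρ < r := by have := min_le_left r (b (k + 1)); simp only [ρ]; linarith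
      have hρ2 : ρ ≤ b (k + 1) := by have := min_le_right r (b (k + 1)); simp only [ρ]; linarith
      have hρ3 : r₂ < ρ := by simp only [ρ]; linarith
      have hnorm : ‖(ρ : ℂ)‖ = ρ := Complex.norm_of_nonneg (by linarith)
      have hpos := integral_pos_of_pos_on_open (σ := σ) (U := {w : ℂ | r₂ < ‖w‖ ∧ ‖w‖ < r})
        (z := (ρ : ℂ)) (fun w => ?_) hi
        ((isOpen_lt continuous_const continuous_norm).inter
          (isOpen_lt continuous_norm continuous_const))
        (fun w hw => ?_) (hQ.mem_support hk (by rw [hnorm]; exact hρ3.le)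
          (by rw [hnorm]; exact hρ2)) ⟨by rw [hnorm]; exact hρ3, by rw [hnorm]; exact hρ1⟩
      · rw [he, hld] at hpos
        rw [hlog] at e12
        linarith
      · simp only [Pi.zero_apply]
        rcases le_or_gt ‖w‖ r₁ with hw1 | hw1
        · have : w ∈ {w : ℂ | ‖w‖ ≤ r₁} := hw1
          rw [Set.indicator_of_mem this, max_eq_left (hw1.trans h12.le),
            max_eq_left (hw1.trans hgt.le), hld]
          simp
        · have : w ∉ {w : ℂ | ‖w‖ ≤ r₁} := not_le.2 hw1
          rw [Set.indicator_of_notMem this, sub_zero, sub_nonneg]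
          exact Real.log_le_log (h2.trans_le (le_max_left _ _)) (max_le_max_right _ hgt2.le)
      · have : w ∉ {w : ℂ | ‖w‖ ≤ r₁} := not_le.2 (h12.trans hw.1)
        rw [Set.indicator_of_notMem this, max_eq_right hw.1.le, max_eq_left hw.2.le, sub_zero,
          sub_pos]
        exact Real.log_lt_log (h2.trans hw.1) hw.2

end IsAnnularPotential

end

/-! ### The Laplacian of a radial function -/

/-- Reduces each second derivative in the Laplacian to one-variable calculus along a line. -/
lemma hasDerivAt_fderiv_line {Q : ℂ → ℝ} {z : ℂ} (hQ : ContDiffAt ℝ 2 Q z) (v : ℂ) :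
    HasDerivAt (fun t : ℝ => fderiv ℝ Q (z + t • v) v) (iteratedFDeriv ℝ 2 Q z ![v, v]) 0 := by
  have h1 : HasFDerivAt (fderiv ℝ Q) (fderiv ℝ (fderiv ℝ Q) z) (z + (0 : ℝ) • v) := by
    rw [zero_smul, add_zero]
    exact ((hQ.fderiv_right (m := 1) (by norm_num)).differentiableAt (by norm_num)).hasFDerivAt
  have h2 : HasDerivAt (fun t : ℝ => z + t • v) v 0 := by
    simpa using ((hasDerivAt_id (0 : ℝ)).smul_const v).const_add z
  have h3 := h1.comp_hasDerivAt (0 : ℝ) h2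
  have h4 := h3.clm_apply (hasDerivAt_const (0 : ℝ) v)
  simpa [iteratedFDeriv_two_apply] using h4

lemma eventually_hasDerivAt_line {Q : ℂ → ℝ} {z : ℂ} (hQ : ContDiffAt ℝ 2 Q z) (v : ℂ) :
    ∀ᶠ t : ℝ in 𝓝 0, HasDerivAt (fun t : ℝ => Q (z + t • v)) (fderiv ℝ Q (z + t • v) v) t := by
  have hc : Tendsto (fun t : ℝ => z + t • v) (𝓝 0) (𝓝 z) := by
    have : Continuous fun t : ℝ => z + t • v := by fun_prop
    simpa using this.tendsto 0
  have h1 : ∀ᶠ y in 𝓝 z, ContDiffAt ℝ 2 Q y := hQ.eventually (by simp)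
  filter_upwards [hc.eventually h1] with t ht
  have h2 : HasDerivAt (fun t : ℝ => z + t • v) v t := by
    simpa using ((hasDerivAt_id t).smul_const v).const_add z
  exact (ht.differentiableAt (by norm_num)).hasFDerivAt.comp_hasDerivAt t h2

lemma radialPotential_ofReal (q : ℝ → ℝ) {r : ℝ} (hr : 0 ≤ r) :
    radialPotential q (r : ℂ) = q r := by
  simp [radialPotential, abs_of_nonneg hr]

lemma contDiffAt_profile {q : ℝ → ℝ} {ρ : ℝ} (hρ : 0 < ρ) {n : WithTop ℕ∞}
    (hQ : ContDiffAt ℝ n (radialPotential q) ρ) : ContDiffAt ℝ n q ρ := by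
  have h1 : ContDiffAt ℝ n (fun r : ℝ => radialPotential q (r : ℂ)) ρ :=
    ContDiffAt.comp (g := radialPotential q) ρ hQ Complex.ofRealCLM.contDiff.contDiffAt
  refine h1.congr_of_eventuallyEq ?_
  filter_upwards [lt_mem_nhds hρ] with r hr
  exact (radialPotential_ofReal q (le_of_lt hr)).symm

/-- `4 ∂∂̄` of a radial function at a point of the positive axis. -/
lemma four_mul_quarterLaplacian {q : ℝ → ℝ} {ρ : ℝ} (hρ : 0 < ρ)
    (hQ : ContDiffAt ℝ 2 (radialPotential q) ρ) :
    4 * quarterLaplacian (radialPotential q) ρ = deriv (deriv q) ρ + deriv q ρ / ρ := by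
  have hq : ContDiffAt ℝ 2 q ρ := contDiffAt_profile hρ hQ
  have hq1 : ContDiffAt ℝ 1 (deriv q) ρ := hq.derivWithin (by norm_num)
  have hq2 : DifferentiableAt ℝ (deriv q) ρ := hq1.differentiableAt (by norm_num)
  have hev : ∀ᶠ r in 𝓝 ρ, HasDerivAt q (deriv q r) r :=
    (hq.eventually (by simp)).mono fun r hr => (hr.differentiableAt (by norm_num)).hasDerivAt
  have hxx : iteratedFDeriv ℝ 2 (radialPotential q) ρ ![1, 1] = deriv (deriv q) ρ := by
    have hshift : HasDerivAt (fun t : ℝ => ρ + t) 1 0 := (hasDerivAt_id (0 : ℝ)).const_add ρ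
    have hlim : Tendsto (fun t : ℝ => ρ + t) (𝓝 0) (𝓝 ρ) := by
      simpa using hshift.continuousAt.tendsto
    have h1 : HasDerivAt (fun t : ℝ => deriv q (ρ + t)) (deriv (deriv q) ρ) 0 := by
      have h2 : HasDerivAt (deriv q) (deriv (deriv q) ρ) (ρ + 0) := by
        rw [add_zero]; exact hq2.hasDerivAt
      exact (h2.comp (0 : ℝ) hshift).congr_deriv (mul_one _)
    refine (hasDerivAt_fderiv_line hQ 1).unique (h1.congr_of_eventuallyEq ?_)
    filter_upwards [eventually_hasDerivAt_line hQ 1, hlim.eventually hev,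
      (hlim.eventually (lt_mem_nhds hρ)).eventually_nhds] with t ht1 ht2 ht3
    have h3 : HasDerivAt (fun t : ℝ => q (ρ + t)) (deriv q (ρ + t)) t :=
      (ht2.comp t ((hasDerivAt_id t).const_add ρ)).congr_deriv (mul_one _)
    refine ht1.unique (h3.congr_of_eventuallyEq ?_)
    filter_upwards [ht3] with u hu
    rw [← radialPotential_ofReal q (le_of_lt hu)]
    simp
  -- Along the tangent line the modulus is s(t) = √(ρ² + t²). The first derivative is t · q'(s)/s,
  -- whose derivative at t = 0 is q'(ρ)/ρ.
  have hyy : iteratedFDeriv ℝ 2 (radialPotential q) ρ ![Complex.I, Complex.I] = deriv q ρ / ρ := by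
    set s : ℝ → ℝ := fun t => √(ρ ^ 2 + t ^ 2) with hs
    have hs0 : s 0 = ρ := by simp [hs, hρ.le]
    have hspos : ∀ t, 0 < s t := fun t => Real.sqrt_pos.2 (by positivity)
    have hsd : ∀ t, HasDerivAt s (t / s t) t := fun t => by
      have h := ((hasDerivAt_pow 2 t).const_add (ρ ^ 2)).sqrt (by positivity)
      convert h using 1
      have := (hspos t).ne'
      simp only [hs] at this ⊢
      field_simp
      simp [mul_comm]
    have hlim : Tendsto s (𝓝 0) (𝓝 ρ) := by
      have := (hsd 0).continuousAt.tendsto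
      rwa [hs0] at this
    have hψ : HasDerivAt (fun t => deriv q (s t) / s t)
        ((deriv (deriv q) ρ * (0 / s 0) * s 0 - deriv q (s 0) * (0 / s 0)) / s 0 ^ 2) 0 := by
      have h2 : HasDerivAt (deriv q) (deriv (deriv q) ρ) (s 0) := by
        rw [hs0]; exact hq2.hasDerivAt
      exact (h2.comp (0 : ℝ) (hsd 0)).div (hsd 0) (hspos 0).ne'
    have h1 : HasDerivAt (fun t => t * (deriv q (s t) / s t)) (deriv q ρ / ρ) 0 := by
      refine ((hasDerivAt_id (0 : ℝ)).mul hψ).congr_deriv ?_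
      simp [hs0]
    refine (hasDerivAt_fderiv_line hQ Complex.I).unique (h1.congr_of_eventuallyEq ?_)
    filter_upwards [eventually_hasDerivAt_line hQ Complex.I, hlim.eventually hev] with t ht1 ht2
    have h3 : HasDerivAt (fun t : ℝ => q (s t)) (deriv q (s t) * (t / s t)) t :=
      ht2.comp t (hsd t)
    have h4 : (fun t : ℝ => radialPotential q (ρ + t • Complex.I)) = fun t => q (s t) := by
      ext u
      simp only [radialPotential, hs]
      congr 1
      rw [Complex.real_smul, Complex.norm_add_mul_I]
    rw [h4] at ht1
    rw [ht1.unique h3]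
    ring
  rw [quarterLaplacian, InnerProductSpace.laplacian_eq_iteratedFDeriv_complexPlane]
  simp only [hxx, hyy]
  ring

/-! ### Expansion at a nondegenerate minimum -/

/-- The mean value inequality raises the order of vanishing by one. The factor 1/(k+1) is not needed
and is dropped. -/
lemma abs_le_of_hasDerivAt_le_pow {f f' : ℝ → ℝ} {ρ δ C : ℝ} {k : ℕ}
    (hf : ∀ r, |r - ρ| < δ → HasDerivAt f (f' r) r) (h0 : f ρ = 0) (hC : 0 ≤ C)
    (hb : ∀ r, |r - ρ| < δ → |f' r| ≤ C * |r - ρ| ^ k) {r : ℝ} (hr : |r - ρ| < δ) :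
    |f r| ≤ C * |r - ρ| ^ (k + 1) := by
  have hsub : ∀ x ∈ Set.uIcc ρ r, |x - ρ| ≤ |r - ρ| := fun x hx => Set.abs_sub_left_of_mem_uIcc hx
  have h := (convex_uIcc ρ r).norm_image_sub_le_of_norm_hasDerivWithin_le (f := f) (f' := f')
    (C := C * |r - ρ| ^ k) (fun x hx => (hf x ((hsub x hx).trans_lt hr)).hasDerivWithinAt)
    (fun x hx => (hb x ((hsub x hx).trans_lt hr)).trans
      (mul_le_mul_of_nonneg_left (pow_le_pow_left₀ (abs_nonneg _) (hsub x hx) k) hC))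
    Set.left_mem_uIcc Set.right_mem_uIcc
  rw [h0, sub_zero, Real.norm_eq_abs, Real.norm_eq_abs] at h
  calc |f r| ≤ C * |r - ρ| ^ k * |r - ρ| := h
    _ = _ := by ring

/-- Third-order control at a critical point of a `C³` function. -/
lemma exists_cubic_remainder {g : ℝ → ℝ} {ρ : ℝ} (hg : ContDiffAt ℝ 3 g ρ) (h0 : deriv g ρ = 0) :
    ∃ C δ : ℝ, 0 ≤ C ∧ 0 < δ ∧ ∀ r, |r - ρ| < δ →
      |g r - g ρ - deriv (deriv g) ρ / 2 * (r - ρ) ^ 2| ≤ C * |r - ρ| ^ 3 := by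
  set D := deriv (deriv g) ρ
  have hg1 : ContDiffAt ℝ 2 (deriv g) ρ := hg.derivWithin (by norm_num)
  have hg2 : ContDiffAt ℝ 1 (deriv (deriv g)) ρ := hg1.derivWithin (by norm_num)
  -- The second derivative is C¹ at ρ, hence Lipschitz nearby. Integrating this bound twice gives
  -- the cubic remainder.
  obtain ⟨K, t, ht, hlip⟩ := hg2.exists_lipschitzOnWith
  have e1 : ∀ᶠ r in 𝓝 ρ, HasDerivAt g (deriv g r) r :=
    (hg.eventually (by simp)).mono fun r hr => (hr.differentiableAt (by norm_num)).hasDerivAt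
  have e2 : ∀ᶠ r in 𝓝 ρ, HasDerivAt (deriv g) (deriv (deriv g) r) r :=
    (hg1.eventually (by simp)).mono fun r hr => (hr.differentiableAt (by norm_num)).hasDerivAt
  obtain ⟨δ, hδ, hball⟩ := Metric.eventually_nhds_iff.1 ((e1.and e2).and ht)
  have hlip' : ∀ r, |r - ρ| < δ → |deriv (deriv g) r - D| ≤ K * |r - ρ| ^ 1 := fun r hr => by
    have h := hlip.dist_le_mul r (hball hr).2 ρ (mem_of_mem_nhds ht)
    simpa [Real.dist_eq] using h
  have hd1 : ∀ r, |r - ρ| < δ → |deriv g r - D * (r - ρ)| ≤ K * |r - ρ| ^ 2 := fun r hr =>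
    abs_le_of_hasDerivAt_le_pow (f := fun r => deriv g r - D * (r - ρ))
      (f' := fun r => deriv (deriv g) r - D) (fun r hr =>
        ((hball hr).1.2.sub (((hasDerivAt_id r).sub_const ρ).const_mul D)).congr_deriv (by simp))
      (by simp [h0]) K.2 hlip' hr
  refine ⟨K, δ, K.2, hδ, fun r hr => ?_⟩
  exact abs_le_of_hasDerivAt_le_pow (f := fun r => g r - g ρ - D / 2 * (r - ρ) ^ 2)
    (f' := fun r => deriv g r - D * (r - ρ)) (fun r hr => by
      have h := ((hball hr).1.1.sub_const (g ρ)).sub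
        ((((hasDerivAt_id r).sub_const ρ).pow 2).const_mul (D / 2))
      refine h.congr_deriv ?_
      simp
      ring) (by simp) K.2 hd1 hr

/-- At a local minimum of `q - 2 M log`, the quadratic coefficient is `2 ∂∂̄Q`. -/
lemma exists_expansion_at_min {q : ℝ → ℝ} {ρ M : ℝ} (hρ : 0 < ρ)
    (hQ : ContDiffAt ℝ 3 (radialPotential q) ρ)
    (hmin : IsLocalMin (fun r => q r - 2 * M * Real.log r) ρ) :
    ∃ C δ : ℝ, 0 ≤ C ∧ 0 < δ ∧ ∀ r, |r - ρ| < δ →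
      |q r - 2 * M * Real.log r - (q ρ - 2 * M * Real.log ρ) -
        2 * quarterLaplacian (radialPotential q) ρ * (r - ρ) ^ 2| ≤ C * |r - ρ| ^ 3 := by
  have hq : ContDiffAt ℝ 3 q ρ := contDiffAt_profile hρ hQ
  set g : ℝ → ℝ := fun r => q r - 2 * M * Real.log r
  have hgC : ContDiffAt ℝ 3 g ρ :=
    hq.sub (contDiffAt_const.mul (Real.contDiffAt_log.2 hρ.ne'))
  have hd0 : deriv g ρ = 0 := hmin.deriv_eq_zero
  have hev : ∀ᶠ r in 𝓝 ρ, deriv g r = deriv q r - 2 * M * r⁻¹ := by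
    filter_upwards [hq.eventually (by simp), lt_mem_nhds hρ] with r hr hr0
    exact ((hr.differentiableAt (by norm_num)).hasDerivAt.sub
      ((Real.hasDerivAt_log (ne_of_gt hr0)).const_mul (2 * M))).deriv
  have hq1 : ContDiffAt ℝ 2 (deriv q) ρ := hq.derivWithin (by norm_num)
  -- At the critical point q'(ρ) = 2M/ρ, so the term 2M/ρ² from the logarithm equals q'(ρ)/ρ and
  -- completes the radial Laplacian.
  have hdd : deriv (deriv g) ρ = 4 * quarterLaplacian (radialPotential q) ρ := by
    rw [four_mul_quarterLaplacian hρ (hQ.of_le (by norm_num)), HasDerivAt.deriv (HasDerivAt.congr_of_eventuallyEq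
      ((hq1.differentiableAt (by norm_num)).hasDerivAt.sub
        ((hasDerivAt_inv hρ.ne').const_mul (2 * M))) hev)]
    have h1 : deriv q ρ = 2 * M * ρ⁻¹ := by
      have := hev.self_of_nhds
      rw [hd0] at this
      linarith
    rw [h1]
    field_simp
    ring
  obtain ⟨C, δ, hC, hδ, h⟩ := exists_cubic_remainder hgC hd0
  refine ⟨C, δ, hC, hδ, fun r hr => ?_⟩
  have := h r hr
  rw [hdd] at this
  convert this using 3
  ring

/-! ### Boundary points -/

lemma mem_closure_of_forall_pos {S : Set ℂ} {ρ ε : ℝ} (hε : 0 < ε) {v : ℝ}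
    (h : ∀ t, 0 < t → t < ε → ((ρ + t * v : ℝ) : ℂ) ∈ S) : (ρ : ℂ) ∈ closure S := by
  have hc : Tendsto (fun t : ℝ => ((ρ + t * v : ℝ) : ℂ)) (𝓝[>] 0) (𝓝 (ρ : ℂ)) := by
    have : Continuous fun t : ℝ => ((ρ + t * v : ℝ) : ℂ) := by fun_prop
    simpa using (this.tendsto 0).mono_left nhdsWithin_le_nhds
  refine mem_closure_of_tendsto hc ?_
  filter_upwards [Ioo_mem_nhdsGT hε] with t ht using h t ht.1 ht.2

lemma inner_mem_frontier_gap {r₁ r₂ : ℝ} (h1 : 0 < r₁) (h12 : r₁ < r₂) :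
    (r₁ : ℂ) ∈ frontier (gap r₁ r₂) := by
  refine ⟨mem_closure_of_forall_pos (ε := r₂ - r₁) (v := 1) (by linarith) fun t ht1 ht2 => ?_,
    fun h => ?_⟩
  · rw [gap, Set.mem_ofPred_eq, Complex.norm_of_nonneg (by linarith)]
    constructor <;> linarith
  · have := (interior_subset h).1
    rw [Complex.norm_of_nonneg h1.le] at this
    exact lt_irrefl _ this

lemma outer_mem_frontier_gap {r₁ r₂ : ℝ} (h1 : 0 < r₁) (h12 : r₁ < r₂) :
    (r₂ : ℂ) ∈ frontier (gap r₁ r₂) := by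
  refine ⟨mem_closure_of_forall_pos (ε := r₂ - r₁) (v := -1) (by linarith) fun t ht1 ht2 => ?_,
    fun h => ?_⟩
  · rw [gap, Set.mem_ofPred_eq, Complex.norm_of_nonneg (by linarith)]
    constructor <;> linarith
  · have := (interior_subset h).2
    rw [Complex.norm_of_nonneg (by linarith)] at this
    exact lt_irrefl _ this

lemma SmoothNear.contDiffAt {k : ℕ} {Q : ℂ → ℝ} {E : Set ℂ} (h : SmoothNear k Q E) {z : ℂ}
    (hz : z ∈ E) : ContDiffAt ℝ k Q z := by
  obtain ⟨U, hU, hE, hc⟩ := h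
  exact hc.contDiffAt (hU.mem_nhds (hE hz))

namespace IsAnnularPotential

variable {q : ℝ → ℝ} {σ : Measure ℂ} {N : ℕ} {a b : ℕ → ℝ}

lemma outer_mem_frontier (hQ : IsAnnularPotential q σ N a b) {k : ℕ} (hk : k < N) :
    ((b k : ℝ) : ℂ) ∈ frontier σ.support := by
  have h1 := hQ.outer_pos hk.le
  have hg := hQ.lt_gap k hk
  rw [frontier_eq_closure_inter_closure]
  refine ⟨subset_closure (hQ.mem_support hk.le ?_ ?_),
    mem_closure_of_forall_pos (ε := a (k + 1) - b k) (v := 1) (by linarith) fun t ht1 ht2 => ?_⟩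
  · rw [Complex.norm_of_nonneg h1.le]; exact (hQ.lt_annulus k hk.le).le
  · rw [Complex.norm_of_nonneg h1.le]
  · refine hQ.notMem_support hk ?_ ?_ <;> rw [Complex.norm_of_nonneg (by linarith)] <;> linarith

lemma inner_mem_frontier (hQ : IsAnnularPotential q σ N a b) {k : ℕ} (hk : k < N) :
    ((a (k + 1) : ℝ) : ℂ) ∈ frontier σ.support := by
  have h1 := hQ.outer_pos hk.le
  have hg := hQ.lt_gap k hk
  rw [frontier_eq_closure_inter_closure]
  refine ⟨subset_closure (hQ.mem_support hk ?_ ?_),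
    mem_closure_of_forall_pos (ε := a (k + 1) - b k) (v := -1) (by linarith) fun t ht1 ht2 => ?_⟩
  · rw [Complex.norm_of_nonneg (by linarith)]
  · rw [Complex.norm_of_nonneg (by linarith)]; exact (hQ.lt_annulus (k + 1) hk).le
  · refine hQ.notMem_support hk ?_ ?_ <;> rw [Complex.norm_of_nonneg (by linarith)] <;> linarith

end IsAnnularPotential

/-! ### Elementary inequalities for exponentials -/

lemma abs_exp_sub_one_le_mul_exp (y : ℝ) : |Real.exp y - 1| ≤ |y| * Real.exp |y| := by
  have h1 := Real.add_one_le_exp y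
  have h2 := Real.add_one_le_exp (-y)
  have h3 : Real.exp y * Real.exp (-y) = 1 := by rw [← Real.exp_add]; simp
  have h5 : 1 ≤ Real.exp |y| := Real.one_le_exp (abs_nonneg y)
  rcases le_total 0 y with hy | hy
  · rw [abs_of_nonneg hy, abs_of_nonneg (by linarith)]
    nlinarith
  · rw [abs_of_nonpos hy, abs_of_nonpos (by linarith [Real.exp_le_one_iff.2 hy])]
    rw [abs_of_nonpos hy] at h5
    nlinarith

lemma abs_exp_neg_sub_exp_neg_le {a b m : ℝ} (ha : m ≤ a) (hb : m ≤ b) :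
    |Real.exp (-a) - Real.exp (-b)| ≤ |a - b| * Real.exp (-m) := by
  wlog hab : a ≤ b generalizing a b
  · rw [abs_sub_comm, abs_sub_comm a b]
    exact this hb ha (le_of_not_ge hab)
  have h1 : Real.exp (-b) = Real.exp (-a) * Real.exp (-(b - a)) := by rw [← Real.exp_add]; ring_nf
  have h2 := Real.add_one_le_exp (-(b - a))
  have h3 := Real.exp_pos (-a)
  have h4 : Real.exp (-a) ≤ Real.exp (-m) := Real.exp_le_exp.2 (by linarith)
  have h5 : Real.exp (-b) ≤ Real.exp (-a) := Real.exp_le_exp.2 (by linarith)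
  rw [abs_of_nonneg (by linarith), abs_of_nonpos (by linarith)]
  nlinarith [mul_le_mul_of_nonneg_left h4 (sub_nonneg.2 hab)]

lemma rpow_le_exp_abs_mul {r : ℝ} (hr : 0 < r) (p : ℝ) :
    r ^ p ≤ Real.exp (|p| * |Real.log r|) := by
  rw [Real.rpow_def_of_pos hr, ← abs_mul, mul_comm]
  exact Real.exp_le_exp.2 (le_abs_self _)

lemma exp_neg_abs_mul_le_rpow {r : ℝ} (hr : 0 < r) (p : ℝ) :
    Real.exp (-(|p| * |Real.log r|)) ≤ r ^ p := by
  rw [Real.rpow_def_of_pos hr, ← abs_mul, mul_comm p]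
  exact Real.exp_le_exp.2 (neg_abs_le _)

/-! ### Nondegenerate wells -/

/-- `f` vanishes at `ρ > 0` to second order, with expansion `2 d (r - ρ)² + O(|r - ρ|³)`. -/
def IsWell (f : ℝ → ℝ) (ρ d : ℝ) : Prop :=
  0 < ρ ∧ 0 < d ∧ ∃ C δ : ℝ, 0 ≤ C ∧ 0 < δ ∧
    ∀ r, |r - ρ| < δ → |f r - 2 * d * (r - ρ) ^ 2| ≤ C * |r - ρ| ^ 3

/-- The integrable error profile at a well. -/
def wellError (ρ d ν r : ℝ) : ℝ := |r - ρ| * Real.exp (-(d / 2 * ν) * (r - ρ) ^ 2)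

/-- The Gaussian profile at a well. -/
def wellGaussian (ρ d ν r : ℝ) : ℝ := Real.exp (-(2 * d * ν) * (r - ρ) ^ 2)

lemma wellError_nonneg (ρ d ν r : ℝ) : 0 ≤ wellError ρ d ν r := by
  unfold wellError; positivity

lemma abs_log_div_le {r ρ : ℝ} (hρ : 0 < ρ) (h : |r - ρ| ≤ ρ / 2) :
    |Real.log (r / ρ)| ≤ 2 / ρ * |r - ρ| := by
  have hr : ρ / 2 ≤ r := by linarith [(abs_le.1 h).1]
  have hr0 : 0 < r := by linarith
  have h1 := Real.log_le_sub_one_of_pos (div_pos hr0 hρ)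
  have h2 := Real.one_sub_inv_le_log_of_pos (div_pos hr0 hρ)
  rw [inv_div] at h2
  have e1 : r / ρ - 1 = (r - ρ) / ρ := by field_simp
  have e2 : 1 - ρ / r = (r - ρ) / r := by field_simp
  have b1 : (r - ρ) / ρ ≤ 2 / ρ * |r - ρ| := by
    rw [div_mul_eq_mul_div, div_le_div_iff_of_pos_right hρ]
    linarith [le_abs_self (r - ρ), abs_nonneg (r - ρ)]
  have b2 : -(2 / ρ * |r - ρ|) ≤ (r - ρ) / r := by
    have : |r - ρ| / r ≤ 2 / ρ * |r - ρ| := by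
      rw [div_mul_eq_mul_div, div_le_div_iff₀ hr0 hρ]
      nlinarith [abs_nonneg (r - ρ)]
    have h3 : -(|r - ρ| / r) ≤ (r - ρ) / r := by
      rw [← neg_div, div_le_div_iff_of_pos_right hr0]
      exact neg_abs_le _
    linarith
  rw [abs_le]
  constructor <;> linarith

/-- Comparison of `r ^ p e^{-ν f(r)}` with its Gaussian model near a well. -/
lemma IsWell.exists_near {f : ℝ → ℝ} {ρ d : ℝ} (h : IsWell f ρ d) {β : ℝ} (hβ : 0 < β) :
    ∃ C δ : ℝ, 0 ≤ C ∧ 0 < δ ∧ δ ≤ ρ / 2 ∧ ∀ r, |r - ρ| < δ →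
      (d * (r - ρ) ^ 2 ≤ f r ∧ f r ≤ 3 * d * (r - ρ) ^ 2) ∧
      ∀ ν p : ℝ, 0 ≤ ν → |r ^ p * Real.exp (-ν * f r) - ρ ^ p * wellGaussian ρ d ν r| ≤
        C * (ρ ^ p * Real.exp (β * |p|)) * wellError ρ d ν r := by
  obtain ⟨hρ, hd, C, δ₀, hC, hδ₀, hf⟩ := h
  -- The two summands come from replacing r^p by ρ^p and f by its quadratic part. The bound d/(C+1)
  -- makes the cubic remainder at most d(r-ρ)², and βρ/4 makes |log(r/ρ)| at most β/2.
  refine ⟨2 / ρ * (2 / β) + 2 * C / d, min (min δ₀ (ρ / 2)) (min (d / (C + 1)) (β * ρ / 4)),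
    by positivity, by positivity, (min_le_left _ _).trans (min_le_right _ _), fun r hr => ?_⟩
  have hr1 : |r - ρ| < δ₀ := hr.trans_le ((min_le_left _ _).trans (min_le_left _ _))
  have hr2 : |r - ρ| < ρ / 2 := hr.trans_le ((min_le_left _ _).trans (min_le_right _ _))
  have hr3 : |r - ρ| < d / (C + 1) := hr.trans_le ((min_le_right _ _).trans (min_le_left _ _))
  have hr4 : |r - ρ| < β * ρ / 4 := hr.trans_le ((min_le_right _ _).trans (min_le_right _ _))
  set u := r - ρ with hu
  have hfr := hf r hr1
  have hcub : C * |u| ^ 3 ≤ d * u ^ 2 := by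
    have h1 : C * |u| ≤ d := by
      rw [lt_div_iff₀ (by positivity)] at hr3
      nlinarith [abs_nonneg u]
    have h2 : C * |u| ^ 3 = (C * |u|) * u ^ 2 := by rw [← sq_abs u]; ring
    rw [h2]
    exact mul_le_mul_of_nonneg_right h1 (sq_nonneg u)
  have hb := abs_le.1 (hfr.trans hcub)
  refine ⟨⟨by linarith [hb.1], by linarith [hb.2]⟩, fun ν p hν => ?_⟩
  have hr0 : 0 < r := by linarith [(abs_lt.1 hr2).1]
  have hρp : 0 < ρ ^ p := Real.rpow_pos_of_pos hρ p
  -- The allowance e^{β|p|} is spent in halves: one absorbs the linear factor |p|, the other absorbs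
  -- (r/ρ)^p.
  have hpow : |r ^ p - ρ ^ p| ≤ ρ ^ p * (2 / ρ * (2 / β) * |u| * Real.exp (β * |p|)) := by
    have e1 : r ^ p = ρ ^ p * Real.exp (p * Real.log (r / ρ)) := by
      rw [mul_comm p, ← Real.rpow_def_of_pos (div_pos hr0 hρ), ← Real.mul_rpow hρ.le
        (div_pos hr0 hρ).le, mul_div_cancel₀ _ hρ.ne']
    have e2 : r ^ p - ρ ^ p = ρ ^ p * (Real.exp (p * Real.log (r / ρ)) - 1) := by rw [e1]; ring
    rw [e2, abs_mul, abs_of_pos hρp]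
    refine mul_le_mul_of_nonneg_left ?_ hρp.le
    refine (abs_exp_sub_one_le_mul_exp _).trans ?_
    have hl := abs_log_div_le hρ hr2.le
    have hl2 : |Real.log (r / ρ)| ≤ β / 2 := by
      refine hl.trans ?_
      rw [div_mul_eq_mul_div, div_le_iff₀ hρ]
      linarith
    have h1 : |p * Real.log (r / ρ)| ≤ |p| * (2 / ρ * |u|) := by
      rw [abs_mul]; exact mul_le_mul_of_nonneg_left hl (abs_nonneg p)
    have h2 : |p * Real.log (r / ρ)| ≤ β / 2 * |p| := by
      rw [abs_mul, mul_comm (β / 2)]; exact mul_le_mul_of_nonneg_left hl2 (abs_nonneg p)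
    have h3 : |p| ≤ 2 / β * Real.exp (β / 2 * |p|) := by
      have := Real.add_one_le_exp (β / 2 * |p|)
      rw [div_mul_eq_mul_div, le_div_iff₀ hβ]
      linarith
    calc |p * Real.log (r / ρ)| * Real.exp |p * Real.log (r / ρ)|
        ≤ (|p| * (2 / ρ * |u|)) * Real.exp (β / 2 * |p|) :=
          mul_le_mul h1 (Real.exp_le_exp.2 h2) (Real.exp_pos _).le (by positivity)
      _ ≤ ((2 / β * Real.exp (β / 2 * |p|)) * (2 / ρ * |u|)) * Real.exp (β / 2 * |p|) := by gcongr
      _ = 2 / ρ * (2 / β) * |u| * (Real.exp (β / 2 * |p|) * Real.exp (β / 2 * |p|)) := by ring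
      _ = _ := by rw [← Real.exp_add]; ring_nf
  have hexp1 : Real.exp (-ν * f r) ≤ Real.exp (-(d / 2 * ν) * u ^ 2) := by
    refine Real.exp_le_exp.2 ?_
    have : ν * (d * u ^ 2) ≤ ν * f r := mul_le_mul_of_nonneg_left (by linarith [hb.1]) hν
    nlinarith [mul_nonneg hν (mul_nonneg hd.le (sq_nonneg u))]
  -- The cubic error brings a factor νu², which costs half of the decay e^{-dνu²}. The other half is
  -- the Gaussian in `wellError`.
  have hexp2 : |Real.exp (-ν * f r) - Real.exp (-(2 * d * ν) * u ^ 2)| ≤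
      2 * C / d * |u| * Real.exp (-(d / 2 * ν) * u ^ 2) := by
    have h1 := abs_exp_neg_sub_exp_neg_le (a := ν * f r) (b := 2 * d * ν * u ^ 2)
      (m := d * ν * u ^ 2) (by nlinarith [mul_le_mul_of_nonneg_left hb.1 hν])
      (by nlinarith [mul_nonneg hν (mul_nonneg hd.le (sq_nonneg u))])
    have h2 : |ν * f r - 2 * d * ν * u ^ 2| ≤ ν * (C * |u| ^ 3) := by
      rw [show ν * f r - 2 * d * ν * u ^ 2 = ν * (f r - 2 * d * u ^ 2) by ring, abs_mul,
        abs_of_nonneg hν]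
      exact mul_le_mul_of_nonneg_left hfr hν
    have h3 : ν * u ^ 2 ≤ 2 / d * Real.exp (d / 2 * ν * u ^ 2) := by
      have := Real.add_one_le_exp (d / 2 * ν * u ^ 2)
      rw [div_mul_eq_mul_div, le_div_iff₀ hd]
      linarith
    have e1 : -ν * f r = -(ν * f r) := by ring
    have e2 : -(2 * d * ν) * u ^ 2 = -(2 * d * ν * u ^ 2) := by ring
    rw [e1, e2]
    calc _ ≤ ν * (C * |u| ^ 3) * Real.exp (-(d * ν * u ^ 2)) :=
          h1.trans (mul_le_mul_of_nonneg_right h2 (Real.exp_pos _).le)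
      _ = C * |u| * (ν * u ^ 2) * Real.exp (-(d * ν * u ^ 2)) := by rw [← sq_abs u]; ring
      _ ≤ C * |u| * (2 / d * Real.exp (d / 2 * ν * u ^ 2)) * Real.exp (-(d * ν * u ^ 2)) := by
          gcongr
      _ = 2 * C / d * |u| * (Real.exp (d / 2 * ν * u ^ 2) * Real.exp (-(d * ν * u ^ 2))) := by ring
      _ = _ := by rw [← Real.exp_add]; ring_nf
  have h1e : 1 ≤ Real.exp (β * |p|) := Real.one_le_exp (by positivity)
  calc |r ^ p * Real.exp (-ν * f r) - ρ ^ p * wellGaussian ρ d ν r|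
      = |(r ^ p - ρ ^ p) * Real.exp (-ν * f r) +
          ρ ^ p * (Real.exp (-ν * f r) - Real.exp (-(2 * d * ν) * u ^ 2))| := by
        rw [wellGaussian, ← hu]; congr 1; ring
    _ ≤ |r ^ p - ρ ^ p| * Real.exp (-ν * f r) +
          ρ ^ p * |Real.exp (-ν * f r) - Real.exp (-(2 * d * ν) * u ^ 2)| := by
        refine (abs_add_le _ _).trans (le_of_eq ?_)
        rw [abs_mul, abs_mul, abs_of_pos (Real.exp_pos _), abs_of_pos hρp]
    _ ≤ ρ ^ p * (2 / ρ * (2 / β) * |u| * Real.exp (β * |p|)) * Real.exp (-(d / 2 * ν) * u ^ 2) +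
          ρ ^ p * (2 * C / d * |u| * Real.exp (-(d / 2 * ν) * u ^ 2) * Real.exp (β * |p|)) := by
        refine add_le_add (mul_le_mul hpow hexp1 (Real.exp_pos _).le (by positivity)) ?_
        refine mul_le_mul_of_nonneg_left (hexp2.trans ?_) hρp.le
        exact le_mul_of_one_le_right (by positivity) h1e
    _ = _ := by rw [wellError]; ring

/-- Away from the centre |r-ρ|/δ ≥ 1, so Gaussian tails count as error. This allows the model
Gaussians to be integrated over all of ℝ. -/
lemma wellGaussian_le_wellError {ρ d ν δ r : ℝ} (hd : 0 < d) (hν : 0 ≤ ν) (hδ : 0 < δ)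
    (h : δ ≤ |r - ρ|) : wellGaussian ρ d ν r ≤ δ⁻¹ * wellError ρ d ν r := by
  rw [wellGaussian, wellError, ← mul_assoc]
  have h1 : 1 ≤ δ⁻¹ * |r - ρ| := by
    rw [inv_mul_eq_div, one_le_div hδ]; exact h
  have h2 : Real.exp (-(2 * d * ν) * (r - ρ) ^ 2) ≤ Real.exp (-(d / 2 * ν) * (r - ρ) ^ 2) :=
    Real.exp_le_exp.2 (by nlinarith [mul_nonneg hν (mul_nonneg hd.le (sq_nonneg (r - ρ)))])
  exact h2.trans (le_mul_of_one_le_left (Real.exp_pos _).le h1)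

lemma integrable_wellGaussian {ρ d ν : ℝ} (hd : 0 < d) (hν : 0 < ν) :
    Integrable (wellGaussian ρ d ν) :=
  (integrable_exp_neg_mul_sq (b := 2 * d * ν) (by positivity)).comp_sub_right ρ

lemma integral_wellGaussian (ρ d ν : ℝ) : ∫ r, wellGaussian ρ d ν r = √(π / (2 * d * ν)) := by
  simp only [wellGaussian]
  rw [integral_sub_right_eq_self (fun r => Real.exp (-(2 * d * ν) * r ^ 2)) ρ, integral_gaussian]

lemma integrable_wellError {ρ d ν : ℝ} (hd : 0 < d) (hν : 0 < ν) :
    Integrable (wellError ρ d ν) := by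
  have h := (integrable_mul_exp_neg_mul_sq (b := d / 2 * ν) (by positivity)).abs
  refine (h.comp_sub_right ρ).congr (ae_of_all _ fun r => ?_)
  simp [wellError, abs_mul, abs_of_pos (Real.exp_pos _)]

/-- Scaling by √ν: the extra factor |r-ρ| makes this 1/ν, smaller by √ν than the Gaussian mass. This
is the source of the relative error n^{-1/2}. -/
lemma integral_wellError (ρ d : ℝ) {ν : ℝ} (hν : 0 < ν) :
    ∫ r, wellError ρ d ν r = (∫ r, wellError 0 d 1 r) / ν := by
  have h1 : ∫ r, wellError ρ d ν r = ∫ r, wellError 0 d ν r := by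
    rw [← integral_sub_right_eq_self (wellError 0 d ν) ρ]
    simp [wellError]
  have h2 : ∀ r, wellError 0 d ν r = (√ν)⁻¹ * wellError 0 d 1 (√ν * r) := fun r => by
    have hs : 0 < √ν := Real.sqrt_pos.2 hν
    simp only [wellError, sub_zero, mul_pow, Real.sq_sqrt hν.le, abs_mul, abs_of_pos hs]
    rw [← mul_assoc, ← mul_assoc, inv_mul_cancel₀ hs.ne']
    ring_nf
  rw [h1]
  simp_rw [h2]
  rw [integral_const_mul, Measure.integral_comp_mul_left, abs_of_pos (by positivity), smul_eq_mul,
    ← mul_assoc, ← mul_inv, Real.mul_self_sqrt hν.le]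
  ring

/-! ### Laplace asymptotics for two wells -/

/-- A function on `(0, ∞)` whose only approximate minima are two nondegenerate wells, and which
grows at least like a multiple of `1 + |log r|` away from them. -/
structure IsDoubleWell (f : ℝ → ℝ) (r₁ r₂ d₁ d₂ : ℝ) : Prop where
  measurable : Measurable f
  lt : r₁ < r₂
  left : IsWell f r₁ d₁
  right : IsWell f r₂ d₂
  far : ∀ δ, 0 < δ → ∃ κ, 0 < κ ∧ ∀ r, 0 < r → δ ≤ |r - r₁| → δ ≤ |r - r₂| →
    κ * (1 + |Real.log r|) ≤ f r

/-- The Laplace integrand `r ^ p e^{-ν f(r)}`. -/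
def laplaceIntegrand (f : ℝ → ℝ) (ν p r : ℝ) : ℝ := r ^ p * Real.exp (-ν * f r)

/-- The left side is min(r², r⁻²); it is compared with a density integrable over all of ℝ. -/
lemma exp_neg_two_mul_abs_log_le {r : ℝ} (hr : 0 < r) :
    Real.exp (-(2 * |Real.log r|)) ≤ 2 * (1 + r ^ 2)⁻¹ := by
  rw [← div_eq_mul_inv, le_div_iff₀ (by positivity)]
  have h0 : Real.exp (2 * Real.log r) = r ^ 2 := by
    rw [two_mul, Real.exp_add, Real.exp_log hr]; ring
  have h1 : Real.exp (-(2 * |Real.log r|)) ≤ 1 := Real.exp_le_one_iff.2 (by simp)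
  have h2 : Real.exp (-(2 * |Real.log r|)) * r ^ 2 ≤ 1 := by
    rw [← h0, ← Real.exp_add]
    exact Real.exp_le_one_iff.2 (by linarith [le_abs_self (Real.log r)])
  linarith

namespace IsDoubleWell

variable {f : ℝ → ℝ} {r₁ r₂ d₁ d₂ : ℝ}

lemma measurable_laplaceIntegrand (h : IsDoubleWell f r₁ r₂ d₁ d₂) (ν p : ℝ) :
    Measurable (laplaceIntegrand f ν p) := by
  have := h.measurable
  unfold laplaceIntegrand
  fun_prop

/-- Near a well the local comparison applies and the other Gaussian is a tail. Far from both, f ≥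
κ(1 + |log r|). The condition |p| + 2 ≤ κν then leaves e^{-κν} e^{-2|log r|} after r^p is absorbed.
For r ≤ 0 only tails remain. A single majorant on ℝ results, ready to be integrated. -/
lemma exists_pointwise (h : IsDoubleWell f r₁ r₂ d₁ d₂) {β : ℝ} (hβ : 0 < β) :
    ∃ C κ : ℝ, 0 ≤ C ∧ 0 < κ ∧ ∀ ν p r : ℝ, 0 ≤ ν → |p| + 2 ≤ κ * ν →
      |(Set.Ioi 0).indicator (laplaceIntegrand f ν p) r -
        (r₁ ^ p * wellGaussian r₁ d₁ ν r + r₂ ^ p * wellGaussian r₂ d₂ ν r)| ≤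
      C * Real.exp (β * |p|) *
        (r₁ ^ p * wellError r₁ d₁ ν r + r₂ ^ p * wellError r₂ d₂ ν r) +
        Real.exp (-(κ * ν)) * (2 * (1 + r ^ 2)⁻¹) := by
  obtain ⟨C₁, δ₁, hC₁, hδ₁, hδρ₁, hn₁⟩ := h.left.exists_near hβ
  obtain ⟨C₂, δ₂, hC₂, hδ₂, hδρ₂, hn₂⟩ := h.right.exists_near hβ
  have hr₁ := h.left.1
  have hr₂ := h.right.1
  have hd₁ := h.left.2.1
  have hd₂ := h.right.2.1
  have hlt := h.lt
  set δ := min (min δ₁ δ₂) ((r₂ - r₁) / 2)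
  have hδ : 0 < δ := by have := sub_pos.2 hlt; positivity
  have hδ1 : δ ≤ δ₁ := (min_le_left _ _).trans (min_le_left _ _)
  have hδ2 : δ ≤ δ₂ := (min_le_left _ _).trans (min_le_right _ _)
  have hδ3 : δ ≤ (r₂ - r₁) / 2 := min_le_right _ _
  obtain ⟨κ, hκ, hfar⟩ := h.far δ hδ
  refine ⟨C₁ + C₂ + δ⁻¹, κ, by positivity, hκ, fun ν p r hν hp => ?_⟩
  have hp1 : 0 < r₁ ^ p := Real.rpow_pos_of_pos hr₁ p
  have hp2 : 0 < r₂ ^ p := Real.rpow_pos_of_pos hr₂ p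
  have hE : 1 ≤ Real.exp (β * |p|) := Real.one_le_exp (by positivity)
  have he1 := wellError_nonneg r₁ d₁ ν r
  have he2 := wellError_nonneg r₂ d₂ ν r
  have hg1 : 0 ≤ wellGaussian r₁ d₁ ν r := (Real.exp_pos _).le
  have hg2 : 0 ≤ wellGaussian r₂ d₂ ν r := (Real.exp_pos _).le
  have hH : 0 ≤ Real.exp (-(κ * ν)) * (2 * (1 + r ^ 2)⁻¹) := by positivity
  set E := Real.exp (β * |p|)
  set A := r₁ ^ p * wellError r₁ d₁ ν r
  set B := r₂ ^ p * wellError r₂ d₂ ν r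
  have hA : 0 ≤ A := mul_nonneg hp1.le he1
  have hB : 0 ≤ B := mul_nonneg hp2.le he2
  have hEA : A ≤ E * A := le_mul_of_one_le_left hA hE
  have hEB : B ≤ E * B := le_mul_of_one_le_left hB hE
  have hδi : 0 < δ⁻¹ := inv_pos.2 hδ
  have far1 : δ ≤ |r - r₁| → r₁ ^ p * wellGaussian r₁ d₁ ν r ≤ δ⁻¹ * (E * A) := fun hfr => by
    have := mul_le_mul_of_nonneg_left (wellGaussian_le_wellError hd₁ hν hδ hfr) hp1.le
    have h2 := mul_le_mul_of_nonneg_left hEA hδi.le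
    simp only [A] at h2 ⊢
    linarith
  have far2 : δ ≤ |r - r₂| → r₂ ^ p * wellGaussian r₂ d₂ ν r ≤ δ⁻¹ * (E * B) := fun hfr => by
    have := mul_le_mul_of_nonneg_left (wellGaussian_le_wellError hd₂ hν hδ hfr) hp2.le
    have h2 := mul_le_mul_of_nonneg_left hEB hδi.le
    simp only [B] at h2 ⊢
    linarith
  have x1 : 0 ≤ C₁ * (E * A) := by positivity
  have x2 : 0 ≤ C₂ * (E * A) := by positivity
  have x3 : 0 ≤ C₁ * (E * B) := by positivity
  have x4 : 0 ≤ C₂ * (E * B) := by positivity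
  have x5 : 0 ≤ δ⁻¹ * (E * A) := by positivity
  have x6 : 0 ≤ δ⁻¹ * (E * B) := by positivity
  have hg1' : 0 ≤ r₁ ^ p * wellGaussian r₁ d₁ ν r := mul_nonneg hp1.le hg1
  have hg2' : 0 ≤ r₂ ^ p * wellGaussian r₂ d₂ ν r := mul_nonneg hp2.le hg2
  have expand : (C₁ + C₂ + δ⁻¹) * E * (A + B) = C₁ * (E * A) + C₂ * (E * A) + C₁ * (E * B) +
      C₂ * (E * B) + δ⁻¹ * (E * A) + δ⁻¹ * (E * B) := by ring
  rw [expand]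
  rcases le_or_gt r 0 with hr0 | hr0
  · rw [Set.indicator_of_notMem (by simpa using hr0), zero_sub, abs_neg, abs_of_nonneg (by positivity)]
    have f1 := far1 (by rw [abs_of_nonpos (by linarith)]; linarith)
    have f2 := far2 (by rw [abs_of_nonpos (by linarith)]; linarith)
    linarith
  · rw [Set.indicator_of_mem (show r ∈ Set.Ioi 0 from hr0)]
    rcases lt_or_ge |r - r₁| δ with hn1 | hf1
    · have f2 := far2 (by
        rw [abs_lt] at hn1
        rw [abs_of_nonpos (by linarith)]; linarith)
      have n1 := (hn₁ r (hn1.trans_le hδ1)).2 ν p hν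
      rw [← sub_sub]
      refine (abs_sub _ _).trans ?_
      rw [abs_of_nonneg hg2']
      have : C₁ * (r₁ ^ p * E) * wellError r₁ d₁ ν r = C₁ * (E * A) := by simp only [A]; ring
      rw [this] at n1
      simp only [laplaceIntegrand]
      linarith
    · have f1 := far1 hf1
      rcases lt_or_ge |r - r₂| δ with hn2 | hf2
      · have n2 := (hn₂ r (hn2.trans_le hδ2)).2 ν p hν
        rw [add_comm, ← sub_sub]
        refine (abs_sub _ _).trans ?_
        rw [abs_of_nonneg hg1']
        have : C₂ * (r₂ ^ p * E) * wellError r₂ d₂ ν r = C₂ * (E * B) := by simp only [B]; ring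
        rw [this] at n2
        simp only [laplaceIntegrand]
        linarith
      · have f2 := far2 hf2
        have hfr := hfar r hr0 hf1 hf2
        have hL : laplaceIntegrand f ν p r ≤ Real.exp (-(κ * ν)) * (2 * (1 + r ^ 2)⁻¹) := by
          calc laplaceIntegrand f ν p r
              ≤ Real.exp (|p| * |Real.log r|) * Real.exp (-ν * (κ * (1 + |Real.log r|))) := by
                refine mul_le_mul (rpow_le_exp_abs_mul hr0 p) ?_ (Real.exp_pos _).le
                  (Real.exp_pos _).le
                exact Real.exp_le_exp.2 (by nlinarith [mul_le_mul_of_nonneg_left hfr hν])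
            _ ≤ Real.exp (-(κ * ν)) * Real.exp (-(2 * |Real.log r|)) := by
                rw [← Real.exp_add, ← Real.exp_add]
                refine Real.exp_le_exp.2 ?_
                nlinarith [mul_le_mul_of_nonneg_right hp (abs_nonneg (Real.log r))]
            _ ≤ _ := mul_le_mul_of_nonneg_left (exp_neg_two_mul_abs_log_le hr0) (Real.exp_pos _).le
        have hL0 : 0 ≤ laplaceIntegrand f ν p r :=
          mul_nonneg (Real.rpow_nonneg hr0.le p) (Real.exp_pos _).le
        refine (abs_sub _ _).trans ?_
        rw [abs_of_nonneg hL0, abs_of_nonneg (add_nonneg hg1' hg2')]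
        linarith

/-- Laplace's method with an error that is uniform in the exponent `p`. -/
lemma exists_laplace (h : IsDoubleWell f r₁ r₂ d₁ d₂) {β : ℝ} (hβ : 0 < β) :
    ∃ C ε ν₀ : ℝ, 0 ≤ C ∧ 0 < ε ∧ 0 < ν₀ ∧ ∀ ν p : ℝ, ν₀ ≤ ν → |p| ≤ ε * ν →
      IntegrableOn (laplaceIntegrand f ν p) (Set.Ioi 0) ∧
      |(∫ r in Set.Ioi 0, laplaceIntegrand f ν p r) -
        (r₁ ^ p * √(π / (2 * d₁ * ν)) + r₂ ^ p * √(π / (2 * d₂ * ν)))| ≤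
      C / ν * Real.exp (β * |p|) * (r₁ ^ p + r₂ ^ p) := by
  obtain ⟨C, κ, hC, hκ, hpt⟩ := h.exists_pointwise hβ
  have hr₁ := h.left.1
  have hr₂ := h.right.1
  have hd₁ := h.left.2.1
  have hd₂ := h.right.2.1
  set I₁ := ∫ r, wellError 0 d₁ 1 r
  set I₂ := ∫ r, wellError 0 d₂ 1 r
  have hI₁ : 0 ≤ I₁ := integral_nonneg fun r => wellError_nonneg _ _ _ _
  have hI₂ : 0 ≤ I₂ := integral_nonneg fun r => wellError_nonneg _ _ _ _
  set Λ := |Real.log r₁|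
  have hΛ : 0 ≤ Λ := abs_nonneg _
  -- With this ε and ν₀, |p|(1+Λ) ≤ κν/2 and 2 ≤ κν/2. This yields both |p| + 2 ≤ κν and r₁^p ≥
  -- e^{-κν/2}.
  refine ⟨C * (I₁ + I₂) + 2 * π * (2 / κ), κ / 2 / (1 + Λ), 4 / κ, by positivity, by positivity,
    by positivity, fun ν p hν hp => ?_⟩
  have hν0 : 0 < ν := (by positivity : 0 < 4 / κ).trans_le hν
  have hκν : 4 ≤ κ * ν := by rw [div_le_iff₀ hκ] at hν; linarith
  have hp' : |p| * (1 + Λ) ≤ κ / 2 * ν := by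
    have := mul_le_mul_of_nonneg_right hp (by positivity : 0 ≤ 1 + Λ)
    calc _ ≤ κ / 2 / (1 + Λ) * ν * (1 + Λ) := this
      _ = _ := by field_simp
  have hpΛ : 0 ≤ |p| * Λ := by positivity
  have hp2 : |p| + 2 ≤ κ * ν := by linarith
  have hpt' := fun r => hpt ν p r hν0.le hp2
  have hp2 : 0 < r₂ ^ p := Real.rpow_pos_of_pos hr₂ p
  have iG1 := (integrable_wellGaussian (ρ := r₁) hd₁ hν0).const_mul (r₁ ^ p)
  have iG2 := (integrable_wellGaussian (ρ := r₂) hd₂ hν0).const_mul (r₂ ^ p)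
  have iG : Integrable fun r => r₁ ^ p * wellGaussian r₁ d₁ ν r + r₂ ^ p * wellGaussian r₂ d₂ ν r :=
    iG1.add iG2
  have iE1 := (integrable_wellError (ρ := r₁) hd₁ hν0).const_mul (r₁ ^ p)
  have iE2 := (integrable_wellError (ρ := r₂) hd₂ hν0).const_mul (r₂ ^ p)
  have iE : Integrable fun r => C * Real.exp (β * |p|) *
      (r₁ ^ p * wellError r₁ d₁ ν r + r₂ ^ p * wellError r₂ d₂ ν r) := (iE1.add iE2).const_mul _
  have iH : Integrable fun r : ℝ => Real.exp (-(κ * ν)) * (2 * (1 + r ^ 2)⁻¹) :=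
    (integrable_inv_one_add_sq.const_mul 2).const_mul _
  have hmeas := (h.measurable_laplaceIntegrand ν p).indicator (measurableSet_Ioi (a := (0 : ℝ)))
  have iD : Integrable fun r => (Set.Ioi 0).indicator (laplaceIntegrand f ν p) r -
        (r₁ ^ p * wellGaussian r₁ d₁ ν r + r₂ ^ p * wellGaussian r₂ d₂ ν r) :=
    (iE.add iH).mono' (hmeas.aestronglyMeasurable.sub iG.aestronglyMeasurable)
      (ae_of_all _ hpt')
  have iF : Integrable ((Set.Ioi 0).indicator (laplaceIntegrand f ν p)) :=
    (iD.add iG).congr (ae_of_all _ fun r => by simp)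
  refine ⟨(integrable_indicator_iff measurableSet_Ioi).1 iF, ?_⟩
  have key := norm_integral_le_of_norm_le
    (f := fun r => (Set.Ioi 0).indicator (laplaceIntegrand f ν p) r -
        (r₁ ^ p * wellGaussian r₁ d₁ ν r + r₂ ^ p * wellGaussian r₂ d₂ ν r))
    (iE.add iH) (ae_of_all _ fun r => hpt' r)
  have hadd : ∫ r, (r₁ ^ p * wellGaussian r₁ d₁ ν r + r₂ ^ p * wellGaussian r₂ d₂ ν r) =
      r₁ ^ p * √(π / (2 * d₁ * ν)) + r₂ ^ p * √(π / (2 * d₂ * ν)) := by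
    rw [integral_add iG1 iG2, integral_const_mul, integral_const_mul, integral_wellGaussian,
      integral_wellGaussian]
  have hdom : ∫ r, ((fun r => C * Real.exp (β * |p|) *
        (r₁ ^ p * wellError r₁ d₁ ν r + r₂ ^ p * wellError r₂ d₂ ν r)) +
        fun r : ℝ => Real.exp (-(κ * ν)) * (2 * (1 + r ^ 2)⁻¹)) r =
      C * Real.exp (β * |p|) * (r₁ ^ p * (I₁ / ν) + r₂ ^ p * (I₂ / ν)) +
        Real.exp (-(κ * ν)) * (2 * π) := by
    rw [integral_add' iE iH, integral_const_mul, integral_add iE1 iE2, integral_const_mul,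
      integral_const_mul, integral_wellError r₁ d₁ hν0, integral_wellError r₂ d₂ hν0,
      integral_const_mul, integral_const_mul, integral_univ_inv_one_add_sq]
  rw [hdom, integral_sub iF iG, hadd, integral_indicator measurableSet_Ioi] at key
  refine key.trans ?_
  have hE : 1 ≤ Real.exp (β * |p|) := Real.one_le_exp (by positivity)
  -- One half of the exponent pays for r₁^p, the other for 1/ν, so the far region has the same
  -- relative size as the well errors.
  have hsmall : Real.exp (-(κ * ν)) ≤ 2 / κ / ν * r₁ ^ p := by
    have h1 : Real.exp (-(κ / 2 * ν)) ≤ r₁ ^ p := by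
      refine le_trans (Real.exp_le_exp.2 ?_) (exp_neg_abs_mul_le_rpow hr₁ p)
      have : 0 ≤ |p| := abs_nonneg p
      linarith
    have h2 : Real.exp (-(κ / 2 * ν)) ≤ 2 / κ / ν := by
      rw [Real.exp_neg, show 2 / κ / ν = (κ / 2 * ν)⁻¹ by field_simp,
        inv_le_inv₀ (Real.exp_pos _) (by positivity)]
      have := Real.add_one_le_exp (κ / 2 * ν)
      linarith
    calc Real.exp (-(κ * ν)) = Real.exp (-(κ / 2 * ν)) * Real.exp (-(κ / 2 * ν)) := by
          rw [← Real.exp_add]; ring_nf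
      _ ≤ _ := mul_le_mul h2 h1 (Real.exp_pos _).le (by positivity)
  set E := Real.exp (β * |p|)
  calc C * E * (r₁ ^ p * (I₁ / ν) + r₂ ^ p * (I₂ / ν)) + Real.exp (-(κ * ν)) * (2 * π)
      ≤ C * E * (r₁ ^ p * ((I₁ + I₂) / ν) + r₂ ^ p * ((I₁ + I₂) / ν)) +
        (2 / κ / ν * (r₁ ^ p + r₂ ^ p)) * (2 * π) * E := by
        have h1 : I₁ / ν ≤ (I₁ + I₂) / ν := by gcongr; linarith
        have h2 : I₂ / ν ≤ (I₁ + I₂) / ν := by gcongr; linarith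
        have h3 : Real.exp (-(κ * ν)) * (2 * π) ≤ (2 / κ / ν * (r₁ ^ p + r₂ ^ p)) * (2 * π) := by
          refine mul_le_mul_of_nonneg_right (hsmall.trans ?_) (by positivity)
          exact mul_le_mul_of_nonneg_left (by linarith) (by positivity)
        have h4 : (2 / κ / ν * (r₁ ^ p + r₂ ^ p)) * (2 * π) ≤
            (2 / κ / ν * (r₁ ^ p + r₂ ^ p)) * (2 * π) * E :=
          le_mul_of_one_le_right (by positivity) hE
        refine add_le_add ?_ (h3.trans h4)
        gcongr
    _ = _ := by ring

/-- A lower bound for the Laplace integral, uniform in the exponent `p`. -/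
lemma exists_lower (h : IsDoubleWell f r₁ r₂ d₁ d₂) :
    ∃ c ν₀ : ℝ, 0 < c ∧ 0 < ν₀ ∧ ∀ ν p : ℝ, ν₀ ≤ ν →
      IntegrableOn (laplaceIntegrand f ν p) (Set.Ioi 0) →
      c / √ν * (r₁ ^ p + r₂ ^ p) ≤ ∫ r in Set.Ioi 0, laplaceIntegrand f ν p r := by
  obtain ⟨_, δ₁, -, hδ₁, hδρ₁, hn₁⟩ := h.left.exists_near one_pos
  obtain ⟨_, δ₂, -, hδ₂, hδρ₂, hn₂⟩ := h.right.exists_near one_pos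
  have hr₁ := h.left.1
  have hr₂ := h.right.1
  have hd₁ := h.left.2.1
  have hd₂ := h.right.2.1
  have hlt := h.lt
  set δ := min δ₁ δ₂
  have hδ : 0 < δ := lt_min hδ₁ hδ₂
  -- On an interval of length ν^{-1/2} ending at a well, νf ≤ 3d. The threshold on ν below keeps
  -- this interval inside the region where the well bounds hold.
  set c := Real.exp (-(3 * (d₁ + d₂)))
  refine ⟨c / 2, (δ⁻¹) ^ 2 + 1, by positivity, by positivity, fun ν p hν hint => ?_⟩
  have hν0 : 0 < ν := (by positivity : 0 < δ⁻¹ ^ 2 + 1).trans_le hν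
  have hs : 0 < √ν := Real.sqrt_pos.2 hν0
  have hsδ : (√ν)⁻¹ < δ := by
    rw [inv_lt_comm₀ hs hδ]
    exact Real.lt_sqrt_of_sq_lt (by linarith)
  have hs2 : ν * ((√ν)⁻¹) ^ 2 = 1 := by
    rw [inv_pow, Real.sq_sqrt hν0.le, mul_inv_cancel₀ hν0.ne']
  have hnonneg : ∀ r ∈ Set.Ioi (0 : ℝ), 0 ≤ laplaceIntegrand f ν p r := fun r hr =>
    mul_nonneg (Real.rpow_nonneg (le_of_lt hr) p) (Real.exp_pos _).le
  have interval : ∀ s A : ℝ, 0 < s → (∀ r ∈ Set.Icc s (s + (√ν)⁻¹), A ≤ laplaceIntegrand f ν p r) →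
      A * (√ν)⁻¹ ≤ ∫ r in Set.Ioi 0, laplaceIntegrand f ν p r := fun s A hs0 hA => by
    have hsub : Set.Icc s (s + (√ν)⁻¹) ⊆ Set.Ioi 0 := fun r hr => hs0.trans_le hr.1
    have h1 := setIntegral_ge_of_const_le_real measurableSet_Icc
      (by simp : volume (Set.Icc s (s + (√ν)⁻¹)) ≠ ⊤) hA (hint.mono_set hsub)
    have h2 := setIntegral_mono_set hint
      ((ae_restrict_iff' measurableSet_Ioi).2 (ae_of_all _ hnonneg)) hsub.eventuallyLE
    rw [Real.volume_real_Icc_of_le (by linarith [inv_pos.2 hs]), add_sub_cancel_left] at h1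
    exact h1.trans h2
  have expbound : ∀ ρ d r : ℝ, 0 < d → d ≤ d₁ + d₂ → |r - ρ| ≤ (√ν)⁻¹ →
      f r ≤ 3 * d * (r - ρ) ^ 2 → c ≤ Real.exp (-ν * f r) := fun ρ d r hd hdd hr hf => by
    refine Real.exp_le_exp.2 ?_
    have h1 : (r - ρ) ^ 2 ≤ ((√ν)⁻¹) ^ 2 := by
      rw [← sq_abs]; exact pow_le_pow_left₀ (abs_nonneg _) hr 2
    have h2 : ν * (r - ρ) ^ 2 ≤ 1 := by
      rw [← hs2]; exact mul_le_mul_of_nonneg_left h1 hν0.le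
    have h3 : ν * f r ≤ ν * (3 * d * (r - ρ) ^ 2) := mul_le_mul_of_nonneg_left hf hν0.le
    have h4 : 3 * d * (ν * (r - ρ) ^ 2) ≤ 3 * d * 1 :=
      mul_le_mul_of_nonneg_left h2 (by positivity)
    linarith
  have hdiv : c / 2 / √ν * (r₁ ^ p + r₂ ^ p) = c * ((r₁ ^ p + r₂ ^ p) / 2) * (√ν)⁻¹ := by
    rw [div_eq_mul_inv _ (√ν)]; ring
  rw [hdiv]
  have hc : 0 < c := Real.exp_pos _
  -- The interval is placed outside [r₁,r₂]: to the right of r₂ for p ≥ 0 and to the left of r₁ for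
  -- p ≤ 0. There r^p is at least the larger of r₁^p and r₂^p, so nothing is lost however large |p|
  -- is.
  rcases le_total 0 p with hp | hp
  · have hle : r₁ ^ p ≤ r₂ ^ p := Real.rpow_le_rpow hr₁.le hlt.le hp
    refine le_trans ?_ (interval r₂ (c * r₂ ^ p) hr₂ fun r hr => ?_)
    · gcongr
      linarith
    · have ha : |r - r₂| ≤ (√ν)⁻¹ := by
        rw [abs_of_nonneg (by linarith [hr.1])]; linarith [hr.2]
      have hw := (hn₂ r (ha.trans_lt (hsδ.trans_le (min_le_right _ _)))).1.2
      rw [mul_comm]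
      exact mul_le_mul (Real.rpow_le_rpow hr₂.le hr.1 hp)
        (expbound r₂ d₂ r hd₂ (by linarith) ha hw) hc.le (Real.rpow_nonneg (by linarith [hr.1]) p)
  · have hle : r₂ ^ p ≤ r₁ ^ p := Real.rpow_le_rpow_of_nonpos hr₁ hlt.le hp
    have hpos : 0 < r₁ - (√ν)⁻¹ := by
      have : δ ≤ δ₁ := min_le_left _ _
      linarith
    refine le_trans ?_ (interval (r₁ - (√ν)⁻¹) (c * r₁ ^ p) hpos fun r hr => ?_)
    · gcongr
      linarith
    · rw [sub_add_cancel] at hr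
      have ha : |r - r₁| ≤ (√ν)⁻¹ := by
        rw [abs_of_nonpos (by linarith [hr.2])]; linarith [hr.1]
      have hw := (hn₁ r (ha.trans_lt (hsδ.trans_le (min_le_left _ _)))).1.2
      have hr0 : 0 < r := hpos.trans_le hr.1
      rw [mul_comm]
      exact mul_le_mul (Real.rpow_le_rpow_of_nonpos hr0 hr.2 hp)
        (expbound r₁ d₁ r hd₁ (by linarith) ha hw) hc.le (Real.rpow_nonneg hr0.le p)

end IsDoubleWell

/-! ### The effective potential of a gap -/

/-- The radial profile `r ↦ q(r) - 2 M log r - c`. -/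
def gapPotential (q : ℝ → ℝ) (M c r : ℝ) : ℝ :=
  radialPotential q (r : ℂ) - 2 * M * Real.log r - c

/-- Going through `radialPotential` evaluates q at |r|. The profile is thus measurable on all of ℝ
although q is arbitrary on negative numbers. -/
lemma gapPotential_of_nonneg (q : ℝ → ℝ) (M c : ℝ) {r : ℝ} (hr : 0 ≤ r) :
    gapPotential q M c r = q r - 2 * M * Real.log r - c := by
  rw [gapPotential, radialPotential_ofReal q hr]

lemma isWell_gapPotential {q : ℝ → ℝ} {ρ M c : ℝ} (hρ : 0 < ρ)
    (hQ : ContDiffAt ℝ 3 (radialPotential q) ρ)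
    (hd : 0 < quarterLaplacian (radialPotential q) ρ) (hc : q ρ - 2 * M * Real.log ρ = c)
    (hmin : ∀ r, 0 < r → c ≤ q r - 2 * M * Real.log r) :
    IsWell (gapPotential q M c) ρ (quarterLaplacian (radialPotential q) ρ) := by
  have hloc : IsLocalMin (fun r => q r - 2 * M * Real.log r) ρ := by
    filter_upwards [lt_mem_nhds hρ] with r hr
    rw [hc]; exact hmin r hr
  obtain ⟨C, δ, hC, hδ, h⟩ := exists_expansion_at_min hρ hQ hloc
  refine ⟨hρ, hd, C, min δ ρ, hC, lt_min hδ hρ, fun r hr => ?_⟩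
  have hr0 : 0 < r := by linarith [(abs_lt.1 (hr.trans_le (min_le_right _ _))).1]
  rw [gapPotential_of_nonneg q M c hr0.le, ← hc]
  exact h r (hr.trans_le (min_le_left _ _))

lemma exists_forall_le_of_lowerSemicontinuousOn {φ : ℝ → ℝ} {K : Set ℝ} (hK : IsCompact K)
    (hφ : LowerSemicontinuousOn φ K) (hpos : ∀ r ∈ K, 0 < φ r) :
    ∃ κ, 0 < κ ∧ ∀ r ∈ K, κ ≤ φ r := by
  rcases K.eq_empty_or_nonempty with rfl | hne
  · exact ⟨1, one_pos, by simp⟩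
  · obtain ⟨z, hz, hmin⟩ := hφ.exists_isMinOn hne hK
    exact ⟨φ z, hpos z hz, fun r hr => hmin hr⟩

lemma lowerSemicontinuous_profile {q : ℝ → ℝ} (h : LowerSemicontinuous (radialPotential q)) :
    LowerSemicontinuous fun r : ℝ => radialPotential q (r : ℂ) :=
  h.comp Complex.continuous_ofReal

lemma measurable_gapPotential {q : ℝ → ℝ} (h : LowerSemicontinuous (radialPotential q))
    (M c : ℝ) : Measurable (gapPotential q M c) := by
  have := (lowerSemicontinuous_profile h).measurable
  unfold gapPotential
  fun_prop

/-- Coercivity of the effective potential away from its minima. -/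
lemma exists_far_bound {q : ℝ → ℝ} {M c r₁ r₂ : ℝ}
    (hlsc : LowerSemicontinuous (radialPotential q))
    (hgrow : Tendsto (fun z : ℂ => radialPotential q z - 2 * Real.log ‖z‖) (cocompact ℂ) atTop)
    (hM0 : 0 < M) (hM1 : M < 1)
    (hmin : ∀ r, 0 < r → r ≠ r₁ → r ≠ r₂ → 0 < gapPotential q M c r) {δ : ℝ} (hδ : 0 < δ) :
    ∃ κ, 0 < κ ∧ ∀ r, 0 < r → δ ≤ |r - r₁| → δ ≤ |r - r₂| →
      κ * (1 + |Real.log r|) ≤ gapPotential q M c r := by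
  have hlsc' := lowerSemicontinuous_profile hlsc
  -- For r ≥ R the growth condition leaves at least 2(1-M)(1 + log r), and M < 1 makes this
  -- coercive.
  obtain ⟨R, hR1, hR⟩ : ∃ R : ℝ, 1 ≤ R ∧ ∀ r, R ≤ r →
      2 * (1 - M) + c ≤ q r - 2 * Real.log r := by
    have h1 := hgrow.eventually_ge_atTop (2 * (1 - M) + c)
    rw [Metric.cobounded_eq_cocompact.symm, ← comap_norm_atTop, eventually_comap] at h1
    obtain ⟨R, hR⟩ := eventually_atTop.1 h1
    refine ⟨max R 1, le_max_right _ _, fun r hr => ?_⟩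
    have hr0 : 0 ≤ r := zero_le_one.trans ((le_max_right _ _).trans hr)
    have hn : ‖(r : ℂ)‖ = r := Complex.norm_of_nonneg hr0
    have := hR r ((le_max_left _ _).trans hr) (r : ℂ) hn
    rwa [radialPotential_ofReal q hr0, hn] at this
  obtain ⟨m, hm⟩ : ∃ m : ℝ, ∀ r, 0 < r → r ≤ 1 → m ≤ q r := by
    obtain ⟨z, -, hz⟩ := (hlsc'.lowerSemicontinuousOn (Set.Icc 0 1)).exists_isMinOn
      ⟨0, by simp⟩ isCompact_Icc
    refine ⟨radialPotential q (z : ℂ), fun r hr0 hr1 => ?_⟩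
    have := hz ⟨hr0.le, hr1⟩
    simp only [Set.mem_ofPred_eq] at this
    rwa [radialPotential_ofReal q hr0.le] at this
  -- Chosen so that M|log r| ≥ M + c - m for r ≤ ε. Half of -2M log r then absorbs the constants and
  -- the other half gives M(1 + |log r|). The middle range is compact, and there lower
  -- semicontinuity gives a positive minimum.
  set ε := Real.exp (-(|M + c - m| / M))
  have hε0 : 0 < ε := Real.exp_pos _
  have hε1 : ε ≤ 1 := Real.exp_le_one_iff.2 (by
    have : 0 ≤ |M + c - m| / M := by positivity
    linarith)
  set K : Set ℝ := Set.Icc ε R ∩ ({r | δ ≤ |r - r₁|} ∩ {r | δ ≤ |r - r₂|})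
  have hK : IsCompact K := isCompact_Icc.inter_right
    ((isClosed_le continuous_const (by fun_prop)).inter
      (isClosed_le continuous_const (by fun_prop)))
  have hKpos : ∀ r ∈ K, 0 < r := fun r hr => hε0.trans_le hr.1.1
  have hlog : ContinuousOn (fun r : ℝ => -(2 * M * Real.log r) - c) K := by
    refine ContinuousOn.sub (ContinuousOn.neg (continuousOn_const.mul ?_)) continuousOn_const
    exact Real.continuousOn_log.mono fun r hr => (hKpos r hr).ne'
  have hφ : LowerSemicontinuousOn (gapPotential q M c) K := by
    have h := (hlsc'.lowerSemicontinuousOn K).add hlog.lowerSemicontinuousOn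
    have e : gapPotential q M c =
        fun r : ℝ => radialPotential q (r : ℂ) + (-(2 * M * Real.log r) - c) := by
      ext r; rw [gapPotential]; ring
    rw [e]; exact h
  obtain ⟨κ₀, hκ₀, hKb⟩ := exists_forall_le_of_lowerSemicontinuousOn hK hφ fun r hr =>
    hmin r (hKpos r hr) (fun e => by
      have := hr.2.1
      rw [e] at this
      simp at this
      linarith) (fun e => by
      have := hr.2.2
      rw [e] at this
      simp at this
      linarith)
  set Λ := 1 + |Real.log ε| + |Real.log R|
  have hΛ : 0 < Λ := by positivity
  have h1M : 0 < 1 - M := by linarith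
  refine ⟨min (κ₀ / Λ) (min M (1 - M)), by positivity, fun r hr hr1 hr2 => ?_⟩
  have hL : 0 ≤ 1 + |Real.log r| := by positivity
  rcases le_or_gt r ε with hre | hre
  · have hlog1 : Real.log r ≤ -(|M + c - m| / M) := by
      rw [← Real.log_exp (-(|M + c - m| / M))]
      exact Real.log_le_log hr hre
    have hlog0 : Real.log r ≤ 0 := hlog1.trans (by
      have : 0 ≤ |M + c - m| / M := by positivity
      linarith)
    have h3 : M + c - m ≤ M * |Real.log r| := by
      rw [abs_of_nonpos hlog0]
      have h4 := mul_le_mul_of_nonneg_left hlog1 hM0.le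
      have h5 : M * -(|M + c - m| / M) = -|M + c - m| := by field_simp
      rw [h5] at h4
      linarith [le_abs_self (M + c - m)]
    have h4 := hm r hr (hre.trans hε1)
    rw [gapPotential_of_nonneg q M c hr.le]
    have h5 : min (κ₀ / Λ) (min M (1 - M)) * (1 + |Real.log r|) ≤ M * (1 + |Real.log r|) :=
      mul_le_mul_of_nonneg_right ((min_le_right _ _).trans (min_le_left _ _)) hL
    rw [abs_of_nonpos hlog0] at h3 h5 ⊢
    linarith
  · rcases le_or_gt R r with hRr | hRr
    · have h4 := hR r hRr
      have hlog0 : 0 ≤ Real.log r := Real.log_nonneg (hR1.trans hRr)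
      rw [gapPotential_of_nonneg q M c hr.le, abs_of_nonneg hlog0]
      have h5 : min (κ₀ / Λ) (min M (1 - M)) * (1 + Real.log r) ≤ (1 - M) * (1 + Real.log r) :=
        mul_le_mul_of_nonneg_right ((min_le_right _ _).trans (min_le_right _ _)) (by linarith)
      nlinarith [mul_nonneg h1M.le hlog0]
    · have h4 := hKb r ⟨⟨hre.le, hRr.le⟩, hr1, hr2⟩
      have h6 : |Real.log r| ≤ |Real.log ε| + |Real.log R| := by
        have e1 := Real.log_le_log hε0 hre.le
        have e2 := Real.log_le_log hr hRr.le
        rw [abs_le]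
        constructor
        · linarith [neg_abs_le (Real.log ε), abs_nonneg (Real.log R)]
        · linarith [le_abs_self (Real.log R), abs_nonneg (Real.log ε)]
      calc _ ≤ κ₀ / Λ * (1 + |Real.log r|) := mul_le_mul_of_nonneg_right (min_le_left _ _) hL
        _ ≤ κ₀ / Λ * Λ := mul_le_mul_of_nonneg_left (by simp only [Λ]; linarith) (by positivity)
        _ = κ₀ := div_mul_cancel₀ _ hΛ.ne'
        _ ≤ _ := h4

/-- The effective potential of a gap has exactly two wells, at the boundary radii. -/
theorem IsAnnularPotential.exists_isDoubleWell {q : ℝ → ℝ} {σ : Measure ℂ} {N : ℕ} {a b : ℕ → ℝ}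
    (hQ : IsAnnularPotential q σ N a b) {k : ℕ} (hk : k < N)
    (hsmooth : SmoothNear 6 (radialPotential q) (frontier (gap (b k) (a (k + 1))))) :
    ∃ M c : ℝ, 0 < M ∧ M < 1 ∧ gapParameter q (b k) (a (k + 1)) = 2 * M ∧
      IsDoubleWell (gapPotential q M c) (b k) (a (k + 1))
        (quarterLaplacian (radialPotential q) (b k : ℂ))
        (quarterLaplacian (radialPotential q) (a (k + 1) : ℂ)) := by
  obtain ⟨M, c, hM0, hM1, hB, hc1, hc2, hlt⟩ := hQ.radial_obstacle hk
  have h1 : 0 < b k := hQ.outer_pos hk.le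
  have h12 := hQ.lt_gap k hk
  have hmin : ∀ r, 0 < r → c ≤ q r - 2 * M * Real.log r := fun r hr => by
    by_cases e1 : r = b k
    · rw [e1, hc1]
    · by_cases e2 : r = a (k + 1)
      · rw [e2, hc2]
      · exact (hlt r hr e1 e2).le
  refine ⟨M, c, hM0, hM1, hB, measurable_gapPotential hQ.lowerSemicontinuous M c, h12, ?_, ?_, ?_⟩
  · exact isWell_gapPotential h1 ((hsmooth.contDiffAt (inner_mem_frontier_gap h1 h12)).of_le
      (by norm_num)) (hQ.laplacian_pos _ (hQ.outer_mem_frontier hk)) hc1 hmin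
  · exact isWell_gapPotential (h1.trans h12) ((hsmooth.contDiffAt
      (outer_mem_frontier_gap h1 h12)).of_le (by norm_num))
      (hQ.laplacian_pos _ (hQ.inner_mem_frontier hk)) hc2 hmin
  · intro δ hδ
    refine exists_far_bound hQ.lowerSemicontinuous hQ.growth hM0 hM1 (fun r hr e1 e2 => ?_) hδ
    rw [gapPotential_of_nonneg q M c hr.le]
    linarith [hlt r hr e1 e2]

/-! ### Norms of the weighted monomials -/

lemma norm_weightedMonomial (q : ℝ → ℝ) (n j : ℕ) (z : ℂ) :
    ‖weightedMonomial (radialPotential q) n j z‖ =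
      ‖z‖ ^ j * Real.exp (-((n : ℝ) / 2) * q ‖z‖) := by
  rw [weightedMonomial, norm_mul, norm_pow, Complex.norm_real, Real.norm_of_nonneg (Real.exp_pos _).le,
    radialPotential]

/-- Polar coordinates, with r^{2nM} and e^{-nc} moved between the power and the weight. No
integrability is required: if the norm is infinite, both integrals take the default value 0. -/
lemma integral_norm_sq_weightedMonomial (q : ℝ → ℝ) (M c : ℝ) (n j : ℕ) :
    ∫ u, ‖weightedMonomial (radialPotential q) n j u‖ ^ 2 ∂areaMeasure =
      Real.exp (-(n * c)) * (2 * ∫ r in Set.Ioi (0 : ℝ),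
        laplaceIntegrand (gapPotential q M c) n (2 * j + 1 - 2 * (n * M)) r) := by
  simp only [norm_weightedMonomial]
  rw [areaMeasure, integral_smul_measure, ENNReal.toReal_ofReal (by positivity),
    integral_fun_norm_addHaar volume
      (fun y : ℝ => (y ^ j * Real.exp (-((n : ℝ) / 2) * q y)) ^ 2)]
  have hvol : volume.real (Metric.ball (0 : ℂ) 1) = π := by
    simp [Measure.real, Complex.volume_ball]
  rw [hvol, Complex.finrank_real_complex]
  have hcongr : ∫ y in Set.Ioi (0 : ℝ), y ^ (2 - 1) • (y ^ j * Real.exp (-((n : ℝ) / 2) * q y)) ^ 2 =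
      ∫ y in Set.Ioi (0 : ℝ), Real.exp (-(n * c)) *
        laplaceIntegrand (gapPotential q M c) n (2 * j + 1 - 2 * (n * M)) y := by
    refine setIntegral_congr_fun measurableSet_Ioi fun y hy => ?_
    have hy0 : 0 < y := hy
    simp only [laplaceIntegrand]
    rw [gapPotential_of_nonneg q M c hy0.le, Real.rpow_def_of_pos hy0, smul_eq_mul]
    have e1 : y ^ (2 - 1) * (y ^ j * Real.exp (-((n : ℝ) / 2) * q y)) ^ 2 =
        y ^ (2 * j + 1) * (Real.exp (-((n : ℝ) / 2) * q y)) ^ 2 := by ring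
    have e2 : y ^ (2 * j + 1) = Real.exp (Real.log y * ((2 * j + 1 : ℕ) : ℝ)) := by
      rw [mul_comm (Real.log y), Real.exp_nat_mul, Real.exp_log hy0]
    rw [e1, e2, sq, ← Real.exp_add, ← Real.exp_add, ← Real.exp_add, ← Real.exp_add]
    congr 1
    push_cast
    ring
  rw [hcongr, integral_const_mul]
  simp only [smul_eq_mul, nsmul_eq_mul, Nat.cast_ofNat]
  field_simp

/-! ### Comparison of the coefficients -/

/-- The normalized Laplace integral `√(ν / 2π) · 2 ∫ r ^ p e^{-ν f(r)} dr`. -/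
def laplaceCoeff (f : ℝ → ℝ) (ν p : ℝ) : ℝ :=
  √(ν / (2 * π)) * (2 * ∫ r in Set.Ioi (0 : ℝ), laplaceIntegrand f ν p r)

/-- The limit `r₁ ^ p / √d₁ + r₂ ^ p / √d₂` of the normalized Laplace integrals. -/
def szegoDenominator (r₁ r₂ d₁ d₂ p : ℝ) : ℝ := r₁ ^ p / √d₁ + r₂ ^ p / √d₂

/-- Once |p| is of order ν, the allowance e^{β|p|} outweighs √ν. The claimed relative error is then
at least 1, and such exponents need no asymptotics. -/
lemma one_le_div_sqrt_mul_exp {β ε ν p : ℝ} (hβ : 0 < β) (hε : 0 < ε) (hν : 0 < ν)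
    (hp : ε * ν ≤ |p|) : 1 ≤ (1 + 1 / (β * ε)) / √ν * Real.exp (β * |p|) := by
  have hs : 0 < √ν := Real.sqrt_pos.2 hν
  have h1 := Real.add_one_le_exp (β * |p|)
  have h2 : 1 ≤ Real.exp (β * |p|) := Real.one_le_exp (by positivity)
  have h3 : β * ε * ν ≤ β * |p| := by
    rw [mul_assoc]; exact mul_le_mul_of_nonneg_left hp hβ.le
  have h4 : ν ≤ 1 / (β * ε) * Real.exp (β * |p|) := by
    rw [div_mul_eq_mul_div, le_div_iff₀ (by positivity)]
    linarith
  have h5 : √ν ≤ 1 + ν := by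
    rw [Real.sqrt_le_left (by positivity)]
    nlinarith
  rw [div_mul_eq_mul_div, one_le_div hs]
  linarith

namespace IsDoubleWell

variable {f : ℝ → ℝ} {r₁ r₂ d₁ d₂ : ℝ}

lemma szegoDenominator_pos (h : IsDoubleWell f r₁ r₂ d₁ d₂) (p : ℝ) :
    0 < szegoDenominator r₁ r₂ d₁ d₂ p := by
  have h1 := Real.rpow_pos_of_pos h.left.1 p
  have h2 := Real.rpow_pos_of_pos h.right.1 p
  have h3 := Real.sqrt_pos.2 h.left.2.1
  unfold szegoDenominator
  positivity

/-- The inverse normalized norms converge to the inverse Szegő denominators, with a relative error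
`O(ν^{-1/2})` up to a small exponential loss in the exponent. -/
lemma exists_inv_laplaceCoeff (h : IsDoubleWell f r₁ r₂ d₁ d₂) {β : ℝ} (hβ : 0 < β) :
    ∃ C ν₀ : ℝ, 0 ≤ C ∧ 0 < ν₀ ∧ ∀ ν p : ℝ, ν₀ ≤ ν →
      |(laplaceCoeff f ν p)⁻¹ - (szegoDenominator r₁ r₂ d₁ d₂ p)⁻¹| ≤
        C / √ν * Real.exp (β * |p|) * (szegoDenominator r₁ r₂ d₁ d₂ p)⁻¹ := by
  obtain ⟨C₁, ε, ν₁, hC₁, hε, hν₁, hlap⟩ := h.exists_laplace hβ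
  obtain ⟨c, ν₂, hc, hν₂, hlow⟩ := h.exists_lower
  have hd₁ := h.left.2.1
  have hd₂ := h.right.2.1
  set A := √d₁ + √d₂
  set A' := 1 / √d₁ + 1 / √d₂
  have hA' : 0 < A' := by positivity
  set c₂ := 2 * c / √(2 * π) / A'
  have hc₂ : 0 < c₂ := by positivity
  set C₃ := 2 * C₁ * A
  set C₄ := 1 + 1 / (β * ε)
  refine ⟨(1 + 1 / c₂) * (C₃ + C₄), max ν₁ ν₂, by positivity, by positivity, fun ν p hν => ?_⟩
  have hν1 : ν₁ ≤ ν := (le_max_left _ _).trans hν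
  have hν2 : ν₂ ≤ ν := (le_max_right _ _).trans hν
  have hν0 : 0 < ν := hν₁.trans_le hν1
  have hp1 := Real.rpow_pos_of_pos h.left.1 p
  have hp2 := Real.rpow_pos_of_pos h.right.1 p
  set W := r₁ ^ p + r₂ ^ p
  have hD := h.szegoDenominator_pos p
  set D := szegoDenominator r₁ r₂ d₁ d₂ p with hDdef
  have hWD : W ≤ A * D := by
    have e : A * D = r₁ ^ p + r₂ ^ p + (√d₂ * (r₁ ^ p / √d₁) + √d₁ * (r₂ ^ p / √d₂)) := by
      simp only [A, hDdef, szegoDenominator]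
      field_simp
      ring
    rw [e]
    have : 0 ≤ √d₂ * (r₁ ^ p / √d₁) + √d₁ * (r₂ ^ p / √d₂) := by positivity
    simp only [W]
    linarith
  have hDW : D ≤ A' * W := by
    have e : A' * W = D + (r₁ ^ p / √d₂ + r₂ ^ p / √d₁) := by
      simp only [A', W, hDdef, szegoDenominator]
      field_simp
      ring
    rw [e]
    have : 0 ≤ r₁ ^ p / √d₂ + r₂ ^ p / √d₁ := by positivity
    linarith
  set J := ∫ r in Set.Ioi (0 : ℝ), laplaceIntegrand f ν p r
  set E := laplaceCoeff f ν p
  have hEJ : E = √(ν / (2 * π)) * (2 * J) := rfl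
  set X := Real.exp (β * |p|)
  have hclose : |p| ≤ ε * ν → |E - D| ≤ C₃ / √ν * X * D := fun hp => by
    have h1 := (hlap ν p hν1 hp).2
    have hg : ∀ d : ℝ, 0 < d → √(ν / (2 * π)) * (2 * √(π / (2 * d * ν))) = 1 / √d := fun d hd => by
      have e1 : ν / (2 * π) * (π / (2 * d * ν)) = 1 / (2 ^ 2 * d) := by
        field_simp
      calc √(ν / (2 * π)) * (2 * √(π / (2 * d * ν)))
          = 2 * √(ν / (2 * π) * (π / (2 * d * ν))) := by
            rw [Real.sqrt_mul (by positivity)]; ring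
        _ = 1 / √d := by
            rw [e1, Real.sqrt_div zero_le_one, Real.sqrt_one, Real.sqrt_mul (by positivity),
              Real.sqrt_sq (by norm_num)]
            field_simp
    have e2 : E - D = √(ν / (2 * π)) * 2 *
        (J - (r₁ ^ p * √(π / (2 * d₁ * ν)) + r₂ ^ p * √(π / (2 * d₂ * ν)))) := by
      have g1 := hg d₁ hd₁
      have g2 := hg d₂ hd₂
      rw [hEJ, hDdef, szegoDenominator, div_eq_mul_one_div (r₁ ^ p), div_eq_mul_one_div (r₂ ^ p), ← g1, ← g2]
      ring
    have e3 : √(ν / (2 * π)) ≤ √ν := Real.sqrt_le_sqrt (div_le_self hν0.le (by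
      linarith [Real.pi_gt_three]))
    rw [e2, abs_mul, abs_of_nonneg (by positivity)]
    calc √(ν / (2 * π)) * 2 * _ ≤ √ν * 2 * (C₁ / ν * X * (A * D)) := by
          refine mul_le_mul (by linarith) (h1.trans ?_) (abs_nonneg _) (by positivity)
          exact mul_le_mul_of_nonneg_left hWD (by positivity)
      _ = C₃ * X * D * (√ν / ν) := by simp only [C₃]; ring
      _ = _ := by rw [Real.sqrt_div_self', ← div_eq_mul_one_div]; ring
  -- A divergent integral has value 0, hence inverse 0, which is the convention for monomials of
  -- infinite norm. Otherwise the lower bound is valid for every p.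
  have hlower : E = 0 ∨ c₂ * D ≤ E := by
    by_cases hi : IntegrableOn (laplaceIntegrand f ν p) (Set.Ioi 0)
    · right
      have h1 := hlow ν p hν2 hi
      have e1 : √(ν / (2 * π)) * (2 * (c / √ν * W)) = 2 * c / √(2 * π) * W := by
        rw [Real.sqrt_div hν0.le]
        field_simp
      have e2 : c₂ * (A' * W) = 2 * c / √(2 * π) * W := by
        simp only [c₂]
        field_simp
      calc c₂ * D ≤ c₂ * (A' * W) := mul_le_mul_of_nonneg_left hDW hc₂.le
        _ = √(ν / (2 * π)) * (2 * (c / √ν * W)) := by rw [e1, e2]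
        _ ≤ E := by
          rw [hEJ]
          exact mul_le_mul_of_nonneg_left (by linarith) (Real.sqrt_nonneg _)
    · left
      have : J = 0 := integral_undef hi
      rw [hEJ, this, mul_zero, mul_zero]
  have hDi : 0 < D⁻¹ := inv_pos.2 hD
  have hc₂i : 0 < 1 / c₂ := by positivity
  set Y := X / √ν
  have eY : ∀ C : ℝ, C / √ν * X = C * Y := fun C => by simp only [Y]; ring
  rw [eY] at hclose ⊢
  have hfar : ¬ |p| ≤ ε * ν → 1 ≤ C₄ * Y := fun hp => by
    rw [← eY]
    exact one_le_div_sqrt_mul_exp hβ hε hν0 (not_le.1 hp).le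
  have hnn1 : 0 ≤ C₃ * Y := by positivity
  have hnn2 : 0 ≤ C₄ * Y := by positivity
  have hnn3 : 0 ≤ 1 / c₂ * (C₃ * Y) := by positivity
  have hnn4 : 0 ≤ 1 / c₂ * (C₄ * Y) := by positivity
  have expand : (1 + 1 / c₂) * (C₃ + C₄) * Y =
    C₃ * Y + C₄ * Y + 1 / c₂ * (C₃ * Y) + 1 / c₂ * (C₄ * Y) := by ring
  rcases hlower with h0 | h0
  · rw [h0, inv_zero, zero_sub, abs_neg, abs_of_pos hDi]
    refine le_mul_of_one_le_left hDi.le ?_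
    rw [expand]
    by_cases hp : |p| ≤ ε * ν
    -- If E = 0, closeness of E to D is possible only when the error bound is itself at least 1.
    · have h1 := hclose hp
      rw [h0, zero_sub, abs_neg, abs_of_pos hD] at h1
      have h2 : 1 ≤ C₃ * Y := by
        by_contra hcon
        have := mul_lt_mul_of_pos_right (not_le.1 hcon) hD
        linarith
      linarith
    · linarith [hfar hp]
  · have hE0 : 0 < E := (by positivity : 0 < c₂ * D).trans_le h0
    have hEi : E⁻¹ ≤ 1 / c₂ * D⁻¹ := by
      rw [one_div, ← mul_inv]
      exact inv_anti₀ (by positivity) h0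
    have hEi0 : 0 < E⁻¹ := inv_pos.2 hE0
    by_cases hp : |p| ≤ ε * ν
    · have h1 := hclose hp
      have e : E⁻¹ - D⁻¹ = (D - E) * (E⁻¹ * D⁻¹) := by field_simp
      rw [e, abs_mul, abs_sub_comm, abs_of_pos (by positivity : 0 < E⁻¹ * D⁻¹)]
      calc |E - D| * (E⁻¹ * D⁻¹) ≤ (C₃ * Y * D) * ((1 / c₂ * D⁻¹) * D⁻¹) := by gcongr
        _ = 1 / c₂ * (C₃ * Y) * D⁻¹ := by field_simp
        _ ≤ _ := by
          refine mul_le_mul_of_nonneg_right ?_ hDi.le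
          rw [expand]
          linarith
    · have h2 := hfar hp
      have h3 : |E⁻¹ - D⁻¹| ≤ (1 + 1 / c₂) * D⁻¹ := by
        rw [abs_le]
        constructor
        · have : 0 ≤ 1 / c₂ * D⁻¹ := by positivity
          linarith
        · linarith
      refine h3.trans (mul_le_mul_of_nonneg_right ?_ hDi.le)
      rw [expand]
      have := mul_le_mul_of_nonneg_left h2 hc₂i.le
      linarith

end IsDoubleWell

/-! ### Summation over the exponents -/

lemma summable_exp_neg_mul_abs {β : ℝ} (hβ : 0 < β) :
    Summable fun ℓ : ℤ => Real.exp (-(β * |(ℓ : ℝ)|)) := by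
  have h1 : Summable fun n : ℕ => Real.exp (-β) ^ n :=
    summable_geometric_of_lt_one (Real.exp_pos _).le (Real.exp_lt_one_iff.2 (by linarith))
  have h2 : ∀ n : ℕ, Real.exp (-β) ^ n = Real.exp (-(β * n)) := fun n => by
    rw [← Real.exp_nat_mul]; ring_nf
  refine Summable.of_nat_of_neg ?_ ?_
  · refine h1.congr fun n => ?_
    rw [h2]; simp
  · refine h1.congr fun n => ?_
    rw [h2]; simp

/-- Substituting ℓ = j - m and extending by zero lets the finite kernel sum be compared with the
Szegő series term by term. -/
lemma sum_range_eq_tsum_int (m : ℤ) (n : ℕ) (F : ℤ → ℂ) :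
    ∑ j ∈ Finset.range n, F (j - m) =
      ∑' ℓ : ℤ, if 0 ≤ ℓ + m ∧ ℓ + m < n then F ℓ else 0 := by
  have hinj : Function.Injective fun j : ℕ => (j : ℤ) - m := fun i j hij => by
    simpa using hij
  rw [tsum_eq_sum (s := (Finset.range n).map ⟨_, hinj⟩), Finset.sum_map]
  · refine Finset.sum_congr rfl fun j hj => ?_
    rw [if_pos]
    · rfl
    · have := Finset.mem_range.1 hj
      simp only [Function.Embedding.coeFn_mk]
      omega
  · intro ℓ hℓ
    rw [if_neg]
    rintro ⟨h1, h2⟩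
    refine hℓ (Finset.mem_map.2 ⟨(ℓ + m).toNat, ?_, ?_⟩)
    · rw [Finset.mem_range]; omega
    · simp only [Function.Embedding.coeFn_mk]; omega

namespace IsDoubleWell

variable {f : ℝ → ℝ} {r₁ r₂ d₁ d₂ : ℝ}

/-- The decay rate of the series of the Szegő kernel. -/
lemma exists_zpow_div_le (h : IsDoubleWell f r₁ r₂ d₁ d₂) {β : ℝ}
    (hβ : 4 * β = Real.log r₂ - Real.log r₁) :
    ∃ C : ℝ, 0 ≤ C ∧ ∀ (x R : ℝ) (ℓ : ℤ), 0 ≤ x → x ≤ 1 → 0 < R →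
      |Real.log R - (Real.log r₁ + Real.log r₂)| ≤ β →
      R ^ ℓ * (szegoDenominator r₁ r₂ d₁ d₂ (2 * ℓ + 1 - 2 * x))⁻¹ ≤
        C * Real.exp (-(3 * β * |(ℓ : ℝ)|)) := by
  have hs₁ := Real.sqrt_pos.2 h.left.2.1
  have hs₂ := Real.sqrt_pos.2 h.right.2.1
  refine ⟨√d₁ * Real.exp |Real.log r₁| + √d₂ * Real.exp |Real.log r₂|, by positivity,
    fun x R ℓ hx0 hx1 hR hlog => ?_⟩
  have hR' : R ^ ℓ = Real.exp (ℓ * Real.log R) := by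
    rw [mul_comm, ← Real.rpow_def_of_pos hR, Real.rpow_intCast]
  have hp1 := Real.rpow_pos_of_pos h.left.1 (2 * ℓ + 1 - 2 * x)
  have hp2 := Real.rpow_pos_of_pos h.right.1 (2 * ℓ + 1 - 2 * x)
  have hlog' := abs_le.1 hlog
  have hax : |1 - 2 * x| ≤ 1 := abs_le.2 ⟨by linarith, by linarith⟩
  have main : ∀ r d : ℝ, 0 < r → 0 < √d →
      r ^ (2 * (ℓ : ℝ) + 1 - 2 * x) / √d ≤ szegoDenominator r₁ r₂ d₁ d₂ (2 * ℓ + 1 - 2 * x) →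
      ℓ * (Real.log R - 2 * Real.log r) ≤ -(3 * β * |(ℓ : ℝ)|) →
      R ^ ℓ * (szegoDenominator r₁ r₂ d₁ d₂ (2 * ℓ + 1 - 2 * x))⁻¹ ≤
        √d * Real.exp |Real.log r| * Real.exp (-(3 * β * |(ℓ : ℝ)|)) :=
    fun r d hr hd hle hexp => by
      calc R ^ ℓ * (szegoDenominator r₁ r₂ d₁ d₂ (2 * ℓ + 1 - 2 * x))⁻¹
          ≤ R ^ ℓ * (r ^ (2 * (ℓ : ℝ) + 1 - 2 * x) / √d)⁻¹ := by
            gcongr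
        _ = √d * Real.exp (ℓ * Real.log R - Real.log r * (2 * ℓ + 1 - 2 * x)) := by
            rw [hR', Real.rpow_def_of_pos hr, inv_div, Real.exp_sub]
            ring
        _ ≤ √d * Real.exp (|Real.log r| + -(3 * β * |(ℓ : ℝ)|)) := by
            gcongr
            have h1 : -(Real.log r * (1 - 2 * x)) ≤ |Real.log r| := by
              refine (neg_le_abs _).trans ?_
              rw [abs_mul]
              exact mul_le_of_le_one_right (abs_nonneg _) hax
            linarith
        _ = _ := by rw [Real.exp_add]; ring
  have hc1 : 0 ≤ √d₁ * Real.exp |Real.log r₁| * Real.exp (-(3 * β * |(ℓ : ℝ)|)) := by positivity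
  have hc2 : 0 ≤ √d₂ * Real.exp |Real.log r₂| * Real.exp (-(3 * β * |(ℓ : ℝ)|)) := by positivity
  rw [add_mul]
  -- Only the dominant term of the denominator is kept: r₂ for ℓ ≥ 0, r₁ for ℓ ≤ 0. Either ratio
  -- decays at rate log(r₂/r₁) = 4β, less the β allowed for log R.
  rcases le_total 0 (ℓ : ℝ) with hℓ | hℓ
  · refine (main r₂ d₂ h.right.1 hs₂ ?_ ?_).trans (by linarith)
    · rw [szegoDenominator]
      have : 0 < r₁ ^ (2 * (ℓ : ℝ) + 1 - 2 * x) / √d₁ := by positivity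
      linarith
    · rw [abs_of_nonneg hℓ]
      have : Real.log R - 2 * Real.log r₂ ≤ -(3 * β) := by linarith
      nlinarith [mul_le_mul_of_nonneg_left this hℓ]
  · refine (main r₁ d₁ h.left.1 hs₁ ?_ ?_).trans (by linarith)
    · rw [szegoDenominator]
      have : 0 < r₂ ^ (2 * (ℓ : ℝ) + 1 - 2 * x) / √d₂ := by positivity
      linarith
    · rw [abs_of_nonpos hℓ]
      have : 3 * β ≤ Real.log R - 2 * Real.log r₁ := by linarith
      nlinarith [mul_le_mul_of_nonneg_left this (neg_nonneg.2 hℓ)]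

/-- The truncated sum with the exact coefficients differs from the full series with the limiting
coefficients by `O(n^{-1/2})`. -/
lemma exists_sum_sub_tsum_le (h : IsDoubleWell f r₁ r₂ d₁ d₂) {M : ℝ} (hM0 : 0 < M) (hM1 : M < 1) :
    ∃ C β ν₀ : ℝ, 0 ≤ C ∧ 0 < β ∧ 0 < ν₀ ∧ ∀ (n : ℕ) (m : ℤ) (x : ℝ) (ζ : ℂ), ν₀ ≤ n → 0 ≤ x →
      x ≤ 1 → (m : ℝ) + x = n * M → ζ ≠ 0 →
      |Real.log ‖ζ‖ - (Real.log r₁ + Real.log r₂)| ≤ β →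
      Summable (fun ℓ : ℤ =>
        ζ ^ ℓ / (szegoDenominator r₁ r₂ d₁ d₂ (2 * ℓ + 1 - 2 * x) : ℂ)) ∧
      ‖∑ j ∈ Finset.range n, ζ ^ ((j : ℤ) - m) *
          (((laplaceCoeff f n (2 * j + 1 - 2 * (n * M)))⁻¹ : ℝ) : ℂ) -
        ∑' ℓ : ℤ, ζ ^ ℓ / (szegoDenominator r₁ r₂ d₁ d₂ (2 * ℓ + 1 - 2 * x) : ℂ)‖ ≤ C / √n ∧
      ‖∑' ℓ : ℤ, ζ ^ ℓ / (szegoDenominator r₁ r₂ d₁ d₂ (2 * ℓ + 1 - 2 * x) : ℂ)‖ ≤ C := by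
  -- Of the decay 4β|ℓ|, one part is lost to the position of |ζ| and two to e^{β|p|}, since |p| ≤
  -- 2|ℓ| + 1. One part remains for summability.
  set β := (Real.log r₂ - Real.log r₁) / 4 with hβdef
  have hβ : 0 < β := by
    have := Real.log_lt_log h.left.1 h.lt
    simp only [hβdef]; linarith
  obtain ⟨C₁, hC₁, hdecay⟩ := h.exists_zpow_div_le (β := β) (by simp only [hβdef]; ring)
  obtain ⟨C₂, ν₀, hC₂, hν₀, hcoeff⟩ := h.exists_inv_laplaceCoeff hβ
  set ε := min M (1 - M)
  have hε : 0 < ε := lt_min hM0 (by linarith)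
  set C₃ := 1 + 1 / (β * ε)
  have hC₃ : 0 ≤ C₃ := by positivity
  set S := ∑' ℓ : ℤ, Real.exp (-(β * |(ℓ : ℝ)|)) with hS
  have hsum := summable_exp_neg_mul_abs hβ
  set C₄ := C₁ * (C₂ + C₃) * Real.exp β
  refine ⟨C₄ * S + C₁ * S, β, ν₀, by positivity, hβ, hν₀,
    fun n m x ζ hn hx0 hx1 hmx hζ hlog => ?_⟩
  have hn0 : 0 < (n : ℝ) := hν₀.trans_le hn
  have hsn : 0 < √(n : ℝ) := Real.sqrt_pos.2 hn0
  have hR : 0 < ‖ζ‖ := norm_pos_iff.2 hζ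
  set P : ℤ → ℝ := fun ℓ => 2 * ℓ + 1 - 2 * x with hP
  set D : ℤ → ℝ := fun ℓ => szegoDenominator r₁ r₂ d₁ d₂ (P ℓ)
  have hDpos : ∀ ℓ, 0 < D ℓ := fun ℓ => h.szegoDenominator_pos _
  set E : ℤ → ℝ := fun ℓ => laplaceCoeff f n (P ℓ) with hE
  set t : ℤ → ℂ := fun ℓ => ζ ^ ℓ / (D ℓ : ℂ) with ht
  set F : ℤ → ℂ := fun ℓ => ζ ^ ℓ * (((E ℓ)⁻¹ : ℝ) : ℂ) with hF
  set b : ℤ → ℂ := fun ℓ => if 0 ≤ ℓ + m ∧ ℓ + m < n then F ℓ else 0 with hb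
  have htnorm : ∀ ℓ, ‖t ℓ‖ = ‖ζ‖ ^ ℓ * (D ℓ)⁻¹ := fun ℓ => by
    simp only [ht]
    rw [norm_div, norm_zpow, Complex.norm_of_nonneg (hDpos ℓ).le, div_eq_mul_inv]
  have htle : ∀ ℓ, ‖t ℓ‖ ≤ C₁ * Real.exp (-(3 * β * |(ℓ : ℝ)|)) := fun ℓ => by
    rw [htnorm]
    exact hdecay x ‖ζ‖ ℓ hx0 hx1 hR hlog
  have htle' : ∀ ℓ, ‖t ℓ‖ ≤ C₁ * Real.exp (-(β * |(ℓ : ℝ)|)) := fun ℓ => by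
    refine (htle ℓ).trans (mul_le_mul_of_nonneg_left (Real.exp_le_exp.2 ?_) hC₁)
    nlinarith [mul_nonneg hβ.le (abs_nonneg (ℓ : ℝ))]
  have htsum : Summable t := Summable.of_norm_bounded (hsum.mul_left C₁) htle'
  have hPle : ∀ ℓ, |P ℓ| ≤ 2 * |(ℓ : ℝ)| + 1 := fun ℓ => by
    simp only [hP]
    rw [abs_le]
    constructor
    · linarith [neg_abs_le (ℓ : ℝ)]
    · linarith [le_abs_self (ℓ : ℝ)]
  have hdiff : ∀ ℓ, ‖b ℓ - t ℓ‖ ≤ (C₂ + C₃) / √n * Real.exp (β * |P ℓ|) * ‖t ℓ‖ := fun ℓ => by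
    have hX : 0 < Real.exp (β * |P ℓ|) := Real.exp_pos _
    by_cases hv : 0 ≤ ℓ + m ∧ ℓ + m < n
    · have e : b ℓ - t ℓ = ζ ^ ℓ * (((E ℓ)⁻¹ - (D ℓ)⁻¹ : ℝ) : ℂ) := by
        simp only [hb, ht, hF, if_pos hv]
        push_cast
        ring
      rw [e, norm_mul, norm_zpow, Complex.norm_real, Real.norm_eq_abs, htnorm]
      have h1 := hcoeff n (P ℓ) hn
      calc ‖ζ‖ ^ ℓ * |(E ℓ)⁻¹ - (D ℓ)⁻¹|
          ≤ ‖ζ‖ ^ ℓ * (C₂ / √n * Real.exp (β * |P ℓ|) * (D ℓ)⁻¹) := by gcongr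
        _ ≤ ‖ζ‖ ^ ℓ * ((C₂ + C₃) / √n * Real.exp (β * |P ℓ|) * (D ℓ)⁻¹) := by
            have := (hDpos ℓ).le
            gcongr
            linarith
        _ = _ := by ring
    · have e : b ℓ - t ℓ = -t ℓ := by simp only [hb, if_neg hv, zero_sub]
      rw [e, norm_neg]
      refine le_mul_of_one_le_left (norm_nonneg _) ?_
      -- An index outside 0 ≤ j < n has |p| at least 2nM or 2n(1-M), so the truncated tail obeys the
      -- same bound as the other terms.
      have hp : ε * n ≤ |P ℓ| := by
        have hε1 : ε * n ≤ M * n := mul_le_mul_of_nonneg_right (min_le_left _ _) hn0.le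
        have hε2 : ε * n ≤ (1 - M) * n := mul_le_mul_of_nonneg_right (min_le_right _ _) hn0.le
        rw [not_and_or, not_le, not_lt] at hv
        simp only [hP]
        rcases hv with hv | hv
        · have : (ℓ : ℝ) + m ≤ -1 := by exact_mod_cast Int.le_sub_one_of_lt hv
          refine le_trans ?_ (neg_le_abs _)
          nlinarith
        · have : (n : ℝ) ≤ (ℓ : ℝ) + m := by exact_mod_cast hv
          refine le_trans ?_ (le_abs_self _)
          nlinarith
      have h1 := one_le_div_sqrt_mul_exp hβ hε hn0 hp
      have h2 : C₃ ≤ C₂ + C₃ := by linarith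
      exact h1.trans (mul_le_mul_of_nonneg_right (div_le_div_of_nonneg_right h2 hsn.le) hX.le)
  have hdiff' : ∀ ℓ, ‖b ℓ - t ℓ‖ ≤ C₄ / √n * Real.exp (-(β * |(ℓ : ℝ)|)) := fun ℓ => by
    calc ‖b ℓ - t ℓ‖ ≤ (C₂ + C₃) / √n * Real.exp (β * |P ℓ|) * ‖t ℓ‖ := hdiff ℓ
      _ ≤ (C₂ + C₃) / √n * Real.exp (β * (2 * |(ℓ : ℝ)| + 1)) *
          (C₁ * Real.exp (-(3 * β * |(ℓ : ℝ)|))) := by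
          gcongr
          · exact hPle ℓ
          · exact htle ℓ
      _ = C₁ * (C₂ + C₃) / √n *
          (Real.exp (β * (2 * |(ℓ : ℝ)| + 1)) * Real.exp (-(3 * β * |(ℓ : ℝ)|))) := by ring
      _ = C₁ * (C₂ + C₃) / √n * (Real.exp β * Real.exp (-(β * |(ℓ : ℝ)|))) := by
          rw [← Real.exp_add, ← Real.exp_add]; ring_nf
      _ = _ := by simp only [C₄]; ring
  have hdsum : Summable fun ℓ => b ℓ - t ℓ :=
    Summable.of_norm_bounded (hsum.mul_left (C₄ / √n)) hdiff'
  have hbsum : Summable b := (hdsum.add htsum).congr fun ℓ => by ring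
  refine ⟨htsum, ?_, ?_⟩
  · have e1 : ∑ j ∈ Finset.range n, ζ ^ ((j : ℤ) - m) *
        (((laplaceCoeff f n (2 * j + 1 - 2 * (n * M)))⁻¹ : ℝ) : ℂ) = ∑' ℓ, b ℓ := by
      rw [hb, ← sum_range_eq_tsum_int m n F]
      refine Finset.sum_congr rfl fun j _ => ?_
      simp only [hF, hE, hP]
      rw [show 2 * (j : ℝ) + 1 - 2 * (n * M) = 2 * ((j - m : ℤ) : ℝ) + 1 - 2 * x by
        push_cast; linarith]
    rw [e1]
    change ‖∑' ℓ, b ℓ - ∑' ℓ, t ℓ‖ ≤ _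
    rw [← hbsum.tsum_sub htsum]
    have h1 := tsum_of_norm_bounded (hsum.mul_left (C₄ / √n)).hasSum hdiff'
    rw [tsum_mul_left, ← hS] at h1
    refine h1.trans ?_
    rw [div_mul_eq_mul_div]
    gcongr
    have : 0 ≤ C₁ * S := by positivity
    linarith
  · have h1 := tsum_of_norm_bounded (hsum.mul_left C₁).hasSum htle'
    rw [tsum_mul_left, ← hS] at h1
    refine h1.trans ?_
    have : 0 ≤ C₄ * S := by positivity
    linarith

end IsDoubleWell

/-! ### The edge factors -/

/-- The factor `r ^ (-x) e^{-n f(r) / 2}` which a point at distance `r` from the origin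
contributes to the correlation kernel. -/
def edgeFactor (f : ℝ → ℝ) (n x r : ℝ) : ℝ := r ^ (-x) * Real.exp (-(n / 2) * f r)

/-- This is the local comparison at the well with ν = n/2 and p = -x. At displacement t/√(2nd) the
Gaussian exponent is t²/2. The constants are uniform because x ∈ [0,1] and |t| ≤ T. -/
lemma IsWell.exists_edgeFactor {f : ℝ → ℝ} {ρ d : ℝ} (h : IsWell f ρ d) {T : ℝ} (hT : 0 ≤ T) :
    ∃ C ν₀ : ℝ, 0 ≤ C ∧ 0 < ν₀ ∧ ∀ n t x : ℝ, ν₀ ≤ n → |t| ≤ T → 0 ≤ x → x ≤ 1 →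
      0 < ρ + t / √(2 * n * d) ∧
      |Real.log (ρ + t / √(2 * n * d)) - Real.log ρ| ≤ C / √n ∧
      |edgeFactor f n x (ρ + t / √(2 * n * d)) - ρ ^ (-x) * Real.exp (-(1 / 2) * t ^ 2)| ≤
        C / √n ∧
      |ρ ^ (-x) * Real.exp (-(1 / 2) * t ^ 2)| ≤ C := by
  obtain ⟨C₁, δ, hC₁, hδ, hδρ, hnear⟩ := h.exists_near one_pos
  obtain ⟨hρ, hd, -⟩ := h
  have hs : 0 < √(2 * d) := Real.sqrt_pos.2 (by positivity)
  set K := T / √(2 * d) with hK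
  set L := Real.exp |Real.log ρ|
  have hL : 0 < L := Real.exp_pos _
  set C₂ := C₁ * (L * Real.exp 1)
  refine ⟨2 / ρ * K + C₂ * K + L, (K / δ) ^ 2 + 1, by positivity, by positivity,
    fun n t x hn ht hx0 hx1 => ?_⟩
  have hn0 : 0 < n := (by positivity : 0 < (K / δ) ^ 2 + 1).trans_le hn
  have hsn : 0 < √n := Real.sqrt_pos.2 hn0
  have hsq : √(2 * n * d) = √(2 * d) * √n := by
    rw [← Real.sqrt_mul (by positivity)]; ring_nf
  have hu : |t / √(2 * n * d)| ≤ K / √n := by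
    rw [hsq, abs_div, abs_of_pos (mul_pos hs hsn), ← div_div, hK]
    gcongr
  have hKδ : K / √n < δ := by
    rw [div_lt_iff₀ hsn, mul_comm, ← div_lt_iff₀ hδ]
    exact Real.lt_sqrt_of_sq_lt (by linarith)
  set u := t / √(2 * n * d) with hudef
  have hru : ρ + u - ρ = u := by ring
  have hlt : |ρ + u - ρ| < δ := by rw [hru]; exact hu.trans_lt hKδ
  have hr0 : 0 < ρ + u := by linarith [(abs_lt.1 (hu.trans_lt hKδ)).1]
  have hρx : ρ ^ (-x) ≤ L := by
    refine (rpow_le_exp_abs_mul hρ (-x)).trans (Real.exp_le_exp.2 ?_)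
    rw [abs_neg, abs_of_nonneg hx0]
    exact mul_le_of_le_one_left (abs_nonneg _) hx1
  have hterm1 : 0 ≤ 2 / ρ * K / √n := by positivity
  have hterm2 : 0 ≤ C₂ * K / √n := by positivity
  have hterm3 : 0 ≤ L / √n := by positivity
  have hsplit : (2 / ρ * K + C₂ * K + L) / √n = 2 / ρ * K / √n + C₂ * K / √n + L / √n := by ring
  refine ⟨hr0, ?_, ?_, ?_⟩
  · have h1 := abs_log_div_le hρ (hlt.le.trans hδρ)
    rw [Real.log_div hr0.ne' hρ.ne', hru] at h1
    have h2 : 2 / ρ * |u| ≤ 2 / ρ * K / √n := by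
      rw [mul_div_assoc]; gcongr
    rw [hsplit]
    linarith
  · have h1 := (hnear (ρ + u) hlt).2 (n / 2) (-x) (by positivity)
    have hg : wellGaussian ρ d (n / 2) (ρ + u) = Real.exp (-(1 / 2) * t ^ 2) := by
      rw [wellGaussian, hru, hudef, div_pow, Real.sq_sqrt (by positivity)]
      congr 1
      field_simp
    have he : wellError ρ d (n / 2) (ρ + u) ≤ K / √n := by
      rw [wellError, hru]
      refine (mul_le_of_le_one_right (abs_nonneg _) (Real.exp_le_one_iff.2 ?_)).trans hu
      have : 0 ≤ d / 2 * (n / 2) * u ^ 2 := by positivity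
      linarith
    rw [hg] at h1
    rw [edgeFactor]
    refine h1.trans ?_
    have hx1' : Real.exp (1 * |-x|) ≤ Real.exp 1 := by
      rw [one_mul, abs_neg, abs_of_nonneg hx0]
      exact Real.exp_le_exp.2 hx1
    calc C₁ * (ρ ^ (-x) * Real.exp (1 * |-x|)) * wellError ρ d (n / 2) (ρ + u)
        ≤ C₁ * (L * Real.exp 1) * (K / √n) := by
          have := wellError_nonneg ρ d (n / 2) (ρ + u)
          gcongr
      _ = C₂ * K / √n := by simp only [C₂]; ring
      _ ≤ _ := by rw [hsplit]; linarith
  · rw [abs_of_pos (by positivity)]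
    have h1 : Real.exp (-(1 / 2) * t ^ 2) ≤ 1 := Real.exp_le_one_iff.2 (by nlinarith [sq_nonneg t])
    have h2 : ρ ^ (-x) * Real.exp (-(1 / 2) * t ^ 2) ≤ L := by
      calc _ ≤ L * 1 := mul_le_mul hρx h1 (Real.exp_pos _).le hL.le
        _ = L := mul_one L
    have : 0 ≤ 2 / ρ * K + C₂ * K := by positivity
    linarith

/-! ### Factorization of the kernel -/

lemma polar_mul_conj_polar (r s θ₁ θ₂ : ℝ) :
    ((r : ℂ) * Complex.exp (Complex.I * θ₁)) * conj ((s : ℂ) * Complex.exp (Complex.I * θ₂)) =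
      ((r * s : ℝ) : ℂ) * Complex.exp (Complex.I * ((θ₁ : ℂ) - θ₂)) := by
  rw [map_mul, Complex.conj_ofReal, ← Complex.exp_conj, map_mul, Complex.conj_I,
    Complex.conj_ofReal, mul_sub, sub_eq_add_neg, Complex.exp_add]
  push_cast
  ring_nf

lemma norm_polar {r : ℝ} (hr : 0 < r) (θ : ℝ) :
    ‖(r : ℂ) * Complex.exp (Complex.I * θ)‖ = r := by
  rw [norm_mul, Complex.norm_of_nonneg hr.le, mul_comm Complex.I, Complex.norm_exp_ofReal_mul_I,
    mul_one]

/-- The effective potential absorbs r^{nM}, whereas only the integer power m = nM - x is available;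
the mismatch is the factor r^{-x}. -/
lemma zpow_mul_exp_eq_edgeFactor (q : ℝ → ℝ) (c : ℝ) {M x r : ℝ} {n : ℕ} {m : ℤ} (hr : 0 < r)
    (hmx : (m : ℝ) + x = n * M) :
    r ^ m * Real.exp (-((n : ℝ) / 2) * q r) =
      edgeFactor (gapPotential q M c) n x r * Real.exp (-(n * c / 2)) := by
  rw [edgeFactor, gapPotential_of_nonneg q M c hr.le, ← Real.rpow_intCast, Real.rpow_def_of_pos hr,
    Real.rpow_def_of_pos hr, ← Real.exp_add, ← Real.exp_add, ← Real.exp_add]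
  congr 1
  linear_combination Real.log r * hmx

/-- The correlation kernel in terms of normalized Laplace integrals. -/
lemma correlationKernel_polar (q : ℝ → ℝ) (c : ℝ) {M x r s : ℝ} {n : ℕ} {m : ℤ} (hn : 0 < n)
    (hr : 0 < r) (hs : 0 < s) (hmx : (m : ℝ) + x = n * M) (θ₁ θ₂ : ℝ) :
    correlationKernel (radialPotential q) n ((r : ℂ) * Complex.exp (Complex.I * θ₁))
        ((s : ℂ) * Complex.exp (Complex.I * θ₂)) =
      ((√(n / (2 * π)) * (edgeFactor (gapPotential q M c) n x r *
        edgeFactor (gapPotential q M c) n x s) : ℝ) : ℂ) *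
      Complex.exp (Complex.I * (m : ℂ) * ((θ₁ : ℂ) - θ₂)) *
      ∑ j ∈ Finset.range n,
        (((r : ℂ) * Complex.exp (Complex.I * θ₁)) *
          conj ((s : ℂ) * Complex.exp (Complex.I * θ₂))) ^ ((j : ℤ) - m) *
        (((laplaceCoeff (gapPotential q M c) n (2 * j + 1 - 2 * (n * M)))⁻¹ : ℝ) : ℂ) := by
  rw [correlationKernel, Finset.mul_sum]
  refine Finset.sum_congr rfl fun j _ => ?_
  rw [integral_norm_sq_weightedMonomial q M c n j]
  set z := (r : ℂ) * Complex.exp (Complex.I * θ₁)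
  set w := (s : ℂ) * Complex.exp (Complex.I * θ₂)
  have hnz : ‖z‖ = r := norm_polar hr θ₁
  have hnw : ‖w‖ = s := norm_polar hs θ₂
  have hζ : z * conj w = ((r * s : ℝ) : ℂ) * Complex.exp (Complex.I * ((θ₁ : ℂ) - θ₂)) :=
    polar_mul_conj_polar r s θ₁ θ₂
  have hζ0 : z * conj w ≠ 0 := by
    rw [hζ]
    exact mul_ne_zero (Complex.ofReal_ne_zero.2 (mul_pos hr hs).ne') (Complex.exp_ne_zero _)
  set J := ∫ r in Set.Ioi (0 : ℝ), laplaceIntegrand (gapPotential q M c) n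
    (2 * j + 1 - 2 * (n * M)) r with hJ
  -- Extracting the m-th power of z w̄ from every term produces the phase e^{im(θ₁-θ₂)} and centres
  -- the sum at ℓ = 0.
  have hpow : z ^ j * conj (w ^ j) = ((r ^ m * s ^ m : ℝ) : ℂ) *
      Complex.exp (Complex.I * (m : ℂ) * ((θ₁ : ℂ) - θ₂)) * (z * conj w) ^ ((j : ℤ) - m) := by
    have e1 : z ^ j * conj (w ^ j) = (z * conj w) ^ (m + ((j : ℤ) - m)) := by
      rw [add_sub_cancel, zpow_natCast, map_pow, ← mul_pow]
    have e2 : (z * conj w) ^ m = ((r ^ m * s ^ m : ℝ) : ℂ) *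
        Complex.exp (Complex.I * (m : ℂ) * ((θ₁ : ℂ) - θ₂)) := by
      rw [hζ, mul_zpow, ← Complex.exp_int_mul, ← mul_zpow]
      push_cast
      ring_nf
    rw [e1, zpow_add₀ hζ0, e2]
  have hreal : r ^ m * s ^ m * (Real.exp (-((n : ℝ) / 2) * q r) * Real.exp (-((n : ℝ) / 2) * q s)) *
      (Real.exp (-(n * c)) * (2 * J))⁻¹ =
      √(n / (2 * π)) * (edgeFactor (gapPotential q M c) n x r *
        edgeFactor (gapPotential q M c) n x s) *
        (laplaceCoeff (gapPotential q M c) n (2 * j + 1 - 2 * (n * M)))⁻¹ := by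
    have h1 := zpow_mul_exp_eq_edgeFactor q c hr hmx
    have h2 := zpow_mul_exp_eq_edgeFactor q c hs hmx
    have h3 : Real.exp (-(n * c / 2)) * Real.exp (-(n * c / 2)) = Real.exp (-(n * c)) := by
      rw [← Real.exp_add]; ring_nf
    have hsq : √(n / (2 * π)) ≠ 0 := (Real.sqrt_pos.2 (by positivity)).ne'
    rw [laplaceCoeff, ← hJ]
    calc _ = (r ^ m * Real.exp (-((n : ℝ) / 2) * q r)) * (s ^ m * Real.exp (-((n : ℝ) / 2) * q s)) *
          (Real.exp (-(n * c)) * (2 * J))⁻¹ := by ring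
      _ = edgeFactor (gapPotential q M c) n x r * edgeFactor (gapPotential q M c) n x s *
          (Real.exp (-(n * c / 2)) * Real.exp (-(n * c / 2))) *
          (Real.exp (-(n * c)) * (2 * J))⁻¹ := by rw [h1, h2]; ring
      _ = edgeFactor (gapPotential q M c) n x r * edgeFactor (gapPotential q M c) n x s *
          (Real.exp (-(n * c)) * (Real.exp (-(n * c)))⁻¹) * (2 * J)⁻¹ := by
          rw [h3, mul_inv]; ring
      _ = edgeFactor (gapPotential q M c) n x r * edgeFactor (gapPotential q M c) n x s *
          (√(n / (2 * π)) * (√(n / (2 * π)))⁻¹) * (2 * J)⁻¹ := by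
          rw [mul_inv_cancel₀ (Real.exp_pos _).ne', mul_inv_cancel₀ hsq]
      _ = _ := by rw [mul_inv (√(n / (2 * π)))]; ring
  have hterm : weightedMonomial (radialPotential q) n j z *
      conj (weightedMonomial (radialPotential q) n j w) / ((Real.exp (-(n * c)) * (2 * J) : ℝ) : ℂ) =
      (z ^ j * conj (w ^ j)) * ((Real.exp (-((n : ℝ) / 2) * q r) *
        Real.exp (-((n : ℝ) / 2) * q s) * (Real.exp (-(n * c)) * (2 * J))⁻¹ : ℝ) : ℂ) := by
    simp only [weightedMonomial, radialPotential, hnz, hnw, map_mul, Complex.conj_ofReal]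
    push_cast
    ring
  rw [hterm, hpow]
  have hreal' := congrArg (fun y : ℝ => (y : ℂ)) hreal
  calc _ = (((r ^ m * s ^ m * (Real.exp (-((n : ℝ) / 2) * q r) *
        Real.exp (-((n : ℝ) / 2) * q s)) * (Real.exp (-(n * c)) * (2 * J))⁻¹ : ℝ)) : ℂ) *
        (Complex.exp (Complex.I * (m : ℂ) * ((θ₁ : ℂ) - θ₂)) * (z * conj w) ^ ((j : ℤ) - m)) := by
        push_cast
        ring
    _ = _ := by
        rw [hreal']
        push_cast
        ring

/-! ### Perturbation of products -/

lemma norm_mul_sub_mul_le {a a' : ℝ} {S S' : ℂ} {C₁ C₂ C₃ ε : ℝ} (h1 : |a - a'| ≤ C₁ * ε)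
    (h2 : |a'| ≤ C₂) (h3 : ‖S - S'‖ ≤ C₃ * ε) (h4 : ‖S'‖ ≤ C₃) (hC₁ : 0 ≤ C₁) (hC₃ : 0 ≤ C₃)
    (hε0 : 0 ≤ ε) (hε1 : ε ≤ 1) :
    ‖(a : ℂ) * S - (a' : ℂ) * S'‖ ≤ (C₁ * (2 * C₃) + C₂ * C₃) * ε := by
  have hS : ‖S‖ ≤ 2 * C₃ := by
    have e : S = (S - S') + S' := by ring
    rw [e]
    refine (norm_add_le _ _).trans ?_
    have := mul_le_of_le_one_right hC₃ hε1
    linarith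
  have e : (a : ℂ) * S - (a' : ℂ) * S' = ((a - a' : ℝ) : ℂ) * S + (a' : ℂ) * (S - S') := by
    push_cast; ring
  rw [e]
  refine (norm_add_le _ _).trans ?_
  rw [norm_mul, norm_mul, Complex.norm_real, Complex.norm_real, Real.norm_eq_abs, Real.norm_eq_abs]
  calc |a - a'| * ‖S‖ + |a'| * ‖S - S'‖ ≤ (C₁ * ε) * (2 * C₃) + C₂ * (C₃ * ε) := by
        refine add_le_add (mul_le_mul h1 hS (norm_nonneg _) (by positivity)) ?_
        exact mul_le_mul h2 h3 (norm_nonneg _) ((abs_nonneg _).trans h2)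
    _ = _ := by ring

lemma abs_mul_sub_mul_le {a a' b b' C₁ C₂ ε : ℝ} (h1 : |a - a'| ≤ C₁ * ε) (h2 : |b - b'| ≤ C₂ * ε)
    (h3 : |a'| ≤ C₁) (h4 : |b'| ≤ C₂) (hC₁ : 0 ≤ C₁) (hC₂ : 0 ≤ C₂) (hε0 : 0 ≤ ε) (hε1 : ε ≤ 1) :
    |a * b - a' * b'| ≤ 3 * (C₁ * C₂) * ε := by
  have hb : |b| ≤ 2 * C₂ := by
    have e : b = (b - b') + b' := by ring
    rw [e]
    refine (abs_add_le _ _).trans ?_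
    have := mul_le_of_le_one_right hC₂ hε1
    linarith
  have e : a * b - a' * b' = (a - a') * b + a' * (b - b') := by ring
  rw [e]
  refine (abs_add_le _ _).trans ?_
  rw [abs_mul, abs_mul]
  calc |a - a'| * |b| + |a'| * |b - b'| ≤ (C₁ * ε) * (2 * C₂) + C₁ * (C₂ * ε) := by
        refine add_le_add (mul_le_mul h1 hb (abs_nonneg _) (by positivity)) ?_
        exact mul_le_mul h3 h2 (abs_nonneg _) hC₁
    _ = _ := by ring

end CoulombGas

end

/-! ### The kernel asymptotics across the gap -/

open CoulombGas

theorem corollary1p15 (q : ℝ → ℝ) (σ : Measure ℂ) (N : ℕ) (a b : ℕ → ℝ)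
    (hQ : IsAnnularPotential q σ N a b)
    (k : ℕ) (hk : k < N) (r₁ r₂ : ℝ) (hr₁ : r₁ = b k) (hr₂ : r₂ = a (k + 1))
    (hsmooth : SmoothNear 6 (radialPotential q) (frontier (gap r₁ r₂)))
    (θ₁ θ₂ : ℝ) (hθ₁ : 0 ≤ θ₁ ∧ θ₁ < 2 * π) (hθ₂ : 0 ≤ θ₂ ∧ θ₂ < 2 * π)
    (T : Set ℝ) (hT : IsCompact T) :
    ∃ C : ℝ, ∀ᶠ n : ℕ in atTop, ∀ s ∈ T, ∀ t ∈ T,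
      Summable (szegoTerm q r₁ r₂ n (edgePoint q r₁ n θ₁ t) (edgePoint q r₂ n θ₂ s)) ∧
      ‖correlationKernel (radialPotential q) n
            (edgePoint q r₁ n θ₁ t) (edgePoint q r₂ n θ₂ s) -
          (√(2 * π * n) : ℂ) *
            szegoKernel q r₁ r₂ n (edgePoint q r₁ n θ₁ t) (edgePoint q r₂ n θ₂ s) *
            Complex.exp (Complex.I * (gapFloor q r₁ r₂ n : ℂ) * ((θ₁ : ℂ) - (θ₂ : ℂ))) *
            (((r₁ * r₂) ^ (-gapFract q r₁ r₂ n) : ℝ) : ℂ) *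
            (Real.exp (-(1 / 2) * (t ^ 2 + s ^ 2)) : ℂ)‖
        ≤ C * Real.log n ^ 3 := by
  subst hr₁ hr₂
  obtain ⟨M, c, hM0, hM1, hB, hW⟩ := hQ.exists_isDoubleWell hk hsmooth
  obtain ⟨R, hR⟩ := hT.isBounded.exists_norm_le
  set T₀ := max R 0
  have hT₀ : ∀ t ∈ T, |t| ≤ T₀ := fun t ht => (hR t ht).trans (le_max_left _ _)
  set r₁ := b k
  set r₂ := a (k + 1)
  set d₁ := quarterLaplacian (radialPotential q) (r₁ : ℂ)
  set d₂ := quarterLaplacian (radialPotential q) (r₂ : ℂ)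
  set f := gapPotential q M c
  have hr₁ : 0 < r₁ := hW.left.1
  have hr₂ : 0 < r₂ := hW.right.1
  obtain ⟨C₁, ν₁, hC₁, hν₁, hedge₁⟩ := hW.left.exists_edgeFactor (le_max_right R 0)
  obtain ⟨C₂, ν₂, hC₂, hν₂, hedge₂⟩ := hW.right.exists_edgeFactor (le_max_right R 0)
  obtain ⟨C₃, β, ν₃, hC₃, hβ, hν₃, hsum⟩ := hW.exists_sum_sub_tsum_le hM0 hM1
  set C₄ := 3 * (C₁ * C₂) * (2 * C₃) + C₁ * C₂ * C₃
  have hC₄ : 0 ≤ C₄ := by positivity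
  refine ⟨C₄, ?_⟩
  -- The squared term brings log|z w̄| within β of log r₁ + log r₂; `Real.exp 1` ensures log n ≥ 1.
  -- All thresholds are independent of s and t.
  have hlarge : ∀ᶠ n : ℕ in atTop, max (max (max ν₁ ν₂) (max ν₃ (((C₁ + C₂) / β) ^ 2)))
      (Real.exp 1) ≤ (n : ℝ) := tendsto_natCast_atTop_atTop.eventually_ge_atTop _
  filter_upwards [hlarge] with n hn s hs t ht
  have hn1 : ν₁ ≤ n :=
    (le_max_left _ _).trans ((le_max_left _ _).trans ((le_max_left _ _).trans hn))
  have hn2 : ν₂ ≤ n :=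
    (le_max_right _ _).trans ((le_max_left _ _).trans ((le_max_left _ _).trans hn))
  have hn3 : ν₃ ≤ n :=
    (le_max_left _ _).trans ((le_max_right _ _).trans ((le_max_left _ _).trans hn))
  have hn4 : ((C₁ + C₂) / β) ^ 2 ≤ n :=
    (le_max_right _ _).trans ((le_max_right _ _).trans ((le_max_left _ _).trans hn))
  have hn5 : Real.exp 1 ≤ n := (le_max_right _ _).trans hn
  have hn0 : 0 < (n : ℝ) := hν₁.trans_le hn1
  have hsn : 0 < √(n : ℝ) := Real.sqrt_pos.2 hn0
  have hlogn : 1 ≤ Real.log n := (Real.le_log_iff_exp_le hn0).2 hn5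
  have hn1' : 1 ≤ (n : ℝ) := (Real.one_le_exp zero_le_one).trans hn5
  set ε := (√(n : ℝ))⁻¹ with hε
  have hε0 : 0 ≤ ε := by positivity
  have hε1 : ε ≤ 1 := inv_le_one_of_one_le₀ (Real.one_le_sqrt.2 hn1')
  set x := gapFract q r₁ r₂ n with hx
  set m := gapFloor q r₁ r₂ n with hm
  have hx0 : 0 ≤ x := Int.fract_nonneg _
  have hx1 : x ≤ 1 := (Int.fract_lt_one _).le
  have hmx : (m : ℝ) + x = n * M := by
    rw [hm, hx, gapFloor, gapFract, Int.floor_add_fract, hB]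
    ring
  obtain ⟨hp₁, hl₁, he₁, hb₁⟩ := hedge₁ n t x hn1 (hT₀ t ht) hx0 hx1
  obtain ⟨hp₂, hl₂, he₂, hb₂⟩ := hedge₂ n s x hn2 (hT₀ s hs) hx0 hx1
  set ρ₁ := r₁ + t / √(2 * n * d₁)
  set ρ₂ := r₂ + s / √(2 * n * d₂)
  have hz : edgePoint q r₁ n θ₁ t = (ρ₁ : ℂ) * Complex.exp (Complex.I * θ₁) := rfl
  have hw : edgePoint q r₂ n θ₂ s = (ρ₂ : ℂ) * Complex.exp (Complex.I * θ₂) := rfl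
  set z := edgePoint q r₁ n θ₁ t
  set w := edgePoint q r₂ n θ₂ s
  have hnz : ‖z‖ = ρ₁ := by rw [hz]; exact norm_polar hp₁ θ₁
  have hnw : ‖w‖ = ρ₂ := by rw [hw]; exact norm_polar hp₂ θ₂
  have hnζ : ‖z * conj w‖ = ρ₁ * ρ₂ := by rw [norm_mul, RCLike.norm_conj, hnz, hnw]
  have hζ0 : z * conj w ≠ 0 := by
    rw [← norm_pos_iff, hnζ]; exact mul_pos hp₁ hp₂
  have hlogζ : |Real.log ‖z * conj w‖ - (Real.log r₁ + Real.log r₂)| ≤ β := by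
    rw [hnζ, Real.log_mul hp₁.ne' hp₂.ne']
    have e : Real.log ρ₁ + Real.log ρ₂ - (Real.log r₁ + Real.log r₂) =
        (Real.log ρ₁ - Real.log r₁) + (Real.log ρ₂ - Real.log r₂) := by ring
    rw [e]
    refine (abs_add_le _ _).trans ((add_le_add hl₁ hl₂).trans ?_)
    rw [← add_div, div_le_iff₀ hsn, ← div_le_iff₀' hβ]
    exact Real.le_sqrt_of_sq_le hn4
  obtain ⟨hsummable, hdiff, hbound⟩ := hsum n m x (z * conj w) hn3 hx0 hx1 hmx hζ0 hlogζ
  refine ⟨hsummable, ?_⟩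
  have hK := correlationKernel_polar q c (Nat.cast_pos.1 hn0) hp₁ hp₂ hmx θ₁ θ₂
  rw [← hz, ← hw] at hK
  set S₁ := ∑ j ∈ Finset.range n, (z * conj w) ^ ((j : ℤ) - m) *
    (((laplaceCoeff f n (2 * j + 1 - 2 * (n * M)))⁻¹ : ℝ) : ℂ)
  have hSz : szegoKernel q r₁ r₂ n z w = 1 / (2 * (π : ℂ)) * ∑' ℓ : ℤ, (z * conj w) ^ ℓ /
      (szegoDenominator r₁ r₂ d₁ d₂ (2 * ℓ + 1 - 2 * x) : ℂ) := rfl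
  set S₂ := ∑' ℓ : ℤ, (z * conj w) ^ ℓ /
      (szegoDenominator r₁ r₂ d₁ d₂ (2 * ℓ + 1 - 2 * x) : ℂ)
  set g₁ := r₁ ^ (-x) * Real.exp (-(1 / 2) * t ^ 2)
  set g₂ := r₂ ^ (-x) * Real.exp (-(1 / 2) * s ^ 2)
  set e₁ := edgeFactor f n x ρ₁
  set e₂ := edgeFactor f n x ρ₂
  have hg : ((r₁ * r₂) ^ (-x)) * Real.exp (-(1 / 2) * (t ^ 2 + s ^ 2)) = g₁ * g₂ := by
    rw [Real.mul_rpow hr₁.le hr₂.le, mul_add, Real.exp_add]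
    simp only [g₁, g₂]
    ring
  have hsqrt : √(2 * π * n) * (1 / (2 * π)) = √(n / (2 * π)) := by
    rw [show (2 * π * n : ℝ) = (2 * π) ^ 2 * (n / (2 * π)) by field_simp,
      Real.sqrt_mul (by positivity), Real.sqrt_sq (by positivity)]
    field_simp
  have hgC : ((((r₁ * r₂) ^ (-x) : ℝ) : ℂ)) * (Real.exp (-(1 / 2) * (t ^ 2 + s ^ 2)) : ℂ) =
      ((g₁ * g₂ : ℝ) : ℂ) := by
    rw [← hg]; push_cast; ring
  have hsqrtC : (√(2 * π * n) : ℂ) * (1 / (2 * (π : ℂ))) = ((√(n / (2 * π)) : ℝ) : ℂ) := by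
    rw [← hsqrt]; push_cast; ring
  have hprod := abs_mul_sub_mul_le (C₁ := C₁) (C₂ := C₂) (by rwa [hε, ← div_eq_mul_inv])
    (by rwa [hε, ← div_eq_mul_inv]) hb₁ hb₂ hC₁ hC₂ hε0 hε1 (ε := ε) (a := e₁) (b := e₂)
    (a' := g₁) (b' := g₂)
  have hgabs : |g₁ * g₂| ≤ C₁ * C₂ := by
    rw [abs_mul]; exact mul_le_mul hb₁ hb₂ (abs_nonneg _) hC₁
  have hmain := norm_mul_sub_mul_le (S := S₁) (S' := S₂) hprod hgabs
    (by rw [hε, ← div_eq_mul_inv]; exact hdiff) hbound (by positivity) hC₃ hε0 hε1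
  set Φ := Complex.exp (Complex.I * (m : ℂ) * ((θ₁ : ℂ) - (θ₂ : ℂ)))
  have hΦ : ‖Φ‖ = 1 := by
    have : Complex.I * (m : ℂ) * ((θ₁ : ℂ) - (θ₂ : ℂ)) =
        ((m * (θ₁ - θ₂) : ℝ) : ℂ) * Complex.I := by push_cast; ring
    simp only [Φ]
    rw [this, Complex.norm_exp_ofReal_mul_I]
  -- Both sides share the prefactor √(n/2π) and the unimodular phase, so only edge factors times
  -- series are compared.
  have hfinal : correlationKernel (radialPotential q) n z w -
      (√(2 * π * n) : ℂ) * szegoKernel q r₁ r₂ n z w * Φ * (((r₁ * r₂) ^ (-x) : ℝ) : ℂ) *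
        (Real.exp (-(1 / 2) * (t ^ 2 + s ^ 2)) : ℂ) =
      ((√(n / (2 * π)) : ℝ) : ℂ) * Φ *
        (((e₁ * e₂ : ℝ) : ℂ) * S₁ - ((g₁ * g₂ : ℝ) : ℂ) * S₂) := by
    rw [hK, hSz, ← hgC, ← hsqrtC, Complex.ofReal_mul (√(n / (2 * π))), ← hsqrtC]
    ring
  rw [hfinal, norm_mul, norm_mul, hΦ, mul_one, Complex.norm_of_nonneg (Real.sqrt_nonneg _)]
  have hsle : √(n / (2 * π)) ≤ √n := Real.sqrt_le_sqrt (div_le_self hn0.le (by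
    linarith [Real.pi_gt_three]))
  calc √(n / (2 * π)) * ‖((e₁ * e₂ : ℝ) : ℂ) * S₁ - ((g₁ * g₂ : ℝ) : ℂ) * S₂‖
      ≤ √n * (C₄ * ε) := mul_le_mul hsle hmain (norm_nonneg _) hsn.le
    _ = C₄ * (√n * (√n)⁻¹) := by rw [hε]; ring
    _ = C₄ := by rw [mul_inv_cancel₀ hsn.ne', mul_one]
    -- The error is already bounded; the logarithm enters only through log n ≥ 1.
    _ ≤ C₄ * Real.log n ^ 3 := le_mul_of_one_le_right hC₄ (one_le_pow₀ hlogn)
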